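/- Let $\mathcal P_2$ be the set of polynomial matrices $$\zeta=\begin{pmatrix}\alpha\lambda-\bar\alpha\lambda^2&-\gamma^{-1}+\beta\lambda-\gamma\lambda^2\\ \gamma\lambda-\bar\beta\lambda^2+\gamma^{-1}\lambda^3&-\alpha\lambda+\bar\alpha\lambda^2\end{pmatrix},\qquad \alpha,\beta\in\mathbb C,\ \gamma\in\mathbb R,\ \gamma>0,$$ regarded through $(\alpha,\beta,\gamma)$ as an open subset of the real vector space $\mathbb C\times\mathbb C\times\mathbb R$, and consider on $\mathcal P_2$ the Lax vector fields $\partial_x\zeta=[\zeta,U(\zeta)]$ and $\partial_y\zeta=[\zeta,V(\zeta)]$, where $$U(\zeta)=\begin{pmatrix}\frac{\alpha-\bar\alpha}2&-\gamma^{-1}\lambda^{-1}-\gamma\\ \gamma+\gamma^{-1}\lambda&\frac{\bar\alpha-\alpha}2\end{pmatrix},\qquad V(\zeta)=i\begin{pmatrix}\frac{\alpha+\bar\alpha}2&-\gamma^{-1}\lambda^{-1}+\gamma\\ \gamma-\gamma^{-1}\lambda&-\frac{\alpha+\bar\alpha}2\end{pmatrix}.$$ For a polynomial $a\in\mathbb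 C[\lambda]$ let $I(a)=\{\zeta\in\mathcal P_2\mid\det\zeta=\lambda\,a(\lambda)\}$, and let $\mathcal M_2$ be the set of all $a$ with $I(a)\neq\emptyset$; every such $a$ has degree $4$. There is a continuous action $\phi$ of the group $\mathbb R^2$ on $\mathcal P_2$ such that for every $\zeta\in\mathcal P_2$ the map $(x,y)\mapsto\phi(x,y)\zeta$ solves both Lax equations on all of $\mathbb R^2$, and such that every solution $c$ of the first (respectively second) Lax equation on an open interval containing $0$ is given there by $c(t)=\phi(t,0)c(0)$ (respectively $c(t)=\phi(0,t)c(0)$). For every $a\in\mathbb C[\lambda]$ the set $I(a)$ is compact. Moreover, for $a\in\mathcal M_2$: 1. If $a$ has four pairwise distinct simple roots, none of them on the unit circle $\mathbb S^1$, then $I(a)$ is a $2$-dimensional (compact) submanifold of $\mathcal P_2$, $I(a)=\{\phi(x,y)\zeta\mid(x,y)\in\mathbb R^2\}$ for every $\zeta\in I(a)$, and $I(a)$ is homeomorphic to the torus $\mathbb S^1\times\mathbb S^1$. 2. If $a$ has one double root on $\mathbb S^1$ and two distinct simple roots off $\mathbb S^1$, then $I(a)$ is a $1$-dimensional (compact)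 submanifold of $\mathcal P_2$, and $I(a)=\{\phi(x,y)\zeta\mid(x,y)\in\mathbb R^2\}$ for every $\zeta\in I(a)$. 3. If $a$ has two distinct double roots on $\mathbb S^1$ or a fourth-order root on $\mathbb S^1$, then $I(a)$ consists of a single point, and this point is fixed by the action $\phi$. 4. If $a$ has two distinct double roots, both off $\mathbb S^1$, let $\lambda_1$ be either of them, and put $$K_a=\{\zeta\in I(a)\mid\zeta(\lambda)\neq0\text{ for all }\lambda\in\mathbb C\},\qquad L_a=\{\zeta\in I(a)\mid\zeta(\lambda_1)=0\}.$$ Then $I(a)$ is the disjoint union of $K_a$ and $L_a$; the set $K_a$ is a single orbit of $\phi$, a non-compact $2$-dimensional submanifold of $\mathcal P_2$, and its closure is $I(a)$; and $L_a$ is a single point, which is fixed by $\phi$. Here a $k$-dimensional submanifold means a smooth embedded one. -/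

import Mathlib

open Polynomial
open scoped ContDiff ComplexConjugate

noncomputable section

/-- The space of potentials, in the coordinates `(α, β, γ)` with `α, β ∈ ℂ` and `γ > 0`.
It is an open subset of the real vector space `ℂ × ℂ × ℝ` and carries the subspace topology. -/
abbrev Potential : Type := {p : ℂ × ℂ × ℝ // 0 < p.2.2}

namespace Potential

def α (ζ : Potential) : ℂ := ζ.1.1

def β (ζ : Potential) : ℂ := ζ.1.2.1

/-- The real parameter `γ`, regarded as a complex number. -/
def γ (ζ : Potential) : ℂ := ((ζ.1.2.2 : ℝ) : ℂ)

/-- The matrix-valued polynomial `ζ(λ)`; the variable `X` stands for `λ`. -/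
def toMatrix (ζ : Potential) : Matrix (Fin 2) (Fin 2) ℂ[X] :=
  !![C ζ.α * X - C (conj ζ.α) * X ^ 2, -C (ζ.γ⁻¹) + C ζ.β * X - C ζ.γ * X ^ 2;
     C ζ.γ * X - C (conj ζ.β) * X ^ 2 + C (ζ.γ⁻¹) * X ^ 3, -C ζ.α * X + C (conj ζ.α) * X ^ 2]

/-- The value of the polynomial `ζ` at `z`. -/
def evalAt (ζ : Potential) (z : ℂ) : Matrix (Fin 2) (Fin 2) ℂ :=
  ζ.toMatrix.map (Polynomial.eval z)

/-- The value at `z ≠ 0` of the Laurent polynomial `U(ζ)`. -/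
def laxU (ζ : Potential) (z : ℂ) : Matrix (Fin 2) (Fin 2) ℂ :=
  !![(ζ.α - conj ζ.α) / 2, -ζ.γ⁻¹ * z⁻¹ - ζ.γ;
     ζ.γ + ζ.γ⁻¹ * z, (conj ζ.α - ζ.α) / 2]

/-- The value at `z ≠ 0` of the Laurent polynomial `V(ζ)`. -/
def laxV (ζ : Potential) (z : ℂ) : Matrix (Fin 2) (Fin 2) ℂ :=
  Complex.I • !![(ζ.α + conj ζ.α) / 2, -ζ.γ⁻¹ * z⁻¹ + ζ.γ;
                 ζ.γ - ζ.γ⁻¹ * z, -((ζ.α + conj ζ.α) / 2)]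

end Potential

/-- The curve `c` of potentials satisfies the Lax equation `dζ/dt = [ζ, W(ζ)]` at time `t`,
as an identity of (Laurent) polynomials in `λ`, that is, for all `λ ∈ ℂ \ {0}`. -/
def SatisfiesLaxAt (W : Potential → ℂ → Matrix (Fin 2) (Fin 2) ℂ) (c : ℝ → Potential)
    (t : ℝ) : Prop :=
  ∀ z : ℂ, z ≠ 0 → ∀ i j : Fin 2,
    HasDerivAt (fun s : ℝ => (c s).evalAt z i j) (⁅(c t).evalAt z, W (c t) z⁆ i j) t

/-- `φ` is a continuous action of the additive group `ℝ²` on the space of potentials such that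
every `(x, y) ↦ φ (x, y) ζ` solves both Lax equations on all of `ℝ²`. -/
structure IsLaxAction (φ : ℝ × ℝ → Potential → Potential) : Prop where
  zero_act : ∀ ζ, φ 0 ζ = ζ
  add_act : ∀ p q ζ, φ (p + q) ζ = φ p (φ q ζ)
  continuous_act : Continuous (fun r : (ℝ × ℝ) × Potential => φ r.1 r.2)
  lax_x : ∀ (ζ : Potential) (x y : ℝ),
    SatisfiesLaxAt Potential.laxU (fun s => φ (s, y) ζ) x
  lax_y : ∀ (ζ : Potential) (x y : ℝ),
    SatisfiesLaxAt Potential.laxV (fun s => φ (x, s) ζ) y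

/-- The action `φ` extends the local flow of `∂ζ/∂x = [ζ, U(ζ)]` and of `∂ζ/∂y = [ζ, V(ζ)]`:
each solution on an open interval around `0` is a piece of an orbit of `φ`. -/
def ExtendsLocalLaxFlows (φ : ℝ × ℝ → Potential → Potential) : Prop :=
  ∀ (c : ℝ → Potential) (r s : ℝ), r < 0 → 0 < s →
    ((∀ t ∈ Set.Ioo r s, SatisfiesLaxAt Potential.laxU c t) →
      ∀ t ∈ Set.Ioo r s, c t = φ (t, 0) (c 0)) ∧
    ((∀ t ∈ Set.Ioo r s, SatisfiesLaxAt Potential.laxV c t) →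
      ∀ t ∈ Set.Ioo r s, c t = φ (0, t) (c 0))

/-- The orbit of `ζ` under `φ`. -/
def laxOrbit (φ : ℝ × ℝ → Potential → Potential) (ζ : Potential) : Set Potential :=
  Set.range (fun p : ℝ × ℝ => φ p ζ)

/-- The isospectral set `I(a)`. -/
def isoSet (a : ℂ[X]) : Set Potential := {ζ | ζ.toMatrix.det = X * a}

/-- The rootless elements of `I(a)`. -/
def rootlessPart (a : ℂ[X]) : Set Potential := {ζ ∈ isoSet a | ∀ z : ℂ, ζ.evalAt z ≠ 0}

/-- The elements of `I(a)` which vanish at `z`. -/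
def vanishingPart (a : ℂ[X]) (z : ℂ) : Set Potential := {ζ ∈ isoSet a | ζ.evalAt z = 0}

/-- The polynomials `a` with `det ζ = λ a(λ)` for some potential `ζ`. -/
def spectralPolys : Set ℂ[X] := {a | (isoSet a).Nonempty}

/-- Four pairwise distinct simple roots, all off the unit circle. -/
def spectralPolys1 : Set ℂ[X] :=
  {a ∈ spectralPolys | a.roots.card = 4 ∧ a.roots.Nodup ∧ ∀ z ∈ a.roots, ‖z‖ ≠ 1}

/-- One double root on the unit circle and two simple roots off the unit circle. -/
def spectralPolys2 : Set ℂ[X] :=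
  {a ∈ spectralPolys | ∃ μ z w : ℂ, a.roots = {μ, μ, z, w} ∧ z ≠ w ∧
    ‖μ‖ = 1 ∧ ‖z‖ ≠ 1 ∧ ‖w‖ ≠ 1}

/-- Two distinct double roots on the unit circle. -/
def spectralPolys3 : Set ℂ[X] :=
  {a ∈ spectralPolys | ∃ μ ν : ℂ, a.roots = {μ, μ, ν, ν} ∧ μ ≠ ν ∧ ‖μ‖ = 1 ∧ ‖ν‖ = 1}

/-- A fourth-order root on the unit circle. -/
def spectralPolys4 : Set ℂ[X] :=
  {a ∈ spectralPolys | ∃ μ : ℂ, a.roots = {μ, μ, μ, μ} ∧ ‖μ‖ = 1}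

/-- Two distinct double roots off the unit circle. -/
def spectralPolys5 : Set ℂ[X] :=
  {a ∈ spectralPolys | ∃ z w : ℂ, a.roots = {z, z, w, w} ∧ z ≠ w ∧ ‖z‖ ≠ 1 ∧ ‖w‖ ≠ 1}

/-- `S` is a `k`-dimensional (embedded, smooth) submanifold of the finite-dimensional real vector
space `E`: around each of its points some smooth chart of `E` flattens `S` to a `k`-dimensional
linear subspace. -/
def IsSubmanifold {E : Type*} [NormedAddCommGroup E] [NormedSpace ℝ E] [FiniteDimensional ℝ E]
    (k : ℕ) (S : Set E) : Prop :=
  ∀ p ∈ S, ∃ (e : OpenPartialHomeomorph E E) (L : Submodule ℝ E),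
    p ∈ e.source ∧ ContDiffOn ℝ ∞ e e.source ∧ ContDiffOn ℝ ∞ e.symm e.target ∧
    Module.finrank ℝ L = k ∧ ∀ x ∈ e.source, x ∈ S ↔ e x ∈ L

/-- `k`-dimensional submanifolds of the space of potentials, an open subset of `ℂ × ℂ × ℝ`. -/
def IsPotentialSubmanifold (k : ℕ) (S : Set Potential) : Prop :=
  IsSubmanifold k ((Subtype.val : Potential → ℂ × ℂ × ℝ) '' S)

end

open Set Filter Topology Metric

/-! ### Global and commuting flows of vector fields -/

section Flows

variable {E : Type*} [NormedAddCommGroup E] [NormedSpace ℝ E]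

/-! In the real coordinates (Re α, Im α, Re β, Im β, γ, γ⁻¹), with γ and γ⁻¹ treated as independent,
both Lax equations become homogeneous quadratic fields on ℝ⁶. They share four quadratic first
integrals: the product γ·γ⁻¹, the real and imaginary parts of one coefficient of a, and the positive
definite middle coefficient `energy`. Bounded energy levels make the flows global. Symmetry of the
polarised brackets makes them commute, and they preserve the hypersurface γ·γ⁻¹ = 1. Since a has the
form λ⁴ - c̄λ³ + Eλ² - cλ + 1, each nonempty I(a) is a common level set of three integrals, hence
compact.

Transitivity comes from maximising γ. The logarithmic derivatives of γ along the flows are -2 Re α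
and 2 Im α, so at a maximum on the closure of an orbit α vanishes, and the second-order condition is
Schur's criterion `IsInner`, or else degenerates to γ = 1. On a fixed I(a) an inner potential is
determined by α (`IsInner.eq_of_specPoly_eq`, a convexity argument). So I(a) has at most one inner
critical point. Near a suitable maximum the orbit fills I(a) (`eventually_mem_laxOrbit`), so the
maximum lies in the orbit itself and not only in its closure. Any two such orbits therefore share a
point.

The differentials of the three integrals are independent at rootless ζ, so the rootless part is a
surface. A root of ζ is a multiple root of a, so for simple roots all of I(a) is rootless. It is
then a compact homogeneous space of ℝ² with discrete stabiliser: a torus.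

On the unit circle λ⁻²a(λ) = |α - ᾱλ|² + |β - γλ - γ⁻¹λ̄|². A circle root of a thus forces linear
equations on ζ. If another root lies off the circle they cut I(a) down to a regular curve. With two
distinct circle roots, or a quadruple one, only α = 0, β = s real, γ = 1 survives.

Two double roots off the circle give a = (λ² - sλ + 1)² with s real and s² > 4. The stationary
potential with β = s is then the only non-rootless element. The maximum of γ over an orbit closure
might degenerate to this point. That is excluded because log γ solves an elliptic sinh-Gordon
equation without negative entire solutions (`exists_one_le_jointFlow_four`). An explicit curve of
rootless potentials tending to the stationary one gives density. -/

theorem ContDiff.exists_lipschitzOnWith_closedBall [FiniteDimensional ℝ E] {X : E → E}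
    (hX : ContDiff ℝ 1 X) (R : ℝ) :
    ∃ K : NNReal, LipschitzOnWith K X (closedBall 0 R) := by
  obtain ⟨C, hC⟩ := (isCompact_closedBall (0 : E) R).exists_bound_of_continuousOn
    (hX.continuous_fderiv one_ne_zero).continuousOn
  refine ⟨C.toNNReal, (convex_closedBall (0 : E) R).lipschitzOnWith_of_nnnorm_fderiv_le
    (fun x _ => (hX.differentiable one_ne_zero) x) fun x hx => ?_⟩
  rw [← NNReal.coe_le_coe, coe_nnnorm]
  exact (hC x hx).trans (Real.le_coe_toNNReal C)

/-- Integral curves of a `C¹` field through the same point agree. -/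
theorem eqOn_of_hasDerivAt_of_contDiff [FiniteDimensional ℝ E] {X : E → E} (hX : ContDiff ℝ 1 X)
    {c₁ c₂ : ℝ → E} {r s t₀ : ℝ} (h₀ : t₀ ∈ Ioo r s)
    (h₁ : ∀ t ∈ Ioo r s, HasDerivAt c₁ (X (c₁ t)) t)
    (h₂ : ∀ t ∈ Ioo r s, HasDerivAt c₂ (X (c₂ t)) t) (h : c₁ t₀ = c₂ t₀) :
    EqOn c₁ c₂ (Ioo r s) := by
  intro t ht
  obtain ⟨a, ha⟩ := exists_between (lt_min h₀.1 ht.1)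
  obtain ⟨b, hb⟩ := exists_between (max_lt h₀.2 ht.2)
  have hsub : Icc a b ⊆ Ioo r s := fun x hx => ⟨ha.1.trans_le hx.1, hx.2.trans_lt hb.2⟩
  obtain ⟨R₁, hR₁⟩ := isCompact_Icc.exists_bound_of_continuousOn
    (HasDerivAt.continuousOn fun x hx => h₁ x (hsub hx))
  obtain ⟨R₂, hR₂⟩ := isCompact_Icc.exists_bound_of_continuousOn
    (HasDerivAt.continuousOn fun x hx => h₂ x (hsub hx))
  obtain ⟨K, hK⟩ := hX.exists_lipschitzOnWith_closedBall (max R₁ R₂)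
  have hI : Ioo a b ⊆ Icc a b := Ioo_subset_Icc_self
  refine ODE_solution_unique_of_mem_Ioo (v := fun _ => X) (s := fun _ => closedBall 0 (max R₁ R₂))
    (K := K) (a := a) (b := b) (t₀ := t₀) (fun _ _ => hK)
    ⟨ha.2.trans_le (min_le_left _ _), (le_max_left _ _).trans_lt hb.1⟩
    (fun x hx => ⟨h₁ x (hsub (hI hx)), ?_⟩) (fun x hx => ⟨h₂ x (hsub (hI hx)), ?_⟩) h
    ⟨ha.2.trans_le (min_le_right _ _), (le_max_right _ _).trans_lt hb.1⟩
  · exact mem_closedBall_zero_iff.2 ((hR₁ x (hI hx)).trans (le_max_left _ _))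
  · exact mem_closedBall_zero_iff.2 ((hR₂ x (hI hx)).trans (le_max_right _ _))

/-- `N` is a first integral of the `C¹` field `X` with bounded sublevel sets. -/
structure HasProperFirstIntegral (X : E → E) (N : E → ℝ) : Prop where
  contDiff : ContDiff ℝ 1 X
  differentiable : Differentiable ℝ N
  invariant : ∀ w, fderiv ℝ N w (X w) = 0
  bounded : ∀ r, Bornology.IsBounded {w | N w ≤ r}

/-- `Φ` is a global continuous flow of the field `X`. -/
structure IsFlowOf (X : E → E) (Φ : ℝ → E → E) : Prop where
  zero : ∀ w, Φ 0 w = w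
  hasDerivAt : ∀ w t, HasDerivAt (fun s => Φ s w) (X (Φ t w)) t
  continuous : Continuous (fun p : ℝ × E => Φ p.1 p.2)

/-- Cutting the field off outside a large ball makes it bounded and globally Lipschitz, so
Picard–Lindelöf applies on any time interval. The integral N is still conserved by the cut-off
field, which traps solutions where the cutoff is 1. -/
theorem HasProperFirstIntegral.exists_local_flow [FiniteDimensional ℝ E] {X : E → E} {N : E → ℝ}
    (h : HasProperFirstIntegral X N) (n : ℕ) :
    ∃ α : E × ℝ → E, (∀ x ∈ closedBall 0 (n : ℝ), α (x, 0) = x ∧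
      ∀ t ∈ Ioo (-n : ℝ) n, HasDerivAt (fun s => α (x, s)) (X (α (x, t))) t) ∧
      ContinuousOn α (closedBall 0 (n : ℝ) ×ˢ Icc (-n : ℝ) n) := by
  obtain ⟨C, hC⟩ := (isCompact_closedBall (0 : E) n).exists_bound_of_continuousOn
    h.differentiable.continuous.continuousOn
  obtain ⟨R, hR0, hR⟩ := (h.bounded C).exists_pos_norm_le
  -- The radius R contains the whole sublevel set {N ≤ C}, where C bounds |N| on the ball of initial
  -- values.
  let χ : ContDiffBump (0 : E) := ⟨R, R + 1, hR0, by linarith⟩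
  set Z : E → E := fun w => χ w • X w with hZ
  have hZd : ContDiff ℝ 1 Z := (χ.contDiff (n := 1)).smul h.contDiff
  have hZs : HasCompactSupport Z := χ.hasCompactSupport.smul_right
  obtain ⟨K, hK⟩ := ContDiff.lipschitzWith_of_hasCompactSupport hZs hZd one_ne_zero
  obtain ⟨L, hL⟩ := hZs.exists_bound_of_continuous hZd.continuous
  have hpl : IsPicardLindelof (fun _ => Z) (tmin := -n) (tmax := n)
      ⟨(0 : ℝ), by simp⟩ (0 : E) (L.toNNReal * n + n) n L.toNNReal K := by
    refine .of_time_independent (fun x _ => (hL x).trans (Real.le_coe_toNNReal L))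
      hK.lipschitzOnWith ?_
    simp
  obtain ⟨α, hα, hc⟩ := hpl.exists_forall_mem_closedBall_eq_hasDerivWithinAt_continuousOn
  refine ⟨α, fun x hx => ⟨(hα x (by simpa using hx)).1, fun t ht => ?_⟩, by simpa using hc⟩
  obtain ⟨h0, hd⟩ := hα x (by simpa using hx)
  have hd' : ∀ s ∈ Ioo (-n : ℝ) n, HasDerivAt (fun s => α (x, s)) (Z (α (x, s))) s :=
    fun s hs => (hd s (Ioo_subset_Icc_self hs)).hasDerivAt (Icc_mem_nhds hs.1 hs.2)
  have hN : ∀ s ∈ Ioo (-n : ℝ) n, HasDerivAt (fun s => N (α (x, s))) 0 s := by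
    intro s hs
    have := (h.differentiable (α (x, s))).hasFDerivAt.comp_hasDerivAt s (hd' s hs)
    rwa [show fderiv ℝ N (α (x, s)) (Z (α (x, s))) = 0 by simp [hZ, h.invariant]] at this
  have hconst : N (α (x, t)) = N (α (x, 0)) := by
    refine (convex_Ioo (-n : ℝ) n).is_const_of_fderivWithin_eq_zero (𝕜 := ℝ)
      (f := fun s => N (α (x, s)))
      (fun s hs => (hN s hs).differentiableAt.differentiableWithinAt) (fun s hs => ?_) ht ?_
    · rw [fderivWithin_of_isOpen isOpen_Ioo hs]
      ext; simp [(hN s hs).deriv]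
    · constructor <;> linarith [ht.1, ht.2]
  have hb : ‖α (x, t)‖ ≤ R := by
    apply hR
    change N _ ≤ C
    rw [hconst, h0]
    exact (le_abs_self _).trans (hC x hx)
  have h1 : χ (α (x, t)) = 1 := χ.one_of_mem_closedBall (by simpa [χ] using hb)
  simpa [hZ, h1] using hd' t ht

theorem HasProperFirstIntegral.exists_flow [FiniteDimensional ℝ E] {X : E → E} {N : E → ℝ}
    (h : HasProperFirstIntegral X N) : ∃ Φ : ℝ → E → E, IsFlowOf X Φ := by
  choose α hα hc using h.exists_local_flow
  let m : ℝ → E → ℕ := fun t w => ⌈max |t| ‖w‖⌉₊ + 1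
  have hm : ∀ t w, |t| < m t w ∧ ‖w‖ < m t w := by
    intro t w
    have := Nat.le_ceil (max |t| ‖w‖)
    have h1 := le_max_left |t| ‖w‖
    have h2 := le_max_right |t| ‖w‖
    simp only [m]; push_cast
    constructor <;> linarith
  -- Uniqueness makes the local flows compatible, so the choice of index `m t w` is immaterial and
  -- may be frozen near each point.
  have key : ∀ (n : ℕ) (t : ℝ) (w : E), |t| < n → ‖w‖ < n → α (m t w) (w, t) = α n (w, t) := by
    intro n t w ht hw
    obtain ⟨ht', hw'⟩ := hm t w
    have hl := lt_min ht ht'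
    refine eqOn_of_hasDerivAt_of_contDiff h.contDiff (c₁ := fun s => α (m t w) (w, s))
      (c₂ := fun s => α n (w, s)) (r := -min (n : ℝ) (m t w)) (s := min (n : ℝ) (m t w)) (t₀ := 0)
      ?_ (fun s hs => ?_) (fun s hs => ?_) ?_ (abs_lt.1 hl)
    · have := (abs_nonneg t).trans_lt hl
      constructor <;> linarith
    · refine (hα (m t w) w (mem_closedBall_zero_iff.2 hw'.le)).2 s (abs_lt.1 ?_)
      exact (abs_lt.2 hs).trans_le (min_le_right _ _)
    · refine (hα n w (mem_closedBall_zero_iff.2 hw.le)).2 s (abs_lt.1 ?_)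
      exact (abs_lt.2 hs).trans_le (min_le_left _ _)
    · rw [(hα (m t w) w (mem_closedBall_zero_iff.2 hw'.le)).1,
        (hα n w (mem_closedBall_zero_iff.2 hw.le)).1]
  refine ⟨fun t w => α (m t w) (w, t), fun w => ?_, fun w t => ?_, ?_⟩
  · exact (hα _ w (mem_closedBall_zero_iff.2 (hm 0 w).2.le)).1
  · obtain ⟨ht, hw⟩ := hm t w
    refine ((hα (m t w) w (mem_closedBall_zero_iff.2 hw.le)).2 t
      (abs_lt.1 ht)).congr_of_eventuallyEq ?_
    filter_upwards [(isOpen_lt continuous_abs continuous_const).mem_nhds ht] with s hs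
    exact key _ _ _ hs hw
  · rw [continuous_iff_continuousAt]
    rintro ⟨t, w⟩
    obtain ⟨ht, hw⟩ := hm t w
    have hev : ∀ᶠ p : ℝ × E in 𝓝 (t, w), |p.1| < m t w ∧ ‖p.2‖ < m t w :=
      (continuous_fst.abs.continuousAt.eventually_lt continuousAt_const ht).and
        (continuous_snd.norm.continuousAt.eventually_lt continuousAt_const hw)
    have hcc : ContinuousAt (fun p : ℝ × E => α (m t w) (p.2, p.1)) (t, w) := by
      refine ContinuousAt.comp (f := Prod.swap) (g := α (m t w))
        ((hc (m t w)).continuousAt ?_) continuous_swap.continuousAt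
      refine prod_mem_nhds (closedBall_mem_nhds_of_mem (mem_ball_zero_iff.2 hw)) ?_
      exact Icc_mem_nhds (abs_lt.1 ht).1 (abs_lt.1 ht).2
    refine hcc.congr ?_
    filter_upwards [hev] with p hp
    exact (key _ _ _ hp.1 hp.2).symm

namespace IsFlowOf

variable {X Y : E → E} {Φ Ψ : ℝ → E → E}

/-- Commutation makes both partial derivatives plain values of X and Y along the orbit, hence
continuous. Differentiable dependence of the flows on initial data is not needed. -/
theorem hasStrictFDerivAt_comp (hΦ : IsFlowOf X Φ) (hΨ : IsFlowOf Y Ψ) (hX : Continuous X)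
    (hY : Continuous Y) (hcomm : ∀ x y w, Φ x (Ψ y w) = Ψ y (Φ x w)) (w : E) (p : ℝ × ℝ) :
    HasStrictFDerivAt (fun p : ℝ × ℝ => Φ p.1 (Ψ p.2 w))
      ((ContinuousLinearMap.toSpanSingleton ℝ (X (Φ p.1 (Ψ p.2 w)))).coprod
        (ContinuousLinearMap.toSpanSingleton ℝ (Y (Φ p.1 (Ψ p.2 w))))) p := by
  have hc : Continuous (fun p : ℝ × ℝ => Φ p.1 (Ψ p.2 w)) :=
    hΦ.continuous.comp (continuous_fst.prodMk
      (hΨ.continuous.comp (continuous_snd.prodMk continuous_const)))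
  have hs : Continuous fun v : E => ContinuousLinearMap.toSpanSingleton ℝ v :=
    (ContinuousLinearMap.toSpanSingletonCLE (𝕜 := ℝ) (E := E)).continuous
  refine hasStrictFDerivAt_uncurry_coprod (f := fun x y => Φ x (Ψ y w))
    (f₁ := fun x y => ContinuousLinearMap.toSpanSingleton ℝ (X (Φ x (Ψ y w))))
    (f₂ := fun x y => ContinuousLinearMap.toSpanSingleton ℝ (Y (Φ x (Ψ y w))))
    (.of_forall fun v => ?_) (.of_forall fun v => ?_)
    (hs.comp (hX.comp hc)).continuousAt (hs.comp (hY.comp hc)).continuousAt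
  · exact (hΦ.hasDerivAt _ v.1).hasFDerivAt
  · have := hΨ.hasDerivAt (Φ v.1 w) v.2
    simp only [← hcomm] at this
    exact this.hasFDerivAt

theorem apply_eq_of_fderiv_eq_zero (h : IsFlowOf X Φ) {f : E → ℝ} (hf : Differentiable ℝ f)
    (h0 : ∀ w, fderiv ℝ f w (X w) = 0) (t : ℝ) (w : E) : f (Φ t w) = f w := by
  have hd : ∀ s, HasDerivAt (fun s => f (Φ s w)) 0 s := fun s => by
    have := (hf (Φ s w)).hasFDerivAt.comp_hasDerivAt s (h.hasDerivAt w s)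
    rwa [h0] at this
  have := is_const_of_deriv_eq_zero (fun s => (hd s).differentiableAt) (fun s => (hd s).deriv) t 0
  simpa [h.zero] using this

variable [FiniteDimensional ℝ E]

theorem eqOn_Ioo (h : IsFlowOf X Φ) (hX : ContDiff ℝ 1 X) {c : ℝ → E} {r s : ℝ} (hr : r < 0)
    (hs : 0 < s) (hc : ∀ t ∈ Ioo r s, HasDerivAt c (X (c t)) t) :
    ∀ t ∈ Ioo r s, c t = Φ t (c 0) :=
  eqOn_of_hasDerivAt_of_contDiff hX ⟨hr, hs⟩ hc (fun t _ => h.hasDerivAt (c 0) t) (h.zero _).symm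

theorem eq_of_hasDerivAt (h : IsFlowOf X Φ) (hX : ContDiff ℝ 1 X) {c : ℝ → E}
    (hc : ∀ t, HasDerivAt c (X (c t)) t) (t : ℝ) : c t = Φ t (c 0) :=
  h.eqOn_Ioo hX (r := -|t| - 1) (s := |t| + 1) (by linarith [abs_nonneg t])
    (by linarith [abs_nonneg t]) (fun t _ => hc t) t
    ⟨by linarith [neg_abs_le t], by linarith [le_abs_self t]⟩

theorem add (h : IsFlowOf X Φ) (hX : ContDiff ℝ 1 X) (s t : ℝ) (w : E) :
    Φ (s + t) w = Φ s (Φ t w) := by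
  have := h.eq_of_hasDerivAt hX (c := fun s => Φ (s + t) w)
    (fun s => (h.hasDerivAt w (s + t)).comp_add_const s t) s
  simpa using this

theorem eq_self_of_eq_zero (h : IsFlowOf X Φ) (hX : ContDiff ℝ 1 X) {w : E} (hw : X w = 0)
    (t : ℝ) : Φ t w = w :=
  (h.eq_of_hasDerivAt hX (c := fun _ => w) (fun s => by simpa [hw] using hasDerivAt_const s w)
    t).symm

/-- If the quadratic field `X` commutes with `Y`, then its flow maps transport `Y` to itself. -/
theorem hasDerivAt_comp_of_nonneg (hΦ : IsFlowOf X Φ) (hΨ : IsFlowOf Y Ψ) (hX : ContDiff ℝ 1 X)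
    (hY : ContDiff ℝ 1 Y) {B : E → E → E}
    (hB : ∀ w k (r : ℝ), X (w + r • k) = X w + r • B w k + r ^ 2 • X k)
    (hXY : ∀ w, fderiv ℝ Y w (X w) = B w (Y w)) {x : ℝ} (hx : 0 ≤ x) (w : E) :
    HasDerivAt (fun r => Φ x (Ψ r w)) (Y (Φ x w)) 0 := by
  have cΦ : ∀ w, Continuous fun t => Φ t w := fun w =>
    hΦ.continuous.comp (continuous_id.prodMk continuous_const)
  have cΨ : Continuous fun t => Ψ t w :=
    hΨ.continuous.comp (continuous_id.prodMk continuous_const)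
  let f : ℝ → ℝ → E := fun r t => Φ t (Ψ r w)
  -- First-order guess for the perturbed trajectory. Because X is quadratic and the bracket of X and
  -- Y vanishes, it solves the equation of X up to exactly r² X(Y), so Grönwall bounds the distance
  -- by o(r).
  let g : ℝ → ℝ → E := fun r t => Φ t w + r • Y (Φ t w)
  have cf : Continuous (fun p : ℝ × ℝ => f p.1 p.2) :=
    hΦ.continuous.comp (continuous_snd.prodMk (cΨ.comp continuous_fst))
  have cg : Continuous (fun p : ℝ × ℝ => g p.1 p.2) :=
    ((cΦ w).comp continuous_snd).add
      (continuous_fst.smul (hY.continuous.comp ((cΦ w).comp continuous_snd)))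
  have hcomp : IsCompact (Icc (-1 : ℝ) 1 ×ˢ Icc 0 x) := isCompact_Icc.prod isCompact_Icc
  obtain ⟨R₁, hR₁⟩ := hcomp.exists_bound_of_continuousOn cf.continuousOn
  obtain ⟨R₂, hR₂⟩ := hcomp.exists_bound_of_continuousOn cg.continuousOn
  obtain ⟨M, hM⟩ := isCompact_Icc.exists_bound_of_continuousOn (s := Icc 0 x)
    (hX.continuous.comp (hY.continuous.comp (cΦ w))).continuousOn
  obtain ⟨K₀, hK₀⟩ := hX.exists_lipschitzOnWith_closedBall (max R₁ R₂)
  -- Enlarging the constant by 1 keeps it nonzero, which selects the exponential formula for the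
  -- Grönwall bound.
  have hK : LipschitzOnWith (K₀ + 1) X (closedBall 0 (max R₁ R₂)) := hK₀.weaken (by simp)
  set K := K₀ + 1 with hKdef
  have hKne : (K : ℝ) ≠ 0 := by
    have : (0 : ℝ) ≤ K₀ := K₀.2
    rw [hKdef]; push_cast; positivity
  have hg' : ∀ r t, HasDerivAt (g r) (X (Φ t w) + r • B (Φ t w) (Y (Φ t w))) t := by
    intro r t
    have h1 := ((hY.differentiable one_ne_zero) (Φ t w)).hasFDerivAt.comp_hasDerivAt t
      (hΦ.hasDerivAt w t)
    rw [hXY] at h1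
    exact (hΦ.hasDerivAt w t).add (h1.const_smul r)
  have main : ∀ r ∈ Icc (-1 : ℝ) 1, ‖f r x - g r x‖ ≤
      gronwallBound ‖Ψ r w - (w + r • Y w)‖ K (0 + r ^ 2 * M) x := by
    intro r hr
    have := dist_le_of_approx_trajectories_ODE_of_mem (v := fun _ => X) (K := K)
      (s := fun _ => closedBall 0 (max R₁ R₂)) (f := f r) (g := g r) (a := 0) (b := x)
      (f' := fun t => X (f r t)) (g' := fun t => X (Φ t w) + r • B (Φ t w) (Y (Φ t w)))
      (εf := 0) (εg := r ^ 2 * M) (δ := ‖Ψ r w - (w + r • Y w)‖)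
      (fun _ _ => hK) (cΦ _).continuousOn (fun t _ => (hΦ.hasDerivAt _ t).hasDerivWithinAt)
      (fun t _ => by simp)
      (fun t ht => mem_closedBall_zero_iff.2
        ((hR₁ (r, t) ⟨hr, Ico_subset_Icc_self ht⟩).trans (le_max_left _ _)))
      (fun t _ => (hg' r t).continuousAt.continuousWithinAt)
      (fun t _ => (hg' r t).hasDerivWithinAt)
      (fun t ht => ?_)
      (fun t ht => mem_closedBall_zero_iff.2
        ((hR₂ (r, t) ⟨hr, Ico_subset_Icc_self ht⟩).trans (le_max_right _ _)))
      (by simp [f, g, hΦ.zero, dist_eq_norm]) x ⟨hx, le_rfl⟩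
    · simpa [dist_eq_norm] using this
    · simp only [g, hB, dist_eq_norm, sub_add_cancel_left, norm_neg, norm_smul, norm_pow,
        Real.norm_eq_abs, sq_abs]
      exact mul_le_mul_of_nonneg_left (hM t (Ico_subset_Icc_self ht)) (sq_nonneg r)
  have hδ : (fun r : ℝ => ‖Ψ r w - (w + r • Y w)‖) =o[𝓝 0] fun r => r := by
    have := (hasDerivAt_iff_isLittleO.1 (hΨ.hasDerivAt w 0)).norm_left
    simpa [hΨ.zero, sub_sub] using this
  have hsq : (fun r : ℝ => r ^ 2) =o[𝓝 0] fun r => r := by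
    simpa using Asymptotics.isLittleO_pow_pow (𝕜 := ℝ) (m := 1) (n := 2) one_lt_two
  have hbound : (fun r : ℝ => gronwallBound ‖Ψ r w - (w + r • Y w)‖ K (0 + r ^ 2 * M) x)
      =o[𝓝 0] fun r => r := by
    simp only [gronwallBound_of_K_ne_0 hKne]
    have h1 := hδ.const_mul_left (Real.exp (K * x))
    have h2 := hsq.const_mul_left (M / K * (Real.exp (K * x) - 1))
    refine (h1.add h2).congr_left fun r => ?_
    ring
  rw [hasDerivAt_iff_isLittleO]
  have hO : (fun r : ℝ => f r x - g r x) =o[𝓝 0] fun r => r := by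
    refine Asymptotics.IsBigO.trans_isLittleO (.of_bound 1 ?_) hbound
    filter_upwards [Icc_mem_nhds (show (-1 : ℝ) < 0 by norm_num) zero_lt_one] with r hr
    rw [one_mul]
    exact (main r hr).trans (le_abs_self _)
  simpa [f, g, hΨ.zero, sub_sub] using hO

/-- Since Φₓ transports Y to itself, y ↦ Φₓ(Ψ_y w) is an integral curve of Y and uniqueness
identifies it. Grönwall runs forward in time only, so negative x is reached by inverting Φ₋ₓ. -/
theorem comm (hΦ : IsFlowOf X Φ) (hΨ : IsFlowOf Y Ψ) (hX : ContDiff ℝ 1 X)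
    (hY : ContDiff ℝ 1 Y) {B : E → E → E}
    (hB : ∀ w k (r : ℝ), X (w + r • k) = X w + r • B w k + r ^ 2 • X k)
    (hXY : ∀ w, fderiv ℝ Y w (X w) = B w (Y w)) (x y : ℝ) (w : E) :
    Φ x (Ψ y w) = Ψ y (Φ x w) := by
  have pos : ∀ x, 0 ≤ x → ∀ y w, Φ x (Ψ y w) = Ψ y (Φ x w) := by
    intro x hx y w
    have := hΨ.eq_of_hasDerivAt hY (c := fun y => Φ x (Ψ y w)) (fun t => ?_) y
    · simpa [hΨ.zero] using this
    · have h0 := hΦ.hasDerivAt_comp_of_nonneg hΨ hX hY hB hXY hx (Ψ t w)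
      have h1 := HasDerivAt.comp_sub_const (f := fun r => Φ x (Ψ r (Ψ t w))) t t
        (by simpa using h0)
      refine h1.congr_of_eventuallyEq (.of_forall fun s => ?_)
      simp [← hΨ.add hY]
  rcases le_total 0 x with hx | hx
  · exact pos x hx y w
  · have inv : ∀ w, Φ (-x) (Φ x w) = w ∧ Φ x (Φ (-x) w) = w := fun w => by
      simp [← hΦ.add hX, hΦ.zero]
    conv_lhs => rw [← (inv w).1, ← pos (-x) (by linarith)]
    exact (inv _).2

end IsFlowOf

end Flows

/-! ### The Lax equations as commuting quadratic fields on ℝ⁶ -/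

/-- Homogeneous quadratic maps, expressed through the polarisation. -/
def IsQuadraticMap {E F : Type*} [AddCommGroup E] [Module ℝ E] [AddCommGroup F] [Module ℝ F]
    (f : E → F) : Prop :=
  ∀ (w k : E) (r : ℝ), f (w + r • k) = f w + r • QuadraticMap.polar f w k + r ^ 2 • f k

theorem IsQuadraticMap.fderiv_apply {E F : Type*} [NormedAddCommGroup E] [NormedSpace ℝ E]
    [NormedAddCommGroup F] [NormedSpace ℝ F] {f : E → F} (hf : IsQuadraticMap f)
    (hd : Differentiable ℝ f) (w k : E) : fderiv ℝ f w k = QuadraticMap.polar f w k := by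
  have h1 : HasDerivAt (fun r : ℝ => w + r • k) k 0 := by
    simpa using ((hasDerivAt_id (0 : ℝ)).smul_const k).const_add w
  have h2 : HasDerivAt (fun r : ℝ => f (w + r • k)) (fderiv ℝ f w k) 0 := by
    have := (hd (w + (0 : ℝ) • k)).hasFDerivAt.comp_hasDerivAt 0 h1
    simpa [Function.comp_def] using this
  have h3 : HasDerivAt (fun r : ℝ => f w + r • QuadraticMap.polar f w k + r ^ 2 • f k)
      (QuadraticMap.polar f w k) 0 := by
    have := (((hasDerivAt_id (0 : ℝ)).smul_const (QuadraticMap.polar f w k)).const_add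
      (f w)).add (((hasDerivAt_id (0 : ℝ)).pow 2).smul_const (f k))
    simp only [id_eq, one_smul, mul_one, zero_pow, ne_eq, one_ne_zero, not_false_eq_true,
      mul_zero, zero_smul, add_zero, Nat.add_one_sub_one] at this
    exact this
  exact h2.unique (h3.congr_of_eventuallyEq (.of_forall fun r => hf w k r))

/-- The field `∂/∂x` in the coordinates `(Re α, Im α, Re β, Im β, γ, γ⁻¹)`. -/
def fieldX (w : Fin 6 → ℝ) : Fin 6 → ℝ :=
  ![(w 4 - w 5) * w 2 + w 4 ^ 2 - w 5 ^ 2, (w 4 + w 5) * w 3,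
    -2 * w 0 * (w 4 - w 5) + 2 * w 1 * w 3, -2 * w 1 * (w 4 + w 5) - 2 * w 1 * w 2,
    -2 * w 0 * w 4, 2 * w 0 * w 5]

/-- The field `∂/∂y` in the coordinates `(Re α, Im α, Re β, Im β, γ, γ⁻¹)`. -/
def fieldY (w : Fin 6 → ℝ) : Fin 6 → ℝ :=
  ![-(w 4 + w 5) * w 3, (w 4 - w 5) * w 2 - (w 4 ^ 2 - w 5 ^ 2),
    -2 * w 1 * (w 4 - w 5) + 2 * w 0 * w 3, 2 * w 0 * (w 4 + w 5) - 2 * w 0 * w 2,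
    2 * w 1 * w 4, -2 * w 1 * w 5]

/-- The λ²-coefficient of a on the hypersurface γ·γ⁻¹ = 1. Being positive definite, it supplies all
the compactness in the proof. -/
def energy (w : Fin 6 → ℝ) : ℝ :=
  2 * (w 0 ^ 2 + w 1 ^ 2) + w 2 ^ 2 + w 3 ^ 2 + w 4 ^ 2 + w 5 ^ 2

def casimirRe (w : Fin 6 → ℝ) : ℝ := w 0 ^ 2 - w 1 ^ 2 + w 2 * (w 4 + w 5)

def casimirIm (w : Fin 6 → ℝ) : ℝ := 2 * w 0 * w 1 + w 3 * (w 4 - w 5)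

def gammaProd (w : Fin 6 → ℝ) : ℝ := w 4 * w 5

theorem contDiff_fieldX {n : WithTop ℕ∞} : ContDiff ℝ n fieldX := by
  refine contDiff_pi.2 fun i => ?_
  fin_cases i <;> simp [fieldX] <;> fun_prop

theorem contDiff_fieldY {n : WithTop ℕ∞} : ContDiff ℝ n fieldY := by
  refine contDiff_pi.2 fun i => ?_
  fin_cases i <;> simp [fieldY] <;> fun_prop

theorem isQuadraticMap_fieldX : IsQuadraticMap fieldX := by
  intro w k r
  ext i
  fin_cases i <;> simp [fieldX, QuadraticMap.polar] <;> ring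

theorem isQuadraticMap_fieldY : IsQuadraticMap fieldY := by
  intro w k r
  ext i
  fin_cases i <;> simp [fieldY, QuadraticMap.polar] <;> ring

/-- For quadratic fields the derivative is the polarisation, so this is the vanishing of the Lie
bracket. -/
theorem polar_fieldY_fieldX (w : Fin 6 → ℝ) :
    QuadraticMap.polar fieldY w (fieldX w) = QuadraticMap.polar fieldX w (fieldY w) := by
  ext i
  fin_cases i <;> simp [fieldX, fieldY, QuadraticMap.polar] <;> ring

theorem contDiff_energy {n : WithTop ℕ∞} : ContDiff ℝ n energy := by unfold energy; fun_prop

theorem contDiff_casimirRe {n : WithTop ℕ∞} : ContDiff ℝ n casimirRe := by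
  unfold casimirRe; fun_prop

theorem contDiff_casimirIm {n : WithTop ℕ∞} : ContDiff ℝ n casimirIm := by
  unfold casimirIm; fun_prop

theorem contDiff_gammaProd {n : WithTop ℕ∞} : ContDiff ℝ n gammaProd := by
  unfold gammaProd; fun_prop

/-- `f` is constant along the flows of `fieldX` and `fieldY`. -/
structure IsFirstIntegral (f : (Fin 6 → ℝ) → ℝ) : Prop where
  differentiable : Differentiable ℝ f
  fderiv_fieldX : ∀ w, fderiv ℝ f w (fieldX w) = 0
  fderiv_fieldY : ∀ w, fderiv ℝ f w (fieldY w) = 0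

theorem isFirstIntegral_energy : IsFirstIntegral energy := by
  have hq : IsQuadraticMap energy := fun w k r => by
    simp [energy, QuadraticMap.polar]; ring
  have hd : Differentiable ℝ energy := contDiff_energy.differentiable one_ne_zero
  refine ⟨hd, fun w => ?_, fun w => ?_⟩ <;> rw [hq.fderiv_apply hd] <;>
    simp [energy, QuadraticMap.polar, fieldX, fieldY] <;> ring

theorem isFirstIntegral_casimirRe : IsFirstIntegral casimirRe := by
  have hq : IsQuadraticMap casimirRe := fun w k r => by
    simp [casimirRe, QuadraticMap.polar]; ring
  have hd : Differentiable ℝ casimirRe := contDiff_casimirRe.differentiable one_ne_zero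
  refine ⟨hd, fun w => ?_, fun w => ?_⟩ <;> rw [hq.fderiv_apply hd] <;>
    simp [casimirRe, QuadraticMap.polar, fieldX, fieldY] <;> ring

theorem isFirstIntegral_casimirIm : IsFirstIntegral casimirIm := by
  have hq : IsQuadraticMap casimirIm := fun w k r => by
    simp [casimirIm, QuadraticMap.polar]; ring
  have hd : Differentiable ℝ casimirIm := contDiff_casimirIm.differentiable one_ne_zero
  refine ⟨hd, fun w => ?_, fun w => ?_⟩ <;> rw [hq.fderiv_apply hd] <;>
    simp [casimirIm, QuadraticMap.polar, fieldX, fieldY] <;> ring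

theorem isFirstIntegral_gammaProd : IsFirstIntegral gammaProd := by
  have hq : IsQuadraticMap gammaProd := fun w k r => by
    simp [gammaProd, QuadraticMap.polar]; ring
  have hd : Differentiable ℝ gammaProd := contDiff_gammaProd.differentiable one_ne_zero
  refine ⟨hd, fun w => ?_, fun w => ?_⟩ <;> rw [hq.fderiv_apply hd] <;>
    simp [gammaProd, QuadraticMap.polar, fieldX, fieldY] <;> ring

theorem isBounded_energy_le (r : ℝ) : Bornology.IsBounded {w | energy w ≤ r} := by
  refine isBounded_iff_forall_norm_le.2 ⟨√r, fun w hw => ?_⟩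
  refine (pi_norm_le_iff_of_nonneg (Real.sqrt_nonneg r)).2 fun i => Real.abs_le_sqrt ?_
  have h : energy w ≤ r := hw
  unfold energy at h
  fin_cases i <;> simp <;> nlinarith [sq_nonneg (w 0), sq_nonneg (w 1), sq_nonneg (w 2),
    sq_nonneg (w 3), sq_nonneg (w 4), sq_nonneg (w 5)]

theorem hasProperFirstIntegral_fieldX : HasProperFirstIntegral fieldX energy :=
  ⟨contDiff_fieldX, isFirstIntegral_energy.1, isFirstIntegral_energy.2, isBounded_energy_le⟩

theorem hasProperFirstIntegral_fieldY : HasProperFirstIntegral fieldY energy :=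
  ⟨contDiff_fieldY, isFirstIntegral_energy.1, isFirstIntegral_energy.3, isBounded_energy_le⟩

noncomputable def flowX : ℝ → (Fin 6 → ℝ) → Fin 6 → ℝ := hasProperFirstIntegral_fieldX.exists_flow.choose

noncomputable def flowY : ℝ → (Fin 6 → ℝ) → Fin 6 → ℝ := hasProperFirstIntegral_fieldY.exists_flow.choose

theorem isFlowOf_flowX : IsFlowOf fieldX flowX :=
  hasProperFirstIntegral_fieldX.exists_flow.choose_spec

theorem isFlowOf_flowY : IsFlowOf fieldY flowY :=
  hasProperFirstIntegral_fieldY.exists_flow.choose_spec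

theorem flowX_flowY_comm (x y : ℝ) (w : Fin 6 → ℝ) :
    flowX x (flowY y w) = flowY y (flowX x w) :=
  isFlowOf_flowX.comm isFlowOf_flowY contDiff_fieldX contDiff_fieldY
    (B := QuadraticMap.polar fieldX) isQuadraticMap_fieldX
    (fun w => by
      rw [isQuadraticMap_fieldY.fderiv_apply (contDiff_fieldY.differentiable one_ne_zero),
        polar_fieldY_fieldX]) x y w

/-- The joint flow of the two commuting fields. -/
noncomputable def jointFlow (p : ℝ × ℝ) (w : Fin 6 → ℝ) : Fin 6 → ℝ := flowX p.1 (flowY p.2 w)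

theorem jointFlow_zero (w : Fin 6 → ℝ) : jointFlow 0 w = w := by
  simp [jointFlow, isFlowOf_flowX.zero, isFlowOf_flowY.zero]

theorem jointFlow_add (p q : ℝ × ℝ) (w : Fin 6 → ℝ) :
    jointFlow (p + q) w = jointFlow p (jointFlow q w) := by
  simp only [jointFlow, Prod.fst_add, Prod.snd_add, isFlowOf_flowX.add contDiff_fieldX,
    isFlowOf_flowY.add contDiff_fieldY, flowX_flowY_comm]

theorem continuous_jointFlow :
    Continuous fun r : (ℝ × ℝ) × (Fin 6 → ℝ) => jointFlow r.1 r.2 :=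
  isFlowOf_flowX.continuous.comp ((continuous_fst.comp continuous_fst).prodMk
    (isFlowOf_flowY.continuous.comp ((continuous_snd.comp continuous_fst).prodMk continuous_snd)))

theorem hasDerivAt_jointFlow_fst (w : Fin 6 → ℝ) (x y : ℝ) :
    HasDerivAt (fun s => jointFlow (s, y) w) (fieldX (jointFlow (x, y) w)) x :=
  isFlowOf_flowX.hasDerivAt (flowY y w) x

theorem hasDerivAt_jointFlow_snd (w : Fin 6 → ℝ) (x y : ℝ) :
    HasDerivAt (fun s => jointFlow (x, s) w) (fieldY (jointFlow (x, y) w)) y := by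
  simpa only [jointFlow, flowX_flowY_comm] using isFlowOf_flowY.hasDerivAt (flowX x w) y

theorem hasStrictFDerivAt_jointFlow (w : Fin 6 → ℝ) (p : ℝ × ℝ) :
    HasStrictFDerivAt (fun p => jointFlow p w)
      ((ContinuousLinearMap.toSpanSingleton ℝ (fieldX (jointFlow p w))).coprod
        (ContinuousLinearMap.toSpanSingleton ℝ (fieldY (jointFlow p w)))) p :=
  isFlowOf_flowX.hasStrictFDerivAt_comp isFlowOf_flowY
    (contDiff_fieldX (n := 1)).continuous (contDiff_fieldY (n := 1)).continuous flowX_flowY_comm w p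

theorem IsFirstIntegral.jointFlow_eq {f : (Fin 6 → ℝ) → ℝ} (hf : IsFirstIntegral f) (p : ℝ × ℝ)
    (w : Fin 6 → ℝ) : f (jointFlow p w) = f w := by
  rw [jointFlow, isFlowOf_flowX.apply_eq_of_fderiv_eq_zero hf.1 hf.2,
    isFlowOf_flowY.apply_eq_of_fderiv_eq_zero hf.1 hf.3]

/-- The sign of `γ` is preserved by the flow on the hypersurface `γ γ⁻¹ = 1`. -/
theorem jointFlow_four_pos {w : Fin 6 → ℝ} (h : gammaProd w = 1) (h4 : 0 < w 4) (p : ℝ × ℝ) :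
    0 < jointFlow p w 4 := by
  have hne : ∀ q, jointFlow q w 4 ≠ 0 := fun q h0 => by
    have := isFirstIntegral_gammaProd.jointFlow_eq q w
    rw [h, gammaProd, h0, zero_mul] at this
    exact zero_ne_one this
  by_contra hcon
  have hc : Continuous fun q => jointFlow q w 4 :=
    (continuous_apply 4).comp
      (continuous_jointFlow.comp (continuous_id.prodMk continuous_const))
  obtain ⟨q, hq⟩ := mem_range_of_exists_le_of_exists_ge hc (c := 0) ⟨p, not_lt.1 hcon⟩
    ⟨0, by rw [jointFlow_zero]; exact h4.le⟩
  exact hne q hq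

/-! ### Potentials in real coordinates and the Lax action -/

namespace Potential

/-- The real coordinates `(Re α, Im α, Re β, Im β, γ, γ⁻¹)`. -/
noncomputable def coords (ζ : Potential) : Fin 6 → ℝ :=
  ![ζ.1.1.re, ζ.1.1.im, ζ.1.2.1.re, ζ.1.2.1.im, ζ.1.2.2, (ζ.1.2.2)⁻¹]

def ofCoords (w : Fin 6 → ℝ) (h : 0 < w 4) : Potential := ⟨(⟨w 0, w 1⟩, ⟨w 2, w 3⟩, w 4), h⟩

theorem coords_four_pos (ζ : Potential) : 0 < ζ.coords 4 := ζ.2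

theorem coords_five_pos (ζ : Potential) : 0 < ζ.coords 5 := inv_pos.2 ζ.2

theorem gammaProd_coords (ζ : Potential) : gammaProd ζ.coords = 1 :=
  mul_inv_cancel₀ ζ.2.ne'

theorem coords_ofCoords {w : Fin 6 → ℝ} (h : 0 < w 4) (hw : gammaProd w = 1) :
    (ofCoords w h).coords = w := by
  have h5 : (w 4)⁻¹ = w 5 := inv_eq_of_mul_eq_one_right hw
  ext i
  fin_cases i <;> simp [coords, ofCoords, h5]

theorem continuous_coords : Continuous coords := by
  refine continuous_pi fun i => ?_
  have h : Continuous fun ζ : Potential => ζ.1.2.2 := by fun_prop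
  fin_cases i <;> simp [coords]
  · exact Complex.continuous_re.comp (by fun_prop)
  · exact Complex.continuous_im.comp (by fun_prop)
  · exact Complex.continuous_re.comp (by fun_prop)
  · exact Complex.continuous_im.comp (by fun_prop)
  · exact h
  · exact h.inv₀ fun ζ => ζ.2.ne'

theorem range_coords : range coords = {w | gammaProd w = 1 ∧ 0 ≤ w 4} := by
  ext w
  constructor
  · rintro ⟨ζ, rfl⟩
    exact ⟨ζ.gammaProd_coords, ζ.coords_four_pos.le⟩
  · rintro ⟨h1, h2⟩
    have h4 : 0 < w 4 := h2.lt_of_ne fun h => by simp [gammaProd, ← h] at h1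
    exact ⟨ofCoords w h4, coords_ofCoords h4 h1⟩

/-- Recording γ⁻¹ as a coordinate keeps γ away from 0 on bounded sets. The image is therefore
closed, and compactness can be tested in ℝ⁶. -/
theorem isClosedEmbedding_coords : IsClosedEmbedding coords := by
  refine ⟨?_, ?_⟩
  · have hρ : Continuous fun w : Fin 6 → ℝ =>
        ((w 0 + w 1 * Complex.I, w 2 + w 3 * Complex.I, w 4) : ℂ × ℂ × ℝ) := by fun_prop
    refine .of_comp continuous_coords hρ ?_
    convert! (IsEmbedding.subtypeVal : IsEmbedding (Subtype.val : Potential → ℂ × ℂ × ℝ)) using 1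
    ext ζ <;> simp [coords]
  · rw [range_coords]
    exact (isClosed_eq (contDiff_gammaProd (n := 1)).continuous continuous_const).inter
      (isClosed_le continuous_const (continuous_apply 4))

theorem coords_injective : Function.Injective coords := isClosedEmbedding_coords.injective

theorem α_eq (ζ : Potential) : ζ.α = ζ.coords 0 + ζ.coords 1 * Complex.I :=
  (Complex.re_add_im _).symm

theorem β_eq (ζ : Potential) : ζ.β = ζ.coords 2 + ζ.coords 3 * Complex.I :=
  (Complex.re_add_im _).symm

theorem γ_eq (ζ : Potential) : ζ.γ = ζ.coords 4 := rfl

theorem coords_four_inv (ζ : Potential) : ((ζ.coords 4 : ℝ) : ℂ)⁻¹ = ζ.coords 5 :=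
  (Complex.ofReal_inv _).symm

/-- The value `ζ(z)` as a real linear function of the coordinates. -/
noncomputable def coordMatrix (z : ℂ) (w : Fin 6 → ℝ) : Matrix (Fin 2) (Fin 2) ℂ :=
  !![(w 0 + w 1 * Complex.I) * z - (w 0 - w 1 * Complex.I) * z ^ 2,
    -w 5 + (w 2 + w 3 * Complex.I) * z - w 4 * z ^ 2;
    w 4 * z - (w 2 - w 3 * Complex.I) * z ^ 2 + w 5 * z ^ 3,
    -(w 0 + w 1 * Complex.I) * z + (w 0 - w 1 * Complex.I) * z ^ 2]

theorem evalAt_eq (ζ : Potential) (z : ℂ) : ζ.evalAt z = coordMatrix z ζ.coords := by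
  ext i j
  fin_cases i <;> fin_cases j <;>
    simp [evalAt, toMatrix, coordMatrix, α_eq, β_eq, γ_eq, coords_four_inv, sub_eq_add_neg]

theorem hasDerivAt_coordMatrix {c : ℝ → Fin 6 → ℝ} {c' : Fin 6 → ℝ} {t : ℝ}
    (h : HasDerivAt c c' t) (z : ℂ) (i j : Fin 2) :
    HasDerivAt (fun s => coordMatrix z (c s) i j) (coordMatrix z c' i j) t := by
  let L : (Fin 6 → ℝ) →ₗ[ℝ] ℂ :=
    { toFun := fun w => coordMatrix z w i j
      map_add' := fun w k => by
        fin_cases i <;> fin_cases j <;> simp [coordMatrix] <;> ring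
      map_smul' := fun r w => by
        fin_cases i <;> fin_cases j <;> simp [coordMatrix] <;> ring }
  exact L.toContinuousLinearMap.hasFDerivAt.comp_hasDerivAt t h

theorem lie_laxU (ζ : Potential) {z : ℂ} (hz : z ≠ 0) :
    ⁅ζ.evalAt z, ζ.laxU z⁆ = coordMatrix z (fieldX ζ.coords) := by
  rw [evalAt_eq, Ring.lie_def]
  simp only [laxU, α_eq, γ_eq, coords_four_inv, coordMatrix, fieldX]
  ext i j
  fin_cases i <;> fin_cases j <;> simp <;> field_simp <;>
    ring_nf <;> simp only [Complex.I_sq] <;> ring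

theorem lie_laxV (ζ : Potential) {z : ℂ} (hz : z ≠ 0) :
    ⁅ζ.evalAt z, ζ.laxV z⁆ = coordMatrix z (fieldY ζ.coords) := by
  rw [evalAt_eq, Ring.lie_def]
  simp only [laxV, α_eq, γ_eq, coords_four_inv, coordMatrix, fieldY]
  ext i j
  fin_cases i <;> fin_cases j <;> simp <;> field_simp <;>
    ring_nf <;> simp only [Complex.I_sq] <;> ring

/-- The coordinates are real linear combinations of real and imaginary parts of entries at z = 1,
-1, 2, so they inherit differentiability. -/
theorem hasDerivAt_coords_of_entries {c : ℝ → Potential} {c' : Fin 6 → ℝ} {t : ℝ}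
    (h : ∀ z : ℂ, z ≠ 0 → ∀ i j, HasDerivAt (fun s => (c s).evalAt z i j) (coordMatrix z c' i j) t) :
    HasDerivAt (fun s => (c s).coords) c' t := by
  have hre : ∀ z : ℂ, z ≠ 0 → ∀ i j, HasDerivAt (fun s => (coordMatrix z (c s).coords i j).re)
      (coordMatrix z c' i j).re t := fun z hz i j => by
    simp only [← evalAt_eq]
    exact Complex.reCLM.hasFDerivAt.comp_hasDerivAt t (h z hz i j)
  have him : ∀ z : ℂ, z ≠ 0 → ∀ i j, HasDerivAt (fun s => (coordMatrix z (c s).coords i j).im)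
      (coordMatrix z c' i j).im t := fun z hz i j => by
    simp only [← evalAt_eq]
    exact Complex.imCLM.hasFDerivAt.comp_hasDerivAt t (h z hz i j)
  have hA := (hre (-1) (by simp) 0 0).const_mul (-1 / 2)
  have hA' := (him 1 one_ne_zero 0 0).const_mul (1 / 2)
  have hB := hre 1 one_ne_zero 0 1
  have hB' := him 1 one_ne_zero 0 1
  have hC := hre (-1) (by simp) 0 1
  have hD := hre 2 two_ne_zero 0 1
  have hE := (hB.sub hC).const_mul (1 / 2)
  -- The real part of the upper right entry is a quadratic in real z; interpolation at 1, -1, 2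
  -- isolates γ here and γ⁻¹ in the next line.
  have hF := ((hB.const_mul (3 / 2)).sub (hC.const_mul (1 / 2))).sub hD |>.const_mul (1 / 3)
  have hG := ((hD.const_mul (1 / 3)).sub (hC.const_mul (1 / 3))).sub hB
  refine hasDerivAt_pi.2 fun i => ?_
  fin_cases i
  · convert! hA using 1
    · ext s; simp [coordMatrix]; ring
    · simp [coordMatrix]; ring
  · convert! hA' using 1
    · ext s; simp [coordMatrix]; ring
    · simp [coordMatrix]; ring
  · convert! hE using 1
    · ext s; simp [coordMatrix]; ring
    · simp [coordMatrix]; ring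
  · convert! hB' using 1
    · ext s; simp [coordMatrix]
    · simp [coordMatrix]
  · convert! hF using 1
    · ext s; simp [coordMatrix, pow_two]; ring
    · simp [coordMatrix, pow_two]; ring
  · convert! hG using 1
    · ext s; simp [coordMatrix, pow_two]; ring
    · simp [coordMatrix, pow_two]; ring

theorem satisfiesLaxAt_laxU_iff {c : ℝ → Potential} {t : ℝ} :
    SatisfiesLaxAt laxU c t ↔ HasDerivAt (fun s => (c s).coords) (fieldX (c t).coords) t := by
  refine ⟨fun h => hasDerivAt_coords_of_entries fun z hz i j => ?_, fun h z hz i j => ?_⟩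
  · rw [← lie_laxU _ hz]; exact h z hz i j
  · rw [lie_laxU _ hz]; simpa only [evalAt_eq] using hasDerivAt_coordMatrix h z i j

theorem satisfiesLaxAt_laxV_iff {c : ℝ → Potential} {t : ℝ} :
    SatisfiesLaxAt laxV c t ↔ HasDerivAt (fun s => (c s).coords) (fieldY (c t).coords) t := by
  refine ⟨fun h => hasDerivAt_coords_of_entries fun z hz i j => ?_, fun h z hz i j => ?_⟩
  · rw [← lie_laxV _ hz]; exact h z hz i j
  · rw [lie_laxV _ hz]; simpa only [evalAt_eq] using hasDerivAt_coordMatrix h z i j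

/-- The action of `ℝ²` on potentials generated by the two Lax flows. -/
noncomputable def laxFlow (p : ℝ × ℝ) (ζ : Potential) : Potential :=
  ofCoords (jointFlow p ζ.coords) (jointFlow_four_pos ζ.gammaProd_coords ζ.coords_four_pos p)

theorem coords_laxFlow (p : ℝ × ℝ) (ζ : Potential) :
    (laxFlow p ζ).coords = jointFlow p ζ.coords :=
  coords_ofCoords _ (by rw [isFirstIntegral_gammaProd.jointFlow_eq, gammaProd_coords])

theorem laxFlow_zero (ζ : Potential) : laxFlow 0 ζ = ζ :=
  coords_injective (by rw [coords_laxFlow, jointFlow_zero])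

theorem laxFlow_add (p q : ℝ × ℝ) (ζ : Potential) :
    laxFlow (p + q) ζ = laxFlow p (laxFlow q ζ) :=
  coords_injective (by simp only [coords_laxFlow, jointFlow_add])

theorem continuous_laxFlow : Continuous fun r : (ℝ × ℝ) × Potential => laxFlow r.1 r.2 := by
  refine isClosedEmbedding_coords.isInducing.continuous_iff.2 ?_
  simp only [Function.comp_def, coords_laxFlow]
  exact continuous_jointFlow.comp
    (continuous_fst.prodMk (continuous_coords.comp continuous_snd))

theorem isLaxAction_laxFlow : IsLaxAction laxFlow where
  zero_act := laxFlow_zero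
  add_act := laxFlow_add
  continuous_act := continuous_laxFlow
  lax_x ζ x y := by
    rw [satisfiesLaxAt_laxU_iff]
    simpa only [coords_laxFlow] using hasDerivAt_jointFlow_fst ζ.coords x y
  lax_y ζ x y := by
    rw [satisfiesLaxAt_laxV_iff]
    simpa only [coords_laxFlow] using hasDerivAt_jointFlow_snd ζ.coords x y

theorem extendsLocalLaxFlows_laxFlow : ExtendsLocalLaxFlows laxFlow := by
  refine fun c r s hr hs => ⟨fun h t ht => coords_injective ?_, fun h t ht => coords_injective ?_⟩
  · rw [coords_laxFlow, isFlowOf_flowX.eqOn_Ioo contDiff_fieldX (c := fun s => (c s).coords) hr hs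
      (fun t ht => satisfiesLaxAt_laxU_iff.1 (h t ht)) t ht]
    simp [jointFlow, isFlowOf_flowY.zero]
  · rw [coords_laxFlow, isFlowOf_flowY.eqOn_Ioo contDiff_fieldY (c := fun s => (c s).coords) hr hs
      (fun t ht => satisfiesLaxAt_laxV_iff.1 (h t ht)) t ht]
    simp [jointFlow, isFlowOf_flowX.zero]

theorem laxFlow_eq_self {ζ : Potential} (hX : fieldX ζ.coords = 0) (hY : fieldY ζ.coords = 0)
    (p : ℝ × ℝ) : laxFlow p ζ = ζ := by
  refine coords_injective ?_
  rw [coords_laxFlow, jointFlow, isFlowOf_flowY.eq_self_of_eq_zero contDiff_fieldY hY,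
    isFlowOf_flowX.eq_self_of_eq_zero contDiff_fieldX hX]

/-! ### The spectral polynomial and isospectral sets -/

/-- The quotient of `det ζ` by `λ`, in terms of the first integrals. -/
noncomputable def specPoly (ζ : Potential) : ℂ[X] :=
  X ^ 4 - C (casimirRe ζ.coords - casimirIm ζ.coords * Complex.I) * X ^ 3
    + C (energy ζ.coords : ℂ) * X ^ 2
    - C (casimirRe ζ.coords + casimirIm ζ.coords * Complex.I) * X + 1

theorem det_toMatrix (ζ : Potential) : ζ.toMatrix.det = X * ζ.specPoly := by
  have hg : (C ((ζ.coords 4 : ℝ) : ℂ) : ℂ[X]) * C ((ζ.coords 5 : ℝ) : ℂ) = 1 := by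
    rw [← C_mul, ← Complex.ofReal_mul]
    have := ζ.gammaProd_coords
    rw [gammaProd] at this
    simp [this]
  have hI : (C Complex.I : ℂ[X]) ^ 2 = -1 := by rw [← C_pow, Complex.I_sq]; simp
  rw [Matrix.det_fin_two]
  simp only [toMatrix, specPoly, casimirRe, casimirIm, energy, γ_eq, coords_four_inv, α_eq, β_eq]
  simp
  generalize ζ.coords = w at hg ⊢
  rw [show (C 2 : ℂ[X]) = 2 from map_ofNat C 2]
  linear_combination (X : ℂ[X]) ^ 5 * hg + X * hg
    -((C (w 1 : ℂ)) ^ 2 * (X ^ 2 + 2 * X ^ 3 + X ^ 4) + X ^ 3 * C (w 3 : ℂ) ^ 2) * hI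

end Potential

namespace Potential

theorem mem_isoSet_iff {ζ : Potential} {a : ℂ[X]} : ζ ∈ isoSet a ↔ ζ.specPoly = a := by
  rw [isoSet, mem_ofPred_eq, det_toMatrix]
  exact mul_right_inj' X_ne_zero

theorem specPoly_coeff (ζ : Potential) :
    ζ.specPoly.coeff 2 = energy ζ.coords ∧
      ζ.specPoly.coeff 1 = -(casimirRe ζ.coords + casimirIm ζ.coords * Complex.I) := by
  unfold specPoly
  constructor <;> simp [coeff_one, coeff_X_pow, -map_add, -map_sub, -map_mul]

theorem specPoly_eq_iff {ζ ζ' : Potential} : ζ.specPoly = ζ'.specPoly ↔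
    casimirRe ζ.coords = casimirRe ζ'.coords ∧ casimirIm ζ.coords = casimirIm ζ'.coords ∧
      energy ζ.coords = energy ζ'.coords := by
  constructor
  · intro h
    obtain ⟨h2, h1⟩ := ζ.specPoly_coeff
    obtain ⟨h2', h1'⟩ := ζ'.specPoly_coeff
    rw [h, h2'] at h2
    rw [h, h1', neg_inj] at h1
    refine ⟨?_, ?_, ?_⟩
    · simpa using (congrArg Complex.re h1).symm
    · simpa using (congrArg Complex.im h1).symm
    · exact_mod_cast h2.symm
  · rintro ⟨h1, h2, h3⟩
    simp only [specPoly, h1, h2, h3]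

theorem specPoly_laxFlow (p : ℝ × ℝ) (ζ : Potential) : (laxFlow p ζ).specPoly = ζ.specPoly := by
  simp only [specPoly_eq_iff, coords_laxFlow, isFirstIntegral_casimirRe.jointFlow_eq,
    isFirstIntegral_casimirIm.jointFlow_eq, isFirstIntegral_energy.jointFlow_eq, and_self]

theorem laxFlow_mem_isoSet {ζ : Potential} {a : ℂ[X]} (h : ζ ∈ isoSet a) (p : ℝ × ℝ) :
    laxFlow p ζ ∈ isoSet a := by
  rwa [mem_isoSet_iff, specPoly_laxFlow, ← mem_isoSet_iff]

theorem isCompact_isoSet (a : ℂ[X]) : IsCompact (isoSet a) := by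
  rcases (isoSet a).eq_empty_or_nonempty with h | ⟨ζ, hζ⟩
  · rw [h]; exact isCompact_empty
  have : isoSet a = coords ⁻¹' {w | casimirRe w = casimirRe ζ.coords ∧
      casimirIm w = casimirIm ζ.coords ∧ energy w = energy ζ.coords} := by
    ext ζ'
    rw [mem_isoSet_iff, ← mem_isoSet_iff.1 hζ, specPoly_eq_iff]
    rfl
  rw [this]
  refine isClosedEmbedding_coords.isCompact_preimage
    (isCompact_of_isClosed_isBounded ?_ ((isBounded_energy_le (energy ζ.coords)).subset ?_))
  · exact (isClosed_eq (contDiff_casimirRe (n := 1)).continuous continuous_const).inter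
      ((isClosed_eq (contDiff_casimirIm (n := 1)).continuous continuous_const).inter
        (isClosed_eq (contDiff_energy (n := 1)).continuous continuous_const))
  · exact fun w hw => hw.2.2.le

/-- Vanishing at a point of the unit circle, in real terms. -/
theorem evalAt_eq_zero_of_circle {ζ : Potential} {x y : ℝ} (hxy : x ^ 2 + y ^ 2 = 1)
    (h0 : ζ.coords 0 = ζ.coords 0 * x + ζ.coords 1 * y)
    (h1 : ζ.coords 1 = ζ.coords 0 * y - ζ.coords 1 * x)
    (h2 : ζ.coords 2 = (ζ.coords 4 + ζ.coords 5) * x)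
    (h3 : ζ.coords 3 = (ζ.coords 4 - ζ.coords 5) * y) :
    ζ.evalAt (x + y * Complex.I) = 0 := by
  rw [evalAt_eq]
  generalize ζ.coords = w at *
  have hz : ((x : ℂ) + y * Complex.I) * (x - y * Complex.I) = 1 := by
    have : ((x : ℂ) ^ 2 + y ^ 2) = 1 := by exact_mod_cast hxy
    linear_combination this - (y : ℂ) ^ 2 * Complex.I_sq
  have hα : (w 0 + w 1 * Complex.I : ℂ) = (w 0 - w 1 * Complex.I) * (x + y * Complex.I) := by
    have h0' : (w 0 : ℂ) = w 0 * x + w 1 * y := by exact_mod_cast h0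
    have h1' : (w 1 : ℂ) = w 0 * y - w 1 * x := by exact_mod_cast h1
    linear_combination h0' + Complex.I * h1' + (w 1 : ℂ) * y * Complex.I_sq
  have h2' : (w 2 : ℂ) = (w 4 + w 5) * x := by exact_mod_cast h2
  have h3' : (w 3 : ℂ) = (w 4 - w 5) * y := by exact_mod_cast h3
  have hβ : (w 2 + w 3 * Complex.I : ℂ) = w 4 * (x + y * Complex.I) + w 5 * (x - y * Complex.I) := by
    linear_combination h2' + Complex.I * h3'
  have hβ' : (w 2 - w 3 * Complex.I : ℂ) = w 4 * (x - y * Complex.I) + w 5 * (x + y * Complex.I) := by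
    linear_combination h2' - Complex.I * h3'
  generalize (x + y * Complex.I : ℂ) = z at *
  generalize (x - y * Complex.I : ℂ) = z' at *
  simp only [coordMatrix, hβ, hβ', hα]
  ext i j
  fin_cases i <;> fin_cases j <;> simp
  · ring
  · linear_combination (w 5 : ℂ) * hz
  · linear_combination (-(w 4 : ℂ) * z) * hz
  · ring

/-- Here the diagonal vanishes and both off-diagonal entries are multiples of z² - βz + 1, so a root
of this quadratic works. -/
theorem exists_evalAt_eq_zero_of_gamma_eq_one {ζ : Potential} (h0 : ζ.coords 0 = 0)
    (h1 : ζ.coords 1 = 0) (h3 : ζ.coords 3 = 0) (h4 : ζ.coords 4 = 1) (h5 : ζ.coords 5 = 1) :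
    ∃ z, ζ.evalAt z = 0 := by
  obtain ⟨s, hs⟩ := IsAlgClosed.exists_pow_nat_eq ((ζ.coords 2 : ℂ) ^ 2 - 4) two_pos
  refine ⟨(ζ.coords 2 + s) / 2, ?_⟩
  rw [evalAt_eq]
  ext i j
  fin_cases i <;> fin_cases j <;> simp [coordMatrix, h0, h1, h3, h4, h5]
  · linear_combination (-1 / 4 : ℂ) * hs
  · linear_combination (1 / 8 : ℂ) * (ζ.coords 2 + s) * hs

/-- At a point z = x + iy of the circle z⁻²a(z) is real and equals |α - ᾱz|² + |β - γz - γ⁻¹z̄|².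
Its vanishing kills each of the four real squares. -/
theorem eq_of_isRoot_of_norm_eq_one {ζ : Potential} {x y : ℝ} (hxy : x ^ 2 + y ^ 2 = 1)
    (h : ζ.specPoly.IsRoot (x + y * Complex.I)) :
    ζ.coords 0 = ζ.coords 0 * x + ζ.coords 1 * y ∧ ζ.coords 1 = ζ.coords 0 * y - ζ.coords 1 * x ∧
    ζ.coords 2 = (ζ.coords 4 + ζ.coords 5) * x ∧ ζ.coords 3 = (ζ.coords 4 - ζ.coords 5) * y := by
  have hg := ζ.gammaProd_coords
  rw [IsRoot, specPoly] at h
  simp only [eval_add, eval_sub, eval_mul, eval_pow, eval_X, eval_C, eval_one] at h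
  unfold gammaProd at hg
  generalize hN : energy ζ.coords = N at h
  generalize hc₁ : casimirRe ζ.coords = c₁ at h
  generalize hc₂ : casimirIm ζ.coords = c₂ at h
  -- This is z⁻²a(z), written with z⁻¹ = z̄ on the circle.
  have key : 2 * (x ^ 2 - y ^ 2) - 2 * (c₁ * x + c₂ * y) + N = 0 := by
    have hxy' : ((x : ℂ) ^ 2 + y ^ 2) = 1 := by exact_mod_cast hxy
    have hz : ((x : ℂ) + y * Complex.I) * (x - y * Complex.I) = 1 := by
      linear_combination hxy' - (y : ℂ) ^ 2 * Complex.I_sq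
    have : (2 * ((x : ℂ) ^ 2 - y ^ 2) - 2 * (c₁ * x + c₂ * y) + N : ℂ) = 0 := by
      generalize hzz : (x + y * Complex.I : ℂ) = z at *
      generalize hzz' : (x - y * Complex.I : ℂ) = z' at *
      have e1 : (2 * ((x : ℂ) ^ 2 - y ^ 2)) = z ^ 2 + z' ^ 2 := by
        rw [← hzz, ← hzz']; linear_combination (-2 * (y : ℂ) ^ 2) * Complex.I_sq
      have e2 : (2 * ((c₁ : ℂ) * x + c₂ * y)) =
          (c₁ - c₂ * Complex.I) * z + (c₁ + c₂ * Complex.I) * z' := by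
        rw [← hzz, ← hzz']; linear_combination (2 * (y : ℂ) * c₂) * Complex.I_sq
      rw [e1, e2]
      linear_combination z' ^ 2 * h - (z ^ 2 * (z * z' + 1) - (c₁ - c₂ * Complex.I) * z * (z * z' + 1)
        + N * (z * z' + 1) - (c₁ + c₂ * Complex.I) * z') * hz
    exact_mod_cast this
  simp only [energy, casimirRe, casimirIm] at hN hc₁ hc₂
  generalize ζ.coords = w at *
  have sum : (w 0 - (w 0 * x + w 1 * y)) ^ 2 + (w 1 - (w 0 * y - w 1 * x)) ^ 2 +
      (w 2 - (w 4 + w 5) * x) ^ 2 + (w 3 - (w 4 - w 5) * y) ^ 2 = 0 := by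
    rw [← hN, ← hc₁, ← hc₂] at key
    linear_combination key + (w 0 ^ 2 + w 1 ^ 2 + w 4 ^ 2 + w 5 ^ 2) * hxy +
      (2 * x ^ 2 - 2 * y ^ 2) * hg
  have h1 := sq_nonneg (w 0 - (w 0 * x + w 1 * y))
  have h2 := sq_nonneg (w 1 - (w 0 * y - w 1 * x))
  have h3 := sq_nonneg (w 2 - (w 4 + w 5) * x)
  have h4 := sq_nonneg (w 3 - (w 4 - w 5) * y)
  refine ⟨?_, ?_, ?_, ?_⟩ <;> refine sub_eq_zero.1 (pow_eq_zero_iff two_ne_zero |>.1 ?_) <;> linarith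

/-! ### Inner potentials are determined by α -/

/-- The potentials for which the roots of `γ⁻¹ - β λ + γ λ²` lie in the closed unit disc and have a
product of modulus less than one (Schur's criterion). -/
def IsInner (ζ : Potential) : Prop :=
  ζ.coords 5 < ζ.coords 4 ∧
    (ζ.coords 2 * (ζ.coords 4 - ζ.coords 5)) ^ 2 + (ζ.coords 3 * (ζ.coords 4 + ζ.coords 5)) ^ 2 ≤
      ((ζ.coords 4 + ζ.coords 5) * (ζ.coords 4 - ζ.coords 5)) ^ 2

end Potential

/-- With t - s fixed, A/s + B/t + s is convex in s, and `hle` says that its derivative at s is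
nonnegative. It strictly increases to the right of s, so the level N is not taken again there. -/
theorem le_of_level_of_le {s s' t t' A B N : ℝ} (hs : 0 < s) (ht : 0 < t) (hst : s' - s = t' - t)
    (hA : 0 ≤ A) (hB : 0 ≤ B) (h : A / s + B / t + s = N) (h' : A / s' + B / t' + s' = N)
    (hle : A / s ^ 2 + B / t ^ 2 ≤ 1) : s' ≤ s := by
  by_contra! hlt
  have hs' : 0 < s' := hs.trans hlt
  have ht' : 0 < t' := by linarith
  have e1 : A / s - A / s' = (s' - s) * (A / (s * s')) := by field_simp
  have e2 : B / t - B / t' = (s' - s) * (B / (t * t')) := by rw [hst]; field_simp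
  have e3 : (s' - s) * (A / (s * s') + B / (t * t') - 1) = 0 := by linarith
  have e4 : A / (s * s') + B / (t * t') = 1 := by
    rcases mul_eq_zero.1 e3 with h0 | h0 <;> linarith
  have f1 : A / (s * s') = A / s ^ 2 * (s / s') := by field_simp
  have f2 : B / (t * t') = B / t ^ 2 * (t / t') := by field_simp
  have g1 : s / s' < 1 := (div_lt_one hs').2 hlt
  have g2 : t / t' < 1 := (div_lt_one ht').2 (by linarith)
  have k1 : 0 ≤ A / s ^ 2 := by positivity
  have k2 : 0 ≤ B / t ^ 2 := by positivity
  rw [f1, f2] at e4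
  rcases k1.eq_or_lt with k | k
  · rw [← k] at e4 hle
    nlinarith [mul_nonneg k2 (sub_nonneg.2 g2.le)]
  · nlinarith [mul_pos k (sub_pos.2 g1), mul_nonneg k2 (sub_nonneg.2 g2.le)]

namespace Potential

/-- Put p = γ + γ⁻¹ and q = γ - γ⁻¹, so p² - q² = 4. For fixed α the integrals fix p Re β, q Im β
and |β|² + p², which becomes a level equation for s = p², t = q². Schur's inequality is the
derivative condition of `le_of_level_of_le`, applied in both directions to get p = p'. -/
theorem IsInner.eq_of_specPoly_eq {ζ ζ' : Potential} (h : ζ.IsInner) (h' : ζ'.IsInner)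
    (hs : ζ.specPoly = ζ'.specPoly) (h0 : ζ.coords 0 = ζ'.coords 0)
    (h1 : ζ.coords 1 = ζ'.coords 1) : ζ = ζ' := by
  refine coords_injective ?_
  obtain ⟨k1, k2, k3⟩ := specPoly_eq_iff.1 hs
  have hg := ζ.gammaProd_coords
  have hg' := ζ'.gammaProd_coords
  have p4 := ζ.coords_four_pos
  have p5 := ζ.coords_five_pos
  have p4' := ζ'.coords_four_pos
  have p5' := ζ'.coords_five_pos
  obtain ⟨hq, hi⟩ := h
  obtain ⟨hq', hi'⟩ := h'
  unfold casimirRe at k1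
  unfold casimirIm at k2
  unfold energy at k3
  unfold gammaProd at hg hg'
  generalize ζ.coords = w at *
  generalize ζ'.coords = w' at *
  set p := w 4 + w 5 with hp
  set q := w 4 - w 5 with hqd
  set p' := w' 4 + w' 5 with hp'
  set q' := w' 4 - w' 5 with hqd'
  have pp : 0 < p := by positivity
  have pp' : 0 < p' := by positivity
  have qp : 0 < q := by rw [hqd]; linarith
  have qp' : 0 < q' := by rw [hqd']; linarith
  have c1 : w 2 * p = w' 2 * p' := by rw [h0, h1] at k1; linarith
  have c2 : w 3 * q = w' 3 * q' := by rw [h0, h1] at k2; linarith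
  have hpq : p ^ 2 - q ^ 2 = 4 := by rw [hp, hqd]; linear_combination 4 * hg
  have hpq' : p' ^ 2 - q' ^ 2 = 4 := by rw [hp', hqd']; linear_combination 4 * hg'
  have hN : w 2 ^ 2 + w 3 ^ 2 + p ^ 2 = w' 2 ^ 2 + w' 3 ^ 2 + p' ^ 2 := by
    rw [hp, hp', ← sub_eq_zero]
    rw [h0, h1] at k3
    linear_combination k3 + 2 * hg - 2 * hg'
  have lev : ∀ b₁ b₂ p q : ℝ, 0 < p → 0 < q →
      (b₁ * p) ^ 2 / p ^ 2 + (b₂ * q) ^ 2 / q ^ 2 + p ^ 2 = b₁ ^ 2 + b₂ ^ 2 + p ^ 2 := by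
    intro b₁ b₂ p q hp hq
    field_simp
  have ine : ∀ b₁ b₂ p q : ℝ, 0 < p → 0 < q → (b₁ * q) ^ 2 + (b₂ * p) ^ 2 ≤ (p * q) ^ 2 →
      (b₁ * p) ^ 2 / (p ^ 2) ^ 2 + (b₂ * q) ^ 2 / (q ^ 2) ^ 2 ≤ 1 := by
    intro b₁ b₂ p q hp hq h
    rw [show (b₁ * p) ^ 2 / (p ^ 2) ^ 2 + (b₂ * q) ^ 2 / (q ^ 2) ^ 2 =
      ((b₁ * q) ^ 2 + (b₂ * p) ^ 2) / (p * q) ^ 2 by field_simp]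
    exact (div_le_one (by positivity)).2 h
  have le1 : p' ^ 2 ≤ p ^ 2 := by
    refine le_of_level_of_le (A := (w 2 * p) ^ 2) (B := (w 3 * q) ^ 2) (t := q ^ 2) (t' := q' ^ 2)
      (by positivity) (by positivity) (by linarith) (by positivity) (by positivity)
      (lev _ _ _ _ pp qp) ?_ (ine _ _ _ _ pp qp hi)
    rw [c1, c2, lev _ _ _ _ pp' qp', hN]
  have le2 : p ^ 2 ≤ p' ^ 2 := by
    refine le_of_level_of_le (A := (w' 2 * p') ^ 2) (B := (w' 3 * q') ^ 2) (t := q' ^ 2)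
      (t' := q ^ 2) (by positivity) (by positivity) (by linarith) (by positivity) (by positivity)
      (lev _ _ _ _ pp' qp') ?_ (ine _ _ _ _ pp' qp' hi')
    rw [← c1, ← c2, lev _ _ _ _ pp qp, hN]
  have ep : p = p' := (pow_left_inj₀ pp.le pp'.le two_ne_zero).1 (le_antisymm le2 le1)
  have eq : q = q' := (pow_left_inj₀ qp.le qp'.le two_ne_zero).1 (by rw [ep] at hpq; linarith)
  rw [← ep] at c1
  rw [← eq] at c2
  have e2 := mul_right_cancel₀ pp.ne' c1
  have e3 := mul_right_cancel₀ qp.ne' c2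
  ext i
  fin_cases i
  · exact h0
  · exact h1
  · exact e2
  · exact e3
  · simp; linarith
  · simp; linarith

end Potential

/-! ### Maxima of γ and the second-order condition -/

/-- If c were positive the point would also be a local minimum, making f locally constant and its
second derivative zero. -/
theorem second_deriv_nonpos_of_forall_le {f f' : ℝ → ℝ} {c : ℝ} {t₀ : ℝ}
    (hf : ∀ᶠ t in 𝓝 t₀, HasDerivAt f (f' t) t) (hf' : HasDerivAt f' c t₀)
    (hmax : IsLocalMax f t₀) : c ≤ 0 := by
  by_contra! hc
  have hd : deriv f =ᶠ[𝓝 t₀] f' := hf.mono fun t ht => ht.deriv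
  have h2 : deriv (deriv f) t₀ = c := by rw [hd.deriv_eq, hf'.deriv]
  have hmin := isLocalMin_of_deriv_deriv_pos (h2 ▸ hc) hmax.deriv_eq_zero
    hf.self_of_nhds.continuousAt
  have hconst : f =ᶠ[𝓝 t₀] fun _ => f t₀ := by
    filter_upwards [hmax, hmin] with t h1 h2 using le_antisymm h1 h2
  have h3 : deriv f =ᶠ[𝓝 t₀] fun _ => 0 := by
    filter_upwards [hconst.eventuallyEq_nhds] with t ht
    rw [ht.deriv_eq, deriv_const]
  rw [h3.deriv_eq, deriv_const] at h2
  exact hc.ne h2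

theorem hasDerivAt_jointFlow_line (w : Fin 6 → ℝ) (ξ η t : ℝ) :
    HasDerivAt (fun t => jointFlow (t * ξ, t * η) w)
      (ξ • fieldX (jointFlow (t * ξ, t * η) w) + η • fieldY (jointFlow (t * ξ, t * η) w)) t := by
  have h1 : HasDerivAt (fun t : ℝ => (t * ξ, t * η)) (ξ, η) t :=
    (hasDerivAt_mul_const ξ).prodMk (hasDerivAt_mul_const η)
  have := (hasStrictFDerivAt_jointFlow w (t * ξ, t * η)).hasFDerivAt.comp_hasDerivAt t h1
  exact this.congr_deriv (by simp)

/-- At a maximum of `γ` on an orbit the gradient vanishes and the Hessian is negative. -/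
theorem conditions_of_forall_jointFlow_le {w : Fin 6 → ℝ} (h4 : 0 < w 4) (h5 : 0 < w 5)
    (hmax : ∀ p, jointFlow p w 4 ≤ w 4) :
    w 0 = 0 ∧ w 1 = 0 ∧ w 5 ≤ w 4 ∧ (w 2 * (w 4 - w 5)) ^ 2 + (w 3 * (w 4 + w 5)) ^ 2 ≤
      ((w 4 + w 5) * (w 4 - w 5)) ^ 2 := by
  let c : ℝ → ℝ → ℝ → Fin 6 → ℝ := fun ξ η t => jointFlow (t * ξ, t * η) w
  have hc : ∀ ξ η t i, HasDerivAt (fun t => c ξ η t i)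
      (ξ * fieldX (c ξ η t) i + η * fieldY (c ξ η t) i) t := fun ξ η t i => by
    simpa using hasDerivAt_pi.1 (hasDerivAt_jointFlow_line w ξ η t) i
  have c0 : ∀ ξ η, c ξ η 0 = w := fun ξ η => by
    simp only [c, zero_mul]; exact jointFlow_zero w
  have hd : ∀ ξ η t, HasDerivAt (fun t => c ξ η t 4)
      (-2 * (ξ * c ξ η t 0 - η * c ξ η t 1) * c ξ η t 4) t := fun ξ η t => by
    refine (hc ξ η t 4).congr_deriv ?_
    simp [fieldX, fieldY]; ring
  have hlm : ∀ ξ η, IsLocalMax (fun t => c ξ η t 4) 0 := fun ξ η => .of_forall fun t => by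
    simp only [c0]; exact hmax _
  have h0 : w 0 = 0 := by
    have := (hlm 1 0).hasDerivAt_eq_zero (hd 1 0 0)
    simpa [c0, h4.ne'] using this
  have h1 : w 1 = 0 := by
    have := (hlm 0 1).hasDerivAt_eq_zero (hd 0 1 0)
    simpa [c0, h4.ne'] using this
  -- Negative of the Hessian of γ in direction (ξ, η), up to a positive factor. Its diagonal entries
  -- sum to 2(γ + γ⁻¹)(γ - γ⁻¹), giving γ⁻¹ ≤ γ, and its discriminant gives Schur's inequality.
  have hess : ∀ ξ η : ℝ, 0 ≤ (w 4 - w 5) * (w 2 + (w 4 + w 5)) * (ξ * ξ) -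
      2 * (w 4 + w 5) * w 3 * η * ξ + (w 4 - w 5) * (w 4 + w 5 - w 2) * (η * η) := fun ξ η => by
    have hk := (((((hc ξ η 0 0).const_mul ξ).sub ((hc ξ η 0 1).const_mul η)).const_mul
      (-2)).mul (hc ξ η 0 4))
    have := second_deriv_nonpos_of_forall_le (.of_forall (hd ξ η)) hk (hlm ξ η)
    simp only [Pi.sub_apply, c0, h0, h1, mul_zero, sub_zero, zero_mul, add_zero] at this
    simp [fieldX, fieldY, h0, h1] at this
    by_contra! hneg
    nlinarith [mul_pos_of_neg_of_neg hneg (neg_neg_of_pos h4)]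
  have hA := hess 1 0
  have hD := hess 0 1
  have hp : 0 < w 4 + w 5 := by positivity
  have hdis := discrim_le_zero (a := (w 4 - w 5) * (w 2 + (w 4 + w 5)))
    (b := -2 * (w 4 + w 5) * w 3) (c := (w 4 - w 5) * (w 4 + w 5 - w 2))
    fun x => by simpa [sub_eq_add_neg] using hess x 1
  refine ⟨h0, h1, ?_, ?_⟩
  · by_contra! hlt
    nlinarith [mul_pos (sub_pos.2 hlt) hp]
  · rw [discrim] at hdis
    nlinarith

/-! ### Orbits, their closures and local transitivity -/

namespace Potential

theorem mem_laxOrbit_self (ζ : Potential) : ζ ∈ laxOrbit laxFlow ζ := ⟨0, laxFlow_zero ζ⟩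

theorem laxFlow_neg_laxFlow (p : ℝ × ℝ) (ζ : Potential) : laxFlow (-p) (laxFlow p ζ) = ζ := by
  rw [← laxFlow_add, neg_add_cancel, laxFlow_zero]

theorem laxOrbit_laxFlow (p : ℝ × ℝ) (ζ : Potential) :
    laxOrbit laxFlow (laxFlow p ζ) = laxOrbit laxFlow ζ := by
  refine Subset.antisymm ?_ ?_
  · rintro _ ⟨q, rfl⟩
    exact ⟨q + p, laxFlow_add q p ζ⟩
  · rintro _ ⟨q, rfl⟩
    refine ⟨q - p, ?_⟩
    simp only [← laxFlow_add, sub_add_cancel]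

theorem laxOrbit_eq_of_mem {ζ ζ' : Potential} (h : ζ' ∈ laxOrbit laxFlow ζ) :
    laxOrbit laxFlow ζ' = laxOrbit laxFlow ζ := by
  obtain ⟨p, rfl⟩ := h
  exact laxOrbit_laxFlow p ζ

theorem laxOrbit_subset_isoSet {ζ : Potential} {a : ℂ[X]} (h : ζ ∈ isoSet a) :
    laxOrbit laxFlow ζ ⊆ isoSet a := by
  rintro _ ⟨p, rfl⟩
  exact laxFlow_mem_isoSet h p

theorem continuous_laxFlow_left (p : ℝ × ℝ) : Continuous (laxFlow p) :=
  continuous_laxFlow.comp (continuous_const.prodMk continuous_id)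

theorem continuous_laxFlow_right (ζ : Potential) : Continuous fun p => laxFlow p ζ :=
  continuous_laxFlow.comp (continuous_id.prodMk continuous_const)

theorem laxFlow_mem_closure_laxOrbit {ζ ζ' : Potential}
    (h : ζ' ∈ closure (laxOrbit laxFlow ζ)) (p : ℝ × ℝ) :
    laxFlow p ζ' ∈ closure (laxOrbit laxFlow ζ) := by
  refine map_mem_closure (continuous_laxFlow_left p) h ?_
  rintro _ ⟨q, rfl⟩
  exact ⟨p + q, laxFlow_add p q ζ⟩

theorem continuous_coords_apply (i : Fin 6) : Continuous fun ζ : Potential => ζ.coords i :=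
  (continuous_apply i).comp continuous_coords

/-- The closure of each orbit contains a maximum of `γ`, which satisfies the first and second order
conditions. -/
theorem exists_forall_mem_closure_laxOrbit_le (ζ : Potential) :
    ∃ M ∈ closure (laxOrbit laxFlow ζ), M.coords 0 = 0 ∧ M.coords 1 = 0 ∧
      M.coords 5 ≤ M.coords 4 ∧
      (M.coords 2 * (M.coords 4 - M.coords 5)) ^ 2 + (M.coords 3 * (M.coords 4 + M.coords 5)) ^ 2 ≤
        ((M.coords 4 + M.coords 5) * (M.coords 4 - M.coords 5)) ^ 2 ∧
      ∀ ζ' ∈ closure (laxOrbit laxFlow ζ), ζ'.coords 4 ≤ M.coords 4 := by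
  have hc : IsCompact (closure (laxOrbit laxFlow ζ)) :=
    (isCompact_isoSet ζ.specPoly).closure_of_subset
      (laxOrbit_subset_isoSet (mem_isoSet_iff.2 rfl))
  obtain ⟨M, hM, hmax⟩ := hc.exists_isMaxOn ⟨ζ, subset_closure (mem_laxOrbit_self ζ)⟩
    (continuous_coords_apply 4).continuousOn
  obtain ⟨h0, h1, h2, h3⟩ := conditions_of_forall_jointFlow_le M.coords_four_pos
    M.coords_five_pos fun p => by
      rw [← coords_laxFlow]
      exact hmax (laxFlow_mem_closure_laxOrbit hM p)
  exact ⟨M, hM, h0, h1, h2, h3, fun ζ' h => hmax h⟩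

theorem closure_laxOrbit_subset_isoSet {ζ : Potential} {a : ℂ[X]} (h : ζ ∈ isoSet a) :
    closure (laxOrbit laxFlow ζ) ⊆ isoSet a :=
  closure_minimal (laxOrbit_subset_isoSet h) (isCompact_isoSet a).isClosed

/-- An orbit is a neighbourhood of `M` in its isospectral set, as soon as some linear function of
the coordinates is submersive along the orbit and locally injective on the isospectral set. -/
theorem eventually_mem_laxOrbit {G : Type*} [NormedAddCommGroup G] [NormedSpace ℝ G]
    [CompleteSpace G] (T : (Fin 6 → ℝ) →L[ℝ] G) {M : Potential} {a : ℂ[X]} {U : Set Potential}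
    (hM : M ∈ isoSet a) (hU : U ∈ 𝓝 M)
    (hinj : ∀ ζ ∈ U ∩ isoSet a, ∀ ζ' ∈ U ∩ isoSet a, T ζ.coords = T ζ'.coords → ζ = ζ')
    (hsurj : ∀ g : G, ∃ ξ η : ℝ, ξ • T (fieldX M.coords) + η • T (fieldY M.coords) = g) :
    ∀ᶠ ζ in 𝓝 M, ζ ∈ isoSet a → ζ ∈ laxOrbit laxFlow M := by
  have hd := T.hasStrictFDerivAt.comp (0 : ℝ × ℝ) (hasStrictFDerivAt_jointFlow M.coords 0)
  rw [jointFlow_zero] at hd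
  -- A submersion is open: every value of T close to its value at M is attained on the orbit, and
  -- injectivity of T on the isospectral set turns equal values into equal points.
  have hmap := hd.map_nhds_eq_of_surj (LinearMap.range_eq_top.2 fun g => by
    obtain ⟨ξ, η, h⟩ := hsurj g
    exact ⟨(ξ, η), by simpa using h⟩)
  have hV : {p | laxFlow p M ∈ U} ∈ 𝓝 (0 : ℝ × ℝ) :=
    (continuous_laxFlow_right M).continuousAt.preimage_mem_nhds (by rwa [laxFlow_zero])
  have himg := image_mem_map (m := fun p => T (jointFlow p M.coords)) hV
  rw [hmap] at himg
  have hT : ContinuousAt (fun ζ : Potential => T ζ.coords) M :=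
    (T.continuous.comp continuous_coords).continuousAt
  have hpre : ∀ᶠ ζ in 𝓝 M, T ζ.coords ∈ (fun p => T (jointFlow p M.coords)) ''
      {p | laxFlow p M ∈ U} := hT (by simpa [jointFlow_zero] using himg)
  filter_upwards [hpre, hU] with ζ ⟨p, hp, hpe⟩ hζU hζ
  refine ⟨p, hinj _ ⟨hp, laxFlow_mem_isoSet hM p⟩ _ ⟨hζU, hζ⟩ ?_⟩
  rw [coords_laxFlow]
  exact hpe

/-- The orbit of M is a neighbourhood of M in I(a), so an orbit accumulating at M meets it, and
orbits that meet coincide. -/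
theorem mem_laxOrbit_of_mem_closure {M ζ : Potential} {a : ℂ[X]}
    (hev : ∀ᶠ ζ in 𝓝 M, ζ ∈ isoSet a → ζ ∈ laxOrbit laxFlow M) (hζ : ζ ∈ isoSet a)
    (hM : M ∈ closure (laxOrbit laxFlow ζ)) : M ∈ laxOrbit laxFlow ζ := by
  obtain ⟨ζ', h1, h2⟩ := (mem_closure_iff_frequently.1 hM).and_eventually hev |>.exists
  rw [← laxOrbit_eq_of_mem h1, laxOrbit_eq_of_mem (h2 (laxOrbit_subset_isoSet hζ h1))]
  exact mem_laxOrbit_self M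

/-- The projection to `α`. -/
noncomputable def alphaCLM : (Fin 6 → ℝ) →L[ℝ] ℝ × ℝ :=
  (ContinuousLinearMap.proj 0).prod (ContinuousLinearMap.proj 1)

theorem alphaCLM_apply (w : Fin 6 → ℝ) : alphaCLM w = (w 0, w 1) := rfl

/-- The interior of the set of inner potentials. -/
def IsStrictlyInner (ζ : Potential) : Prop :=
  ζ.coords 5 < ζ.coords 4 ∧
    (ζ.coords 2 * (ζ.coords 4 - ζ.coords 5)) ^ 2 + (ζ.coords 3 * (ζ.coords 4 + ζ.coords 5)) ^ 2 <
      ((ζ.coords 4 + ζ.coords 5) * (ζ.coords 4 - ζ.coords 5)) ^ 2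

theorem IsStrictlyInner.isInner {ζ : Potential} (h : ζ.IsStrictlyInner) : ζ.IsInner :=
  ⟨h.1, h.2.le⟩

theorem isOpen_setOf_isStrictlyInner : IsOpen {ζ : Potential | ζ.IsStrictlyInner} := by
  have h := continuous_coords_apply
  simp only [IsStrictlyInner, ofPred_and]
  refine (isOpen_lt (h 5) (h 4)).inter (isOpen_lt ?_ ?_)
  · exact (((h 2).mul ((h 4).sub (h 5))).pow 2).add (((h 3).mul ((h 4).add (h 5))).pow 2)
  · exact (((h 4).add (h 5)).mul ((h 4).sub (h 5))).pow 2

/-- At a nondegenerate maximum of `γ`, the fields `∂/∂x`, `∂/∂y` span the `α`-plane. -/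
theorem IsStrictlyInner.exists_combination {M : Potential} (h : M.IsStrictlyInner)
    (g : ℝ × ℝ) :
    ∃ ξ η : ℝ, ξ • alphaCLM (fieldX M.coords) + η • alphaCLM (fieldY M.coords) = g := by
  obtain ⟨g₁, g₂⟩ := g
  have h' := h.2
  generalize M.coords = w at *
  simp only [alphaCLM_apply, Prod.smul_mk, Prod.mk_add_mk, Prod.mk.injEq, smul_eq_mul]
  have e0 : fieldX w 0 = (w 4 - w 5) * (w 2 + (w 4 + w 5)) := by simp [fieldX]; ring
  have e1 : fieldX w 1 = (w 4 + w 5) * w 3 := by simp [fieldX]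
  have e2 : fieldY w 0 = -((w 4 + w 5) * w 3) := by simp [fieldY]; ring
  have e3 : fieldY w 1 = (w 4 - w 5) * (w 2 - (w 4 + w 5)) := by simp [fieldY]; ring
  rw [e0, e1, e2, e3]
  -- Determinant of the α-components of the two fields. It is negative precisely by the strict Schur
  -- inequality, and the witnesses below are Cramer's rule.
  set D := (w 4 - w 5) * (w 2 + (w 4 + w 5)) * ((w 4 - w 5) * (w 2 - (w 4 + w 5))) +
    (w 4 + w 5) * w 3 * ((w 4 + w 5) * w 3) with hD
  have hD0 : D ≠ 0 := by
    refine ne_of_lt ?_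
    rw [hD]
    nlinarith
  refine ⟨(g₁ * ((w 4 - w 5) * (w 2 - (w 4 + w 5))) + g₂ * ((w 4 + w 5) * w 3)) / D,
    (g₂ * ((w 4 - w 5) * (w 2 + (w 4 + w 5))) - g₁ * ((w 4 + w 5) * w 3)) / D, ?_, ?_⟩
  · rw [div_mul_eq_mul_div, div_mul_eq_mul_div, ← add_div, div_eq_iff hD0, hD]; ring
  · rw [div_mul_eq_mul_div, div_mul_eq_mul_div, ← add_div, div_eq_iff hD0, hD]; ring

theorem IsStrictlyInner.eventually_mem_laxOrbit {M : Potential} {a : ℂ[X]}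
    (h : M.IsStrictlyInner) (hM : M ∈ isoSet a) :
    ∀ᶠ ζ in 𝓝 M, ζ ∈ isoSet a → ζ ∈ laxOrbit laxFlow M := by
  refine Potential.eventually_mem_laxOrbit alphaCLM hM
    (isOpen_setOf_isStrictlyInner.mem_nhds h) ?_ h.exists_combination
  rintro ζ ⟨hζ, hζa⟩ ζ' ⟨hζ', hζa'⟩ he
  simp only [alphaCLM_apply, Prod.mk.injEq] at he
  refine (IsStrictlyInner.isInner hζ).eq_of_specPoly_eq (IsStrictlyInner.isInner hζ') ?_ he.1 he.2
  rw [mem_isoSet_iff.1 hζa, mem_isoSet_iff.1 hζa']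

/-- An inner critical point of `γ` without roots on the unit circle is strictly inner. -/
theorem IsInner.isStrictlyInner {M : Potential} (h : M.IsInner) (h0 : M.coords 0 = 0)
    (h1 : M.coords 1 = 0) (hr : ∀ z : ℂ, M.evalAt z ≠ 0) : M.IsStrictlyInner := by
  refine ⟨h.1, h.2.lt_of_ne fun he => ?_⟩
  have hp : M.coords 4 + M.coords 5 ≠ 0 := (add_pos M.coords_four_pos M.coords_five_pos).ne'
  have hq : M.coords 4 - M.coords 5 ≠ 0 := (sub_pos.2 h.1).ne'
  refine hr _ (evalAt_eq_zero_of_circle (x := M.coords 2 / (M.coords 4 + M.coords 5))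
    (y := M.coords 3 / (M.coords 4 - M.coords 5)) ?_ (by simp [h0, h1]) (by simp [h0, h1])
    (by field_simp) (by field_simp))
  field_simp
  linear_combination he

end Potential

/-! ### Regular level sets and the smooth structure of the rootless part -/

/-- Regular level sets are submanifolds. -/
theorem isSubmanifold_of_forall_exists_regular {E : Type*} [NormedAddCommGroup E] [NormedSpace ℝ E]
    [FiniteDimensional ℝ E] {k m : ℕ} (hk : m + k = Module.finrank ℝ E) {S : Set E}
    (h : ∀ p ∈ S, ∃ (F : E → Fin m → ℝ) (U : Set E), IsOpen U ∧ p ∈ U ∧ ContDiffOn ℝ ∞ F U ∧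
      Function.Surjective (fderiv ℝ F p) ∧ ∀ x ∈ U, x ∈ S ↔ F x = F p) :
    IsSubmanifold k S := by
  intro p hp
  obtain ⟨F, U, hU, hpU, hF, hsurj, hS⟩ := h p hp
  set f' := fderiv ℝ F p with hf'
  obtain ⟨ι₀, hι₀⟩ := f'.toLinearMap.exists_rightInverse_of_surjective
    (LinearMap.range_eq_top.2 hsurj)
  let ι : (Fin m → ℝ) →L[ℝ] E := LinearMap.toContinuousLinearMap ι₀
  have hι : ∀ v, f' (ι v) = v := fun v => LinearMap.congr_fun hι₀ v
  -- With ι a right inverse of f', this map has identity derivative at p and satisfies f' ∘ f = F -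
  -- F p, so it flattens the level set into ker f'.
  let f : E → E := fun x => x - ι (f' x) + ι (F x - F p)
  have hfU : ContDiffOn ℝ ∞ f U := by
    have h1 : ContDiff ℝ ∞ fun x => x - ι (f' x) := by fun_prop
    exact h1.contDiffOn.add (ι.contDiff.comp_contDiffOn (hF.sub contDiffOn_const))
  have hfp : ContDiffAt ℝ ∞ f p := hfU.contDiffAt (hU.mem_nhds hpU)
  have hFd : HasFDerivAt F f' p :=
    ((hF.contDiffAt (hU.mem_nhds hpU)).differentiableAt (by simp)).hasFDerivAt
  have hfd : HasFDerivAt f ((ContinuousLinearEquiv.refl ℝ E : E ≃L[ℝ] E) : E →L[ℝ] E) p := by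
    have h1 : HasFDerivAt (fun x => x - ι (f' x)) (ContinuousLinearMap.id ℝ E - ι.comp f') p :=
      (hasFDerivAt_id p).sub (ι.comp f').hasFDerivAt
    have h2 := ι.hasFDerivAt.comp p (hFd.sub_const (F p))
    refine (h1.add h2).congr_fderiv ?_
    ext x; simp
  let e₀ := hfp.toOpenPartialHomeomorph f hfd (by simp)
  have he₀ : (e₀ : E → E) = f := rfl
  -- Restricting to points where the derivative of f is invertible makes the inverse chart smooth on
  -- its whole domain.
  let W : Set E := U ∩ fderiv ℝ f ⁻¹' range ((↑) : (E ≃L[ℝ] E) → E →L[ℝ] E)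
  have hW : IsOpen W := (hfU.continuousOn_fderiv_of_isOpen hU (by simp)).isOpen_inter_preimage hU
    (ContinuousLinearEquiv.isOpen)
  have hpW : p ∈ W := ⟨hpU, ContinuousLinearEquiv.refl ℝ E, hfd.fderiv.symm⟩
  let e := e₀.restrOpen W hW
  have hes : e.source = e₀.source ∩ W := e₀.restrOpen_source W hW
  have he : (e : E → E) = f := rfl
  refine ⟨e, LinearMap.ker f'.toLinearMap, ?_, ?_, ?_, ?_, ?_⟩
  · rw [hes]
    exact ⟨hfp.mem_toOpenPartialHomeomorph_source hfd (by simp), hpW⟩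
  · rw [he]
    exact hfU.mono fun x hx => (hes ▸ hx : x ∈ e₀.source ∩ W).2.1
  · intro y hy
    have hx : e.symm y ∈ e₀.source ∩ W := hes ▸ e.map_target hy
    obtain ⟨A, hA⟩ := hx.2.2
    have hcd : ContDiffAt ℝ ∞ e (e.symm y) := hfU.contDiffAt (hU.mem_nhds hx.2.1)
    refine (e.contDiffAt_symm hy (f₀' := A) ?_ hcd).contDiffWithinAt
    rw [hA]
    exact (hcd.differentiableAt (by simp)).hasFDerivAt
  · have := f'.toLinearMap.finrank_range_add_finrank_ker
    rw [LinearMap.range_eq_top.2 hsurj, finrank_top, Module.finrank_fin_fun] at this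
    omega
  · intro x hx
    rw [hes] at hx
    rw [hS x hx.2.1, LinearMap.mem_ker, he]
    have : f' (f x) = F x - F p := by simp [f, hι]
    exact (sub_eq_zero.symm.trans (by rw [← this]; rfl))

/-- Surjectivity of a map to `ℝᵐ` is tested on linear functionals. -/
theorem surjective_of_forall_functional {E : Type*} [AddCommGroup E] [Module ℝ E] {m : ℕ}
    (f : E →ₗ[ℝ] Fin m → ℝ)
    (h : ∀ t : Fin m → ℝ, (∀ v, ∑ i, t i * f v i = 0) → t = 0) : Function.Surjective f := by
  rw [← LinearMap.range_eq_top]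
  by_contra hne
  obtain ⟨g, hg, hle⟩ := Submodule.exists_le_ker_of_lt_top _ (lt_top_iff_ne_top.2 hne)
  refine hg ?_
  have hsum : ∀ v, g v = ∑ i, g (Pi.single i 1) * v i := fun v => by
    conv_lhs => rw [← Finset.univ_sum_single v]
    rw [map_sum]
    refine Finset.sum_congr rfl fun i _ => ?_
    have hs : (Pi.single i (v i) : Fin m → ℝ) = v i • Pi.single i 1 := by
      rw [← Pi.single_smul, smul_eq_mul, mul_one]
    rw [hs, map_smul, smul_eq_mul, mul_comm]
  have ht := h (fun i => g (Pi.single i 1)) fun v => by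
    rw [← hsum]
    exact hle (LinearMap.mem_range_self f v)
  ext i
  simpa using congrFun ht i

/-- The extension of `Potential.coords` to the ambient vector space. -/
noncomputable def ambientCoords (p : ℂ × ℂ × ℝ) : Fin 6 → ℝ :=
  ![p.1.re, p.1.im, p.2.1.re, p.2.1.im, p.2.2, (p.2.2)⁻¹]

theorem contDiffAt_ambientCoords {n : WithTop ℕ∞} {p : ℂ × ℂ × ℝ} (hp : p.2.2 ≠ 0) :
    ContDiffAt ℝ n ambientCoords p := by
  have h1 : ContDiff ℝ n fun p : ℂ × ℂ × ℝ => p.1 := contDiff_fst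
  have h2 : ContDiff ℝ n fun p : ℂ × ℂ × ℝ => p.2.1 := contDiff_fst.comp contDiff_snd
  have h3 : ContDiff ℝ n fun p : ℂ × ℂ × ℝ => p.2.2 := contDiff_snd.comp contDiff_snd
  refine contDiffAt_pi.2 fun i => ?_
  fin_cases i
  · exact (Complex.reCLM.contDiff.comp h1).contDiffAt
  · exact (Complex.imCLM.contDiff.comp h1).contDiffAt
  · exact (Complex.reCLM.contDiff.comp h2).contDiffAt
  · exact (Complex.imCLM.contDiff.comp h2).contDiffAt
  · exact h3.contDiffAt
  · exact h3.contDiffAt.inv hp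

theorem fderiv_ambientCoords {p : ℂ × ℂ × ℝ} (hp : p.2.2 ≠ 0) (v : ℂ × ℂ × ℝ) :
    fderiv ℝ ambientCoords p v =
      ![v.1.re, v.1.im, v.2.1.re, v.2.1.im, v.2.2, -v.2.2 * (p.2.2)⁻¹ ^ 2] := by
  have hd := ((contDiffAt_ambientCoords (n := 1) hp).differentiableAt one_ne_zero).hasFDerivAt
  have h3 : HasFDerivAt (fun p : ℂ × ℂ × ℝ => p.2.2)
      ((ContinuousLinearMap.snd ℝ ℂ ℝ).comp (ContinuousLinearMap.snd ℝ ℂ (ℂ × ℝ))) p :=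
    ((ContinuousLinearMap.snd ℝ ℂ ℝ).comp (ContinuousLinearMap.snd ℝ ℂ (ℂ × ℝ))).hasFDerivAt
  have key : ∀ i (L : ℂ × ℂ × ℝ →L[ℝ] ℝ), HasFDerivAt (fun p => ambientCoords p i) L p →
      fderiv ℝ ambientCoords p v i = L v := fun i L hL => by
    have := (hasFDerivAt_pi'.1 hd i).unique hL
    rw [← this]
    rfl
  ext i
  fin_cases i
  · exact key 0 (Complex.reCLM.comp (.fst ℝ ℂ (ℂ × ℝ)))
      (Complex.reCLM.comp (.fst ℝ ℂ (ℂ × ℝ))).hasFDerivAt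
  · exact key 1 (Complex.imCLM.comp (.fst ℝ ℂ (ℂ × ℝ)))
      (Complex.imCLM.comp (.fst ℝ ℂ (ℂ × ℝ))).hasFDerivAt
  · exact key 2 (Complex.reCLM.comp ((ContinuousLinearMap.fst ℝ ℂ ℝ).comp (.snd ℝ ℂ (ℂ × ℝ))))
      (Complex.reCLM.comp
        ((ContinuousLinearMap.fst ℝ ℂ ℝ).comp (.snd ℝ ℂ (ℂ × ℝ)))).hasFDerivAt
  · exact key 3 (Complex.imCLM.comp ((ContinuousLinearMap.fst ℝ ℂ ℝ).comp (.snd ℝ ℂ (ℂ × ℝ))))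
      (Complex.imCLM.comp
        ((ContinuousLinearMap.fst ℝ ℂ ℝ).comp (.snd ℝ ℂ (ℂ × ℝ)))).hasFDerivAt
  · exact key 4 _ h3
  · have := key 5 _ ((hasDerivAt_inv hp).comp_hasFDerivAt p h3)
    simpa [mul_comm] using this

theorem isOpen_setOf_gamma_pos : IsOpen {p : ℂ × ℂ × ℝ | 0 < p.2.2} :=
  isOpen_lt continuous_const (continuous_snd.comp continuous_snd)

theorem finrank_ambient : Module.finrank ℝ (ℂ × ℂ × ℝ) = 5 := by simp

theorem isQuadraticMap_energy : IsQuadraticMap energy := fun w k r => by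
  simp [energy, QuadraticMap.polar]; ring

theorem isQuadraticMap_casimirRe : IsQuadraticMap casimirRe := fun w k r => by
  simp [casimirRe, QuadraticMap.polar]; ring

theorem isQuadraticMap_casimirIm : IsQuadraticMap casimirIm := fun w k r => by
  simp [casimirIm, QuadraticMap.polar]; ring

/-- The differential of the first integrals in terms of the velocity of the coordinates. -/
theorem fderiv_casimirRe (w k : Fin 6 → ℝ) : fderiv ℝ casimirRe w k =
    2 * w 0 * k 0 - 2 * w 1 * k 1 + (w 4 + w 5) * k 2 + w 2 * (k 4 + k 5) := by
  rw [isQuadraticMap_casimirRe.fderiv_apply isFirstIntegral_casimirRe.1]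
  simp [casimirRe, QuadraticMap.polar]; ring

theorem fderiv_casimirIm (w k : Fin 6 → ℝ) : fderiv ℝ casimirIm w k =
    2 * w 1 * k 0 + 2 * w 0 * k 1 + (w 4 - w 5) * k 3 + w 3 * (k 4 - k 5) := by
  rw [isQuadraticMap_casimirIm.fderiv_apply isFirstIntegral_casimirIm.1]
  simp [casimirIm, QuadraticMap.polar]; ring

theorem fderiv_energy (w k : Fin 6 → ℝ) : fderiv ℝ energy w k =
    4 * w 0 * k 0 + 4 * w 1 * k 1 + 2 * w 2 * k 2 + 2 * w 3 * k 3 + 2 * w 4 * k 4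
      + 2 * w 5 * k 5 := by
  rw [isQuadraticMap_energy.fderiv_apply isFirstIntegral_energy.1]
  simp [energy, QuadraticMap.polar]; ring

namespace Potential

theorem ambientCoords_val (ζ : Potential) : ambientCoords ζ.1 = ζ.coords := rfl

theorem specPoly_monic_natDegree (ζ : Potential) :
    ζ.specPoly.Monic ∧ ζ.specPoly.natDegree = 4 := by
  have h : ζ.specPoly.natDegree = 4 := by
    unfold specPoly
    compute_degree!
  refine ⟨?_, h⟩
  rw [Monic, leadingCoeff, h]
  unfold specPoly
  simp [coeff_one, coeff_X_pow, -map_add, -map_sub, -map_mul]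

theorem specPoly_ne_zero (ζ : Potential) : ζ.specPoly ≠ 0 := ζ.specPoly_monic_natDegree.1.ne_zero

theorem isRoot_of_evalAt_eq_zero {ζ : Potential} {z : ℂ} (h : ζ.evalAt z = 0) :
    ζ.specPoly.IsRoot z := by
  have hz : z ≠ 0 := by
    rintro rfl
    rw [evalAt_eq] at h
    have := congrFun (congrFun h 0) 1
    simp [coordMatrix, ζ.coords_five_pos.ne'] at this
  have h1 : (ζ.toMatrix.map (Polynomial.eval z)).det = z * ζ.specPoly.eval z := by
    have := (Polynomial.evalRingHom z).map_det ζ.toMatrix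
    rw [det_toMatrix] at this
    simp only [coe_evalRingHom, eval_mul, eval_X, RingHom.mapMatrix_apply] at this
    exact this.symm
  change (ζ.evalAt z).det = _ at h1
  rw [h] at h1
  simpa [hz] using h1.symm

theorem isOpen_setOf_evalAt_ne_zero (z : ℂ) : IsOpen {ζ : Potential | ζ.evalAt z ≠ 0} := by
  have hc : Continuous fun ζ : Potential => ζ.evalAt z := by
    simp only [evalAt_eq]
    have : Continuous (coordMatrix z) := by
      refine continuous_matrix fun i j => ?_
      fin_cases i <;> fin_cases j <;> simp [coordMatrix] <;> fun_prop
    exact this.comp continuous_coords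
  exact isOpen_ne.preimage hc

/-- The first integrals are independent exactly at rootless potentials. -/
theorem eq_zero_of_combination_eq_zero {ζ : Potential} (hr : ∀ z : ℂ, ζ.evalAt z ≠ 0)
    {t : Fin 3 → ℝ}
    (h0 : t 0 * ζ.coords 0 + t 1 * ζ.coords 1 + t 2 * (2 * ζ.coords 0) = 0)
    (h1 : -t 0 * ζ.coords 1 + t 1 * ζ.coords 0 + t 2 * (2 * ζ.coords 1) = 0)
    (h2 : t 0 * (ζ.coords 4 + ζ.coords 5) + 2 * t 2 * ζ.coords 2 = 0)
    (h3 : t 1 * (ζ.coords 4 - ζ.coords 5) + 2 * t 2 * ζ.coords 3 = 0)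
    (h4 : t 0 * (ζ.coords 2 * (ζ.coords 4 - ζ.coords 5))
      + t 1 * (ζ.coords 3 * (ζ.coords 4 + ζ.coords 5))
      + 2 * t 2 * (ζ.coords 4 ^ 2 - ζ.coords 5 ^ 2) = 0) : t = 0 := by
  have hg : ζ.coords 4 * ζ.coords 5 = 1 := ζ.gammaProd_coords
  have hp : 0 < ζ.coords 4 + ζ.coords 5 := add_pos ζ.coords_four_pos ζ.coords_five_pos
  have hcirc := @evalAt_eq_zero_of_circle ζ
  have hdeg := exists_evalAt_eq_zero_of_gamma_eq_one (ζ := ζ)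
  have h4p := ζ.coords_four_pos
  generalize ζ.coords = w at *
  have hone : w 4 = w 5 → w 4 = 1 ∧ w 5 = 1 := fun h => by
    rw [← h] at hg ⊢
    have : w 4 = 1 := by nlinarith
    exact ⟨this, this⟩
  have nodeg : ¬ (w 0 = 0 ∧ w 1 = 0 ∧ w 3 = 0 ∧ w 4 = w 5) := by
    rintro ⟨k0, k1, k3, k⟩
    obtain ⟨z, hz⟩ := hdeg k0 k1 k3 (hone k).1 (hone k).2
    exact hr z hz
  -- If `energy` enters the relation, normalise the other two coefficients to -2x and -2y. The
  -- relation then gives the equations for a root at x + iy, or forces α = 0, Im β = 0, γ = 1; both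
  -- cases produce a root of ζ.
  have ht2 : t 2 = 0 := by
    by_contra hne
    obtain ⟨x, hx⟩ : ∃ x, t 0 = -2 * t 2 * x := ⟨-t 0 / (2 * t 2), by field_simp⟩
    obtain ⟨y, hy⟩ : ∃ y, t 1 = -2 * t 2 * y := ⟨-t 1 / (2 * t 2), by field_simp⟩
    rw [hx] at h0 h1 h2 h4
    rw [hy] at h0 h1 h3 h4
    have e0 : w 0 * (1 - x) = w 1 * y := mul_left_cancel₀ hne (by linarith)
    have e1 : w 1 * (1 + x) = w 0 * y := mul_left_cancel₀ hne (by linarith)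
    have e2 : w 2 = (w 4 + w 5) * x := mul_left_cancel₀ hne (by linarith)
    have e3 : w 3 = (w 4 - w 5) * y := mul_left_cancel₀ hne (by linarith)
    have e4 : (w 4 - w 5) * ((w 4 + w 5) * (1 - x ^ 2 - y ^ 2)) = 0 := by
      refine mul_left_cancel₀ hne ?_
      rw [e2, e3] at h4
      linarith
    by_cases hxy : x ^ 2 + y ^ 2 = 1
    · exact hr _ (hcirc hxy (by linarith) (by linarith) e2 e3)
    · have hxy' : 1 - x ^ 2 - y ^ 2 ≠ 0 := fun h => hxy (by linarith)
      have hq : w 4 - w 5 = 0 := (mul_eq_zero.1 e4).resolve_right (mul_ne_zero hp.ne' hxy')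
      refine nodeg ⟨?_, ?_, by rw [e3, hq, zero_mul], sub_eq_zero.1 hq⟩
      · refine mul_right_cancel₀ hxy' ?_
        linear_combination (1 + x) * e0 + y * e1
      · refine mul_right_cancel₀ hxy' ?_
        linear_combination (1 - x) * e1 + y * e0
  have ht0 : t 0 = 0 := by
    rw [ht2] at h2
    simpa [hp.ne'] using h2
  have ht1 : t 1 = 0 := by
    by_contra hne
    simp only [ht2, ht0] at h0 h1 h3 h4
    refine nodeg ⟨?_, ?_, ?_, ?_⟩
    · simpa [hne] using h1
    · simpa [hne] using h0
    · simpa [hne, hp.ne'] using h4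
    · simpa [hne, sub_eq_zero] using h3
  ext i
  fin_cases i
  · exact ht0
  · exact ht1
  · exact ht2

/-- Functions of the coordinates as a map on the ambient space. -/
noncomputable def ambientMap {m : ℕ} (Q : Fin m → (Fin 6 → ℝ) → ℝ) (p : ℂ × ℂ × ℝ) : Fin m → ℝ :=
  fun i => Q i (ambientCoords p)

theorem contDiffAt_ambientMap {m : ℕ} {Q : Fin m → (Fin 6 → ℝ) → ℝ} {n : WithTop ℕ∞}
    (hQ : ∀ i, ContDiff ℝ n (Q i)) {p : ℂ × ℂ × ℝ} (hp : p.2.2 ≠ 0) :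
    ContDiffAt ℝ n (ambientMap Q) p :=
  contDiffAt_pi.2 fun i => (hQ i).contDiffAt.comp p (contDiffAt_ambientCoords hp)

theorem fderiv_ambientMap {m : ℕ} {Q : Fin m → (Fin 6 → ℝ) → ℝ} (hQ : ∀ i, ContDiff ℝ 1 (Q i))
    {p : ℂ × ℂ × ℝ} (hp : p.2.2 ≠ 0) (v : ℂ × ℂ × ℝ) (i : Fin m) :
    fderiv ℝ (ambientMap Q) p v i =
      fderiv ℝ (Q i) (ambientCoords p) (fderiv ℝ ambientCoords p v) := by
  have hκ := (contDiffAt_ambientCoords (n := 1) hp).differentiableAt one_ne_zero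
  have hI := ((contDiffAt_ambientMap hQ hp).differentiableAt one_ne_zero).hasFDerivAt
  have h := (((hQ i).differentiable one_ne_zero) (ambientCoords p)).hasFDerivAt.comp p
    hκ.hasFDerivAt
  exact DFunLike.congr_fun ((hasFDerivAt_pi'.1 hI i).unique h) v

/-- The three first integrals. -/
noncomputable def integrals : Fin 3 → (Fin 6 → ℝ) → ℝ := ![casimirRe, casimirIm, energy]

theorem contDiff_integrals {n : WithTop ℕ∞} (i : Fin 3) : ContDiff ℝ n (integrals i) := by
  fin_cases i
  · exact contDiff_casimirRe
  · exact contDiff_casimirIm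
  · exact contDiff_energy

theorem surjective_fderiv_integrals {ζ : Potential} (hr : ∀ z : ℂ, ζ.evalAt z ≠ 0) :
    Function.Surjective (fderiv ℝ (ambientMap integrals) ζ.1) := by
  have hne : ζ.1.2.2 ≠ 0 := ζ.2.ne'
  refine surjective_of_forall_functional (fderiv ℝ (ambientMap integrals) ζ.1).toLinearMap fun t ht => ?_
  have hv := fun v => ht v
  have e0 : integrals 0 = casimirRe := rfl
  have e1 : integrals 1 = casimirIm := rfl
  have e2 : integrals 2 = energy := rfl
  simp only [ContinuousLinearMap.coe_coe, fderiv_ambientMap contDiff_integrals hne,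
    Fin.sum_univ_three, e0, e1, e2, fderiv_casimirRe, fderiv_casimirIm, fderiv_energy,
    fderiv_ambientCoords hne, ambientCoords_val] at hv
  have g0 := hv (1, 0, 0)
  have g1 := hv (Complex.I, 0, 0)
  have g2 := hv (0, 1, 0)
  have g3 := hv (0, Complex.I, 0)
  have g4 := hv (0, 0, 1)
  have hinv : (ζ.1.2.2)⁻¹ = ζ.coords 5 := rfl
  have hg : ζ.coords 4 * ζ.coords 5 = 1 := ζ.gammaProd_coords
  simp [hinv] at g0 g1 g2 g3 g4
  refine eq_zero_of_combination_eq_zero hr ?_ ?_ ?_ ?_ ?_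
  · linarith
  · linarith
  · linarith
  · linarith
  -- The derivative in γ carries -γ⁻² from the last coordinate; multiplying by γ yields the
  -- symmetric form.
  · linear_combination ζ.coords 4 * g4 + (t 0 * ζ.coords 2 * ζ.coords 5
      - t 1 * ζ.coords 3 * ζ.coords 5 + 2 * t 2 * ζ.coords 5 ^ 2) * hg

theorem isPotentialSubmanifold_rootlessPart (a : ℂ[X]) :
    IsPotentialSubmanifold 2 (rootlessPart a) := by
  refine isSubmanifold_of_forall_exists_regular (m := 3) (by rw [finrank_ambient]) ?_
  rintro _ ⟨ζ, ⟨hζ, hr⟩, rfl⟩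
  have ha := mem_isoSet_iff.1 hζ
  have ha0 : a ≠ 0 := ha ▸ specPoly_ne_zero ζ
  -- A root of ζ' ∈ I(a) is a root of a, so avoiding these finitely many points is an open condition
  -- equivalent to rootlessness on I(a).
  let V : Set Potential := ⋂ z ∈ a.roots.toFinset, {ζ' | ζ'.evalAt z ≠ 0}
  have hV : IsOpen V := isOpen_biInter_finset fun z _ => isOpen_setOf_evalAt_ne_zero z
  refine ⟨ambientMap integrals, Subtype.val '' V, isOpen_setOf_gamma_pos.isOpenMap_subtype_val V hV,
    ⟨ζ, mem_iInter₂.2 fun z _ => hr z, rfl⟩, ?_, surjective_fderiv_integrals hr, ?_⟩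
  · rintro _ ⟨ζ', -, rfl⟩
    exact (contDiffAt_ambientMap contDiff_integrals ζ'.2.ne').contDiffWithinAt
  · rintro _ ⟨ζ', hζ', rfl⟩
    have hmem : ζ' ∈ rootlessPart a ↔ ζ' ∈ isoSet a := by
      refine ⟨fun h => h.1, fun h => ⟨h, fun z hz => ?_⟩⟩
      refine mem_iInter₂.1 hζ' z ?_ hz
      rw [Multiset.mem_toFinset, mem_roots ha0, ← mem_isoSet_iff.1 h]
      exact isRoot_of_evalAt_eq_zero hz
    rw [Subtype.val_injective.mem_set_image, hmem, mem_isoSet_iff, ← ha, specPoly_eq_iff]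
    constructor
    · rintro ⟨k1, k2, k3⟩
      ext i
      fin_cases i
      · exact k1
      · exact k2
      · exact k3
    · intro h
      exact ⟨congrFun h 0, congrFun h 1, congrFun h 2⟩

end Potential

/-! ### Compact homogeneous spaces of ℝ² -/

/-- A compact homogeneous space of `ℝ²` with discrete stabilisers is a torus. -/
theorem nonempty_homeomorph_torus {X : Type*} [TopologicalSpace X] [CompactSpace X] [T2Space X]
    [AddAction (ℝ × ℝ) X] [ContinuousVAdd (ℝ × ℝ) X] [AddAction.IsPretransitive (ℝ × ℝ) X]
    (x₀ : X) (h₀ : ∀ᶠ p in 𝓝 (0 : ℝ × ℝ), p +ᵥ x₀ = x₀ → p = 0) :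
    Nonempty (X ≃ₜ Circle × Circle) := by
  let F : C(ℝ × ℝ, X) := ⟨fun p => p +ᵥ x₀, continuous_id.vadd continuous_const⟩
  have hFs : Function.Surjective F := AddAction.surjective_vadd (ℝ × ℝ) x₀
  have hF : IsQuotientMap F :=
    (isOpenMap_vadd_of_sigmaCompact (G := ℝ × ℝ) x₀).isQuotientMap F.continuous hFs
  let L : Submodule ℤ (ℝ × ℝ) := (AddAction.stabilizer (ℝ × ℝ) x₀).toIntSubmodule
  have hL : ∀ p, p ∈ L ↔ p +ᵥ x₀ = x₀ := fun p => Iff.rfl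
  have hFL : ∀ p q, F p = F q ↔ p - q ∈ L := fun p q => by
    rw [hL, sub_eq_neg_add, add_vadd, neg_vadd_eq_iff]
    rfl
  have hdisc : DiscreteTopology L := by
    refine discreteTopology_of_isOpen_singleton_zero ?_
    obtain ⟨U, hU, hUo, h0U⟩ := _root_.eventually_nhds_iff.1 h₀
    refine ⟨U, hUo, ?_⟩
    ext ⟨p, hp⟩
    simp only [mem_preimage, mem_singleton_iff, ← Submodule.coe_eq_zero]
    exact ⟨fun h => hU p h ((hL p).1 hp), fun h => by rwa [h]⟩
  have hlat : IsZLattice ℝ L := by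
    refine ⟨?_⟩
    by_contra hne
    -- If the stabiliser did not span ℝ², a nonzero functional vanishing on it would descend to an
    -- unbounded continuous function on the compact space X.
    obtain ⟨g, hg, hle⟩ := Submodule.exists_le_ker_of_lt_top _ (lt_top_iff_ne_top.2 hne)
    let g' : C(ℝ × ℝ, ℝ) := ⟨g, g.continuous_of_finiteDimensional⟩
    have hfac : Function.FactorsThrough g' F := fun p q hpq => by
      have : g (p - q) = 0 := hle (Submodule.subset_span ((hFL p q).1 hpq))
      rwa [map_sub, sub_eq_zero] at this
    obtain ⟨G, hG⟩ : ∃ G : C(X, ℝ), ∀ p, G (F p) = g p :=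
      ⟨hF.lift g' hfac, fun p => DFunLike.congr_fun (hF.lift_comp g' hfac) p⟩
    obtain ⟨C, hC⟩ := isCompact_univ.exists_bound_of_continuousOn G.continuous.continuousOn
    refine hg (LinearMap.ext fun v => ?_)
    by_contra hv
    have h1 := hC (F (((C + 1) / g v) • v)) (mem_univ _)
    rw [hG, map_smul, smul_eq_mul, div_mul_cancel₀ _ hv] at h1
    linarith [le_abs_self (C + 1), h1, Real.norm_eq_abs (C + 1)]
  have : Module.Finite ℤ L := ZLattice.module_finite ℝ L
  have : Module.Free ℤ L := ZLattice.module_free ℝ L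
  -- In a lattice basis the orbit map and the exponential map T have the same fibres, so X and the
  -- torus are identified.
  let b : Module.Basis (Fin 2) ℤ L :=
    Module.finBasisOfFinrankEq ℤ L (by rw [ZLattice.rank ℝ L]; simp)
  let B : Module.Basis (Fin 2) ℝ (ℝ × ℝ) := b.ofZLatticeBasis ℝ L
  have hB : ∀ p, p ∈ L ↔ ∀ i, ∃ m : ℤ, (m : ℝ) = B.repr p i := fun p => by
    conv_lhs => rw [← b.ofZLatticeBasis_span ℝ]
    exact B.mem_span_iff_repr_mem ℤ p
  have hBc : ∀ i, Continuous fun p => B.repr p i := fun i =>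
    (B.coord i).continuous_of_finiteDimensional
  let T : C(ℝ × ℝ, Circle × Circle) :=
    ⟨fun p => (Circle.exp (B.repr p 0 * (2 * Real.pi)), Circle.exp (B.repr p 1 * (2 * Real.pi))),
      (Circle.exp.continuous.comp ((hBc 0).mul continuous_const)).prodMk
        (Circle.exp.continuous.comp ((hBc 1).mul continuous_const))⟩
  have hexp : ∀ s t : ℝ, Circle.exp (s * (2 * Real.pi)) = Circle.exp (t * (2 * Real.pi)) ↔
      ∃ m : ℤ, (m : ℝ) = s - t := fun s t => by
    have hpi : (2 * Real.pi) ≠ 0 := Real.two_pi_pos.ne'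
    rw [Circle.exp_eq_exp]
    refine exists_congr fun m => ⟨fun h => ?_, fun h => ?_⟩
    · refine mul_right_cancel₀ hpi ?_
      rw [sub_mul, h]; ring
    · rw [h]; ring
  have hTF : ∀ p q, T p = T q ↔ F p = F q := fun p q => by
    rw [hFL, hB, Fin.forall_fin_two, map_sub]
    simp only [Finsupp.sub_apply, ← hexp]
    exact Prod.ext_iff
  have hTs : Function.Surjective T := by
    rintro ⟨z, w⟩
    have hpi : (2 * Real.pi) ≠ 0 := Real.two_pi_pos.ne'
    refine ⟨B.equivFun.symm ![Complex.arg z / (2 * Real.pi), Complex.arg w / (2 * Real.pi)], ?_⟩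
    have hr : ∀ u i, B.repr (B.equivFun.symm u) i = u i := fun u i =>
      congrFun (B.equivFun.apply_symm_apply u) i
    change (Circle.exp _, Circle.exp _) = _
    rw [hr, hr]
    simp only [Matrix.cons_val_zero, Matrix.cons_val_one, div_mul_cancel₀ _ hpi, Circle.exp_arg]
  have hfac : Function.FactorsThrough T F := fun p q => (hTF p q).2
  obtain ⟨T', hT'⟩ : ∃ T' : C(X, Circle × Circle), ∀ p, T' (F p) = T p :=
    ⟨hF.lift T hfac, fun p => DFunLike.congr_fun (hF.lift_comp T hfac) p⟩
  have hbij : Function.Bijective T' := by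
    constructor
    · intro x y hxy
      obtain ⟨p, rfl⟩ := hFs x
      obtain ⟨q, rfl⟩ := hFs y
      rw [hT', hT'] at hxy
      exact (hTF p q).1 hxy
    · intro z
      obtain ⟨p, rfl⟩ := hTs z
      exact ⟨F p, hT' p⟩
  exact ⟨Continuous.homeoOfEquivCompactToT2 (f := Equiv.ofBijective T' hbij) T'.continuous⟩

/-! ### Simple roots: a single orbit and a torus -/

namespace Potential

/-- All four entries are divisible by λ - z, so the determinant is divisible by its square; z ≠ 0
because the upper right entry at 0 is -γ⁻¹, and the factor λ can be cancelled. -/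
theorem sq_dvd_specPoly {ζ : Potential} {z : ℂ} (h : ζ.evalAt z = 0) :
    (X - C z) ^ 2 ∣ ζ.specPoly := by
  have hz : z ≠ 0 := by
    rintro rfl
    have h01 : ζ.evalAt 0 0 1 = 0 := by rw [h]; rfl
    simp [evalAt_eq, coordMatrix, ζ.coords_five_pos.ne'] at h01
  have hd : ∀ i j, X - C z ∣ ζ.toMatrix i j := fun i j =>
    dvd_iff_isRoot.2 (congrFun (congrFun h i) j)
  have h2 : (X - C z) ^ 2 ∣ X * ζ.specPoly := by
    rw [← det_toMatrix, Matrix.det_fin_two, pow_two]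
    exact dvd_sub (mul_dvd_mul (hd 0 0) (hd 1 1)) (mul_dvd_mul (hd 0 1) (hd 1 0))
  have hcop : IsCoprime ((X - C z) ^ 2) (X : ℂ[X]) := by
    have := (isCoprime_X_sub_C_of_isUnit_sub (R := ℂ) (a := z) (b := 0)
      (by simpa using hz)).pow_left (m := 2)
    simpa using this
  exact hcop.dvd_of_dvd_mul_left h2

theorem evalAt_ne_zero_of_nodup {ζ : Potential} {a : ℂ[X]} (hζ : ζ ∈ isoSet a)
    (ha : a.roots.Nodup) (z : ℂ) : ζ.evalAt z ≠ 0 := by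
  intro h
  have hd := sq_dvd_specPoly h
  rw [mem_isoSet_iff.1 hζ] at hd
  have ha0 : a ≠ 0 := mem_isoSet_iff.1 hζ ▸ specPoly_ne_zero ζ
  have h2 := (le_rootMultiplicity_iff ha0).2 hd
  have h1 := Multiset.nodup_iff_count_le_one.1 ha z
  rw [count_roots] at h1
  omega

theorem gamma_eq_one_of_eq {ζ : Potential} (h : ζ.coords 5 = ζ.coords 4) :
    ζ.coords 4 = 1 ∧ ζ.coords 5 = 1 := by
  have hg : ζ.coords 4 * ζ.coords 5 = 1 := ζ.gammaProd_coords
  have h4 := ζ.coords_four_pos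
  rw [h] at hg ⊢
  have : ζ.coords 4 = 1 := by nlinarith
  exact ⟨this, this⟩

theorem isInner_or {M : Potential} (hle : M.coords 5 ≤ M.coords 4)
    (h : (M.coords 2 * (M.coords 4 - M.coords 5)) ^ 2 +
      (M.coords 3 * (M.coords 4 + M.coords 5)) ^ 2 ≤
        ((M.coords 4 + M.coords 5) * (M.coords 4 - M.coords 5)) ^ 2) :
    M.IsInner ∨ (M.coords 3 = 0 ∧ M.coords 4 = 1 ∧ M.coords 5 = 1) := by
  rcases hle.lt_or_eq with hlt | heq
  · exact Or.inl ⟨hlt, h⟩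
  · obtain ⟨h4, h5⟩ := gamma_eq_one_of_eq heq
    refine Or.inr ⟨?_, h4, h5⟩
    rw [h4, h5] at h
    nlinarith [sq_nonneg (M.coords 3)]

/-- If all orbits in `S` contain inner critical points of `γ`, then `S` is a single orbit. -/
theorem eq_laxOrbit_of_forall_exists_isInner {a : ℂ[X]} {S : Set Potential} (hS : S ⊆ isoSet a)
    (hinv : ∀ ζ ∈ S, laxOrbit laxFlow ζ ⊆ S)
    (h : ∀ ζ ∈ S, ∃ M ∈ laxOrbit laxFlow ζ, M.coords 0 = 0 ∧ M.coords 1 = 0 ∧ M.IsInner) :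
    ∀ ζ ∈ S, S = laxOrbit laxFlow ζ := by
  intro ζ hζ
  refine Subset.antisymm (fun ζ' hζ' => ?_) (hinv ζ hζ)
  obtain ⟨M, hM, h0, h1, hi⟩ := h ζ hζ
  obtain ⟨M', hM', h0', h1', hi'⟩ := h ζ' hζ'
  have hMa := mem_isoSet_iff.1 (hS (hinv ζ hζ hM))
  have hMa' := mem_isoSet_iff.1 (hS (hinv ζ' hζ' hM'))
  have he : M = M' := hi.eq_of_specPoly_eq hi' (by rw [hMa, hMa']) (by rw [h0, h0'])
    (by rw [h1, h1'])
  rw [← laxOrbit_eq_of_mem hM, he, laxOrbit_eq_of_mem hM']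
  exact mem_laxOrbit_self ζ'

theorem rootlessPart_eq_isoSet_of_nodup {a : ℂ[X]} (ha : a.roots.Nodup) :
    rootlessPart a = isoSet a :=
  Subset.antisymm (fun _ h => h.1) fun _ h => ⟨h, evalAt_ne_zero_of_nodup h ha⟩

theorem exists_isStrictlyInner_mem_laxOrbit_of_nodup {a : ℂ[X]} (ha : a.roots.Nodup)
    {ζ : Potential} (hζ : ζ ∈ isoSet a) :
    ∃ M ∈ laxOrbit laxFlow ζ, M.coords 0 = 0 ∧ M.coords 1 = 0 ∧ M.IsStrictlyInner := by
  obtain ⟨M, hM, h0, h1, hle, hq, -⟩ := exists_forall_mem_closure_laxOrbit_le ζ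
  have hMa := closure_laxOrbit_subset_isoSet hζ hM
  have hr := evalAt_ne_zero_of_nodup hMa ha
  rcases isInner_or hle hq with hi | ⟨h3, h4, h5⟩
  · have hs := hi.isStrictlyInner h0 h1 hr
    exact ⟨M, mem_laxOrbit_of_mem_closure (hs.eventually_mem_laxOrbit hMa) hζ hM, h0, h1, hs⟩
  · obtain ⟨z, hz⟩ := exists_evalAt_eq_zero_of_gamma_eq_one h0 h1 h3 h4 h5
    exact absurd hz (hr z)

theorem isoSet_eq_laxOrbit_of_nodup {a : ℂ[X]} (ha : a.roots.Nodup) :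
    ∀ ζ ∈ isoSet a, isoSet a = laxOrbit laxFlow ζ := by
  refine eq_laxOrbit_of_forall_exists_isInner Subset.rfl
    (fun ζ hζ => laxOrbit_subset_isoSet hζ) fun ζ hζ => ?_
  obtain ⟨M, hM, h0, h1, hs⟩ := exists_isStrictlyInner_mem_laxOrbit_of_nodup ha hζ
  exact ⟨M, hM, h0, h1, hs.isInner⟩

/-- The α-projection of the orbit map has bijective derivative at 0, so it is locally injective
there: the stabiliser is discrete. -/
theorem IsStrictlyInner.eventually_laxFlow_ne {M : Potential} (h : M.IsStrictlyInner) :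
    ∀ᶠ p in 𝓝 (0 : ℝ × ℝ), laxFlow p M = M → p = 0 := by
  have hd := alphaCLM.hasStrictFDerivAt.comp (0 : ℝ × ℝ) (hasStrictFDerivAt_jointFlow M.coords 0)
  rw [jointFlow_zero] at hd
  set D := alphaCLM.comp ((ContinuousLinearMap.toSpanSingleton ℝ (fieldX M.coords)).coprod
    (ContinuousLinearMap.toSpanSingleton ℝ (fieldY M.coords))) with hD
  have hsurj : Function.Surjective D.toLinearMap := fun g => by
    obtain ⟨ξ, η, h⟩ := h.exists_combination g
    exact ⟨(ξ, η), by simpa [hD] using h⟩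
  let e := (LinearEquiv.ofBijective D.toLinearMap
    ⟨LinearMap.injective_iff_surjective.2 hsurj, hsurj⟩).toContinuousLinearEquiv
  have hd' : HasStrictFDerivAt (fun p => alphaCLM (jointFlow p M.coords))
      (e : ℝ × ℝ →L[ℝ] ℝ × ℝ) 0 := hd
  have hinj := (hd'.toOpenPartialHomeomorph _).injOn
  have h0 := hd'.mem_toOpenPartialHomeomorph_source
  filter_upwards [(hd'.toOpenPartialHomeomorph _).open_source.mem_nhds h0] with p hp hpM
  refine hinj hp h0 ?_
  have : jointFlow p M.coords = jointFlow 0 M.coords := by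
    rw [jointFlow_zero, ← coords_laxFlow, hpM]
  exact congrArg alphaCLM this

theorem nonempty_homeomorph_isoSet_torus {a : ℂ[X]} (ha : a.roots.Nodup)
    (hne : (isoSet a).Nonempty) : Nonempty (isoSet a ≃ₜ Circle × Circle) := by
  obtain ⟨ζ, hζ⟩ := hne
  obtain ⟨M, hM, -, -, hs⟩ := exists_isStrictlyInner_mem_laxOrbit_of_nodup ha hζ
  have hMa := laxOrbit_subset_isoSet hζ hM
  have horb := isoSet_eq_laxOrbit_of_nodup ha
  let _ : AddAction (ℝ × ℝ) (isoSet a) :=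
    { vadd := fun p ζ => ⟨laxFlow p ζ.1, laxFlow_mem_isoSet ζ.2 p⟩
      zero_vadd := fun ζ => Subtype.ext (laxFlow_zero ζ.1)
      add_vadd := fun p q ζ => Subtype.ext (laxFlow_add p q ζ.1) }
  have hval : ∀ (p : ℝ × ℝ) (ζ : isoSet a), (p +ᵥ ζ).1 = laxFlow p ζ.1 := fun _ _ => rfl
  have _ : ContinuousVAdd (ℝ × ℝ) (isoSet a) :=
    ⟨(continuous_laxFlow.comp (continuous_fst.prodMk
      (continuous_subtype_val.comp continuous_snd))).subtype_mk _⟩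
  have _ : AddAction.IsPretransitive (ℝ × ℝ) (isoSet a) := ⟨fun ζ ζ' => by
    have : ζ'.1 ∈ laxOrbit laxFlow ζ.1 := horb ζ.1 ζ.2 ▸ ζ'.2
    obtain ⟨p, hp⟩ := this
    exact ⟨p, Subtype.ext hp⟩⟩
  have _ : CompactSpace (isoSet a) := isCompact_iff_compactSpace.1 (isCompact_isoSet a)
  refine nonempty_homeomorph_torus (⟨M, hMa⟩ : isoSet a) ?_
  filter_upwards [hs.eventually_laxFlow_ne] with p hp h
  exact hp (by rw [← hval p ⟨M, hMa⟩, h])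

end Potential

/-! ### Stationary potentials and one-point isospectral sets -/

namespace Potential

/-- The stationary potentials `α = 0`, `β = s`, `γ = 1`. -/
def stationary (s : ℝ) : Potential := ⟨(0, (s : ℂ), 1), one_pos⟩

theorem coords_stationary (s : ℝ) : (stationary s).coords = ![0, 0, s, 0, 1, 1] := by
  ext i
  fin_cases i <;> simp [coords, stationary]

theorem eq_stationary {ζ : Potential} {s : ℝ} (h0 : ζ.coords 0 = 0) (h1 : ζ.coords 1 = 0)
    (h2 : ζ.coords 2 = s) (h3 : ζ.coords 3 = 0) (h4 : ζ.coords 4 = 1) (h5 : ζ.coords 5 = 1) :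
    ζ = stationary s := by
  refine coords_injective ?_
  rw [coords_stationary]
  ext i
  fin_cases i
  exacts [h0, h1, h2, h3, h4, h5]

theorem laxFlow_stationary (p : ℝ × ℝ) (s : ℝ) : laxFlow p (stationary s) = stationary s := by
  refine laxFlow_eq_self ?_ ?_ p
  · rw [coords_stationary]
    ext i
    fin_cases i <;> simp [fieldX]
  · rw [coords_stationary]
    ext i
    fin_cases i <;> simp [fieldY]

theorem isRoot_specPoly {ζ : Potential} {a : ℂ[X]} (hζ : ζ ∈ isoSet a) {z : ℂ}
    (hz : z ∈ a.roots) : ζ.specPoly.IsRoot z := by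
  rw [mem_isoSet_iff.1 hζ]
  exact isRoot_of_mem_roots hz

theorem specPoly_eq_prod {ζ : Potential} {a : ℂ[X]} (hζ : ζ ∈ isoSet a) {z₁ z₂ z₃ z₄ : ℂ}
    (h : a.roots = {z₁, z₂, z₃, z₄}) :
    ζ.specPoly = (X - C z₁) * ((X - C z₂) * ((X - C z₃) * (X - C z₄))) := by
  have h' := (IsAlgClosed.splits ζ.specPoly).eq_prod_roots_of_monic ζ.specPoly_monic_natDegree.1
  rw [mem_isoSet_iff.1 hζ, h] at h'
  rw [mem_isoSet_iff.1 hζ, h']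
  simp [← Multiset.singleton_add]

theorem re_sq_add_im_sq_of_norm {μ : ℂ} (hμ : ‖μ‖ = 1) : μ.re ^ 2 + μ.im ^ 2 = 1 := by
  have := Complex.sq_norm μ
  rw [hμ, Complex.normSq_apply] at this
  linarith

theorem eq_of_isRoot_of_norm {ζ : Potential} {μ : ℂ} (hμ : ‖μ‖ = 1) (h : ζ.specPoly.IsRoot μ) :
    ζ.coords 0 = ζ.coords 0 * μ.re + ζ.coords 1 * μ.im ∧
    ζ.coords 1 = ζ.coords 0 * μ.im - ζ.coords 1 * μ.re ∧
    ζ.coords 2 = (ζ.coords 4 + ζ.coords 5) * μ.re ∧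
    ζ.coords 3 = (ζ.coords 4 - ζ.coords 5) * μ.im :=
  eq_of_isRoot_of_norm_eq_one (re_sq_add_im_sq_of_norm hμ) (by rwa [Complex.re_add_im])

theorem exists_isoSet_eq_singleton {a : ℂ[X]} (ha : a ∈ spectralPolys) {s : ℝ}
    (h : ∀ ζ ∈ isoSet a, ζ = stationary s) :
    ∃ ζ : Potential, isoSet a = {ζ} ∧ ∀ p : ℝ × ℝ, laxFlow p ζ = ζ :=
  ⟨stationary s, eq_singleton_iff_nonempty_unique_mem.2 ⟨ha, h⟩, fun p => laxFlow_stationary p s⟩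

/-- Re β = (γ + γ⁻¹) Re μ holds for both roots, so they are complex conjugates and nonreal.
Comparing the remaining equations forces α = 0 and γ = γ⁻¹. -/
theorem exists_isoSet_eq_singleton_of_two_circle_roots {a : ℂ[X]} (ha : a ∈ spectralPolys)
    {μ ν : ℂ} (hμ : μ ∈ a.roots) (hν : ν ∈ a.roots) (hne : μ ≠ ν) (hμ1 : ‖μ‖ = 1)
    (hν1 : ‖ν‖ = 1) :
    ∃ ζ : Potential, isoSet a = {ζ} ∧ ∀ p : ℝ × ℝ, laxFlow p ζ = ζ := by
  refine exists_isoSet_eq_singleton ha (s := 2 * μ.re) fun ζ hζ => ?_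
  obtain ⟨h0, h1, h2, h3⟩ := eq_of_isRoot_of_norm hμ1 (isRoot_specPoly hζ hμ)
  obtain ⟨k0, k1, k2, k3⟩ := eq_of_isRoot_of_norm hν1 (isRoot_specPoly hζ hν)
  have hx : μ.re = ν.re :=
    mul_left_cancel₀ (add_pos ζ.coords_four_pos ζ.coords_five_pos).ne' (h2.symm.trans k2)
  have hμ2 := re_sq_add_im_sq_of_norm hμ1
  have hν2 := re_sq_add_im_sq_of_norm hν1
  have hne' : μ.im - ν.im ≠ 0 := fun h => hne (Complex.ext hx (sub_eq_zero.1 h))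
  have hy : ν.im = -μ.im := by
    have : (μ.im - ν.im) * (μ.im + ν.im) = 0 := by rw [hx] at hμ2; linarith
    linarith [(mul_eq_zero.1 this).resolve_left hne']
  rw [← hx, hy] at k0 k1
  rw [hy] at k3 hne'
  have hy0 : μ.im ≠ 0 := fun h => hne' (by rw [h]; simp)
  have e1 : ζ.coords 1 = 0 := (mul_eq_zero.1 (by linarith : ζ.coords 1 * μ.im = 0)).resolve_right hy0
  have e0 : ζ.coords 0 = 0 := (mul_eq_zero.1 (by linarith : ζ.coords 0 * μ.im = 0)).resolve_right hy0
  have e : ζ.coords 5 = ζ.coords 4 := by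
    have : (ζ.coords 4 - ζ.coords 5) * μ.im = 0 := by linarith
    linarith [(mul_eq_zero.1 this).resolve_right hy0]
  obtain ⟨e4, e5⟩ := gamma_eq_one_of_eq e
  refine eq_stationary e0 e1 ?_ ?_ e4 e5
  · rw [h2, e4, e5]; ring
  · rw [h3, e4, e5]; ring

theorem exists_isoSet_eq_singleton_of_quadruple_root {a : ℂ[X]} (ha : a ∈ spectralPolys)
    {μ : ℂ} (hμ : a.roots = {μ, μ, μ, μ}) (hμ1 : ‖μ‖ = 1) :
    ∃ ζ : Potential, isoSet a = {ζ} ∧ ∀ p : ℝ × ℝ, laxFlow p ζ = ζ := by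
  refine exists_isoSet_eq_singleton ha (s := 2 * μ.re) fun ζ hζ => ?_
  obtain ⟨h0, h1, h2, h3⟩ :=
    eq_of_isRoot_of_norm hμ1 (isRoot_specPoly hζ (by rw [hμ]; simp))
  have hE : (energy ζ.coords : ℂ) = 6 * μ ^ 2 := by
    rw [← ζ.specPoly_coeff.1, specPoly_eq_prod hζ hμ,
      show (X - C μ) * ((X - C μ) * ((X - C μ) * (X - C μ))) =
        X ^ 4 - C (4 * μ) * X ^ 3 + C (6 * μ ^ 2) * X ^ 2 - C (4 * μ ^ 3) * X + C (μ ^ 4) by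
      simp only [map_mul, map_pow, map_ofNat]; ring]
    simp [coeff_X_pow, -map_mul, -map_pow]
  -- Energy is real and nonnegative, so it equals its modulus |6μ²| = 6. Hence μ = ±1, and the
  -- energy identity becomes a vanishing sum of squares.
  have hE' : energy ζ.coords = 6 := by
    have : ‖(energy ζ.coords : ℂ)‖ = 6 := by rw [hE]; simp [hμ1]
    rwa [Complex.norm_real, Real.norm_eq_abs, abs_of_nonneg (by unfold energy; positivity)] at this
  have hsq : μ ^ 2 = 1 := by
    rw [hE'] at hE
    push_cast at hE
    linear_combination -hE / 6
  have him : μ.im = 0 := by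
    rcases (sq_eq_sq_iff_eq_or_eq_neg.1 (hsq.trans (one_pow 2).symm) : μ = 1 ∨ μ = -1) with h | h <;> simp [h]
  have hre := re_sq_add_im_sq_of_norm hμ1
  rw [him] at h3 hre
  have hg : ζ.coords 4 * ζ.coords 5 = 1 := ζ.gammaProd_coords
  unfold energy at hE'
  have hsum : 2 * ζ.coords 0 ^ 2 + 2 * ζ.coords 1 ^ 2 + 2 * (ζ.coords 4 - ζ.coords 5) ^ 2 = 0 := by
    rw [h2, h3] at hE'
    linear_combination hE' - (ζ.coords 4 + ζ.coords 5) ^ 2 * hre - 6 * hg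
  have n0 := sq_nonneg (ζ.coords 0)
  have n1 := sq_nonneg (ζ.coords 1)
  have n2 := sq_nonneg (ζ.coords 4 - ζ.coords 5)
  have e : ζ.coords 5 = ζ.coords 4 :=
    (sub_eq_zero.1 (pow_eq_zero_iff two_ne_zero |>.1 (by linarith))).symm
  obtain ⟨e4, e5⟩ := gamma_eq_one_of_eq e
  refine eq_stationary (pow_eq_zero_iff two_ne_zero |>.1 (by linarith))
    (pow_eq_zero_iff two_ne_zero |>.1 (by linarith)) ?_ (by rw [h3, mul_zero]) e4 e5
  rw [h2, e4, e5]; ring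

/-! ### One root on the circle and another off it -/

/-- The coordinates on an isospectral set whose polynomial vanishes at `(n₁ + i n₂)²`, a point of
the unit circle. -/
def OnCircleLocus (n₁ n₂ : ℝ) (w : Fin 6 → ℝ) : Prop :=
  n₁ * w 1 - n₂ * w 0 = 0 ∧ w 2 - (w 4 + w 5) * (n₁ ^ 2 - n₂ ^ 2) = 0 ∧
    w 3 - (w 4 - w 5) * (2 * n₁ * n₂) = 0

theorem exists_sqrt_of_norm {μ : ℂ} (hμ : ‖μ‖ = 1) :
    ∃ n₁ n₂ : ℝ, n₁ ^ 2 + n₂ ^ 2 = 1 ∧ μ.re = n₁ ^ 2 - n₂ ^ 2 ∧ μ.im = 2 * n₁ * n₂ := by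
  obtain ⟨ν, rfl⟩ := IsAlgClosed.exists_pow_nat_eq μ two_pos
  refine ⟨ν.re, ν.im, re_sq_add_im_sq_of_norm ?_, ?_, ?_⟩
  · rw [norm_pow] at hμ
    exact (pow_eq_one_iff_of_nonneg (norm_nonneg ν) two_ne_zero).1 hμ
  · rw [pow_two, Complex.mul_re]; ring
  · rw [pow_two, Complex.mul_im]; ring

theorem onCircleLocus_of_isRoot {ζ : Potential} {μ : ℂ} (hμ : ‖μ‖ = 1)
    (h : ζ.specPoly.IsRoot μ) {n₁ n₂ : ℝ} (hn : n₁ ^ 2 + n₂ ^ 2 = 1)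
    (hre : μ.re = n₁ ^ 2 - n₂ ^ 2) (him : μ.im = 2 * n₁ * n₂) : OnCircleLocus n₁ n₂ ζ.coords := by
  obtain ⟨h0, h1, h2, h3⟩ := eq_of_isRoot_of_norm hμ h
  rw [hre, him] at h0 h1
  refine ⟨?_, by rw [h2, hre, sub_self], by rw [h3, him, sub_self]⟩
  have e0 : n₂ * (n₁ * ζ.coords 1 - n₂ * ζ.coords 0) = 0 := by
    linear_combination (-1 / 2 : ℝ) * h0 - ζ.coords 0 / 2 * hn
  have e1 : n₁ * (n₁ * ζ.coords 1 - n₂ * ζ.coords 0) = 0 := by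
    linear_combination (1 / 2 : ℝ) * h1 + ζ.coords 1 / 2 * hn
  linear_combination n₁ * e1 + n₂ * e0 - (n₁ * ζ.coords 1 - n₂ * ζ.coords 0) * hn

/-- With α = 0 and γ = 1 the circle root μ forces a = ((λ - μ)(λ - μ̄))², whose roots all lie on the
circle, contrary to z. -/
theorem coords_ne_of_isRoot {ζ : Potential} {μ z : ℂ} (hμ : ‖μ‖ = 1) (hz : ‖z‖ ≠ 1)
    (h : ζ.specPoly.IsRoot μ) (h' : ζ.specPoly.IsRoot z) :
    ¬ (ζ.coords 0 = 0 ∧ ζ.coords 1 = 0 ∧ ζ.coords 5 = ζ.coords 4) := by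
  rintro ⟨e0, e1, e⟩
  obtain ⟨-, -, h2, h3⟩ := eq_of_isRoot_of_norm hμ h
  obtain ⟨e4, e5⟩ := gamma_eq_one_of_eq e
  have e2 : ζ.coords 2 = 2 * μ.re := by rw [h2, e4, e5]; ring
  have e3 : ζ.coords 3 = 0 := by rw [h3, e4, e5]; ring
  rw [IsRoot, specPoly] at h'
  simp only [eval_add, eval_sub, eval_mul, eval_pow, eval_X, eval_C, eval_one, energy, casimirRe,
    casimirIm, e0, e1, e2, e3, e4, e5] at h'
  push_cast at h'
  have hsum : μ + conj μ = 2 * μ.re := by rw [Complex.add_conj]; push_cast; ring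
  have hprod : μ * conj μ = 1 := by rw [Complex.mul_conj, Complex.normSq_eq_norm_sq, hμ]; simp
  have hq : ((z - μ) * (z - conj μ)) ^ 2 = 0 := by
    rw [show (z - μ) * (z - conj μ) = z ^ 2 - 2 * μ.re * z + 1 by
      linear_combination -z * hsum + hprod]
    linear_combination h'
  rcases mul_eq_zero.1 (pow_eq_zero_iff two_ne_zero |>.1 hq) with k | k
  · exact hz (by rw [sub_eq_zero.1 k, hμ])
  · exact hz (by rw [sub_eq_zero.1 k, Complex.norm_conj, hμ])

/-- On the locus α = ρ(n₁ + i n₂) with ρ real, and β is a function of γ. All three integrals then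
depend only on ρ² + γ² + γ⁻². -/
theorem OnCircleLocus.integrals_eq {n₁ n₂ : ℝ} (hn : n₁ ^ 2 + n₂ ^ 2 = 1) {ζ : Potential}
    (h : OnCircleLocus n₁ n₂ ζ.coords) :
    casimirRe ζ.coords = (n₁ ^ 2 - n₂ ^ 2) * ((n₁ * ζ.coords 0 + n₂ * ζ.coords 1) ^ 2 +
      ζ.coords 4 ^ 2 + ζ.coords 5 ^ 2 + 2) ∧
    casimirIm ζ.coords = 2 * n₁ * n₂ * ((n₁ * ζ.coords 0 + n₂ * ζ.coords 1) ^ 2 +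
      ζ.coords 4 ^ 2 + ζ.coords 5 ^ 2 - 2) ∧
    energy ζ.coords = 2 * ((n₁ * ζ.coords 0 + n₂ * ζ.coords 1) ^ 2 +
      ζ.coords 4 ^ 2 + ζ.coords 5 ^ 2) + 2 * (n₁ ^ 2 - n₂ ^ 2) ^ 2 - 2 * (2 * n₁ * n₂) ^ 2 := by
  have hg := ζ.gammaProd_coords
  unfold gammaProd at hg
  obtain ⟨h1, h2, h3⟩ := h
  generalize ζ.coords = w at *
  obtain ⟨ρ, hρ⟩ : ∃ ρ, ρ = n₁ * w 0 + n₂ * w 1 := ⟨_, rfl⟩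
  have e0 : w 0 = ρ * n₁ := by rw [hρ]; linear_combination (-w 0) * hn - n₂ * h1
  have e1 : w 1 = ρ * n₂ := by rw [hρ]; linear_combination (-w 1) * hn + n₁ * h1
  have e2 : w 2 = (w 4 + w 5) * (n₁ ^ 2 - n₂ ^ 2) := by linarith
  have e3 : w 3 = (w 4 - w 5) * (2 * n₁ * n₂) := by linarith
  have hm : (n₁ ^ 2 - n₂ ^ 2) ^ 2 + (2 * n₁ * n₂) ^ 2 = 1 := by
    linear_combination (n₁ ^ 2 + n₂ ^ 2 + 1) * hn
  rw [← hρ]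
  unfold casimirRe casimirIm energy
  rw [e0, e1, e2, e3]
  refine ⟨?_, ?_, ?_⟩
  · linear_combination 2 * (n₁ ^ 2 - n₂ ^ 2) * hg
  · linear_combination -4 * n₁ * n₂ * hg
  · linear_combination 2 * ρ ^ 2 * hn + (w 4 ^ 2 + w 5 ^ 2) * hm +
      (2 * (n₁ ^ 2 - n₂ ^ 2) ^ 2 - 2 * (2 * n₁ * n₂) ^ 2) * hg

theorem OnCircleLocus.specPoly_eq_iff {n₁ n₂ : ℝ} (hn : n₁ ^ 2 + n₂ ^ 2 = 1) {ζ ζ' : Potential}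
    (h : OnCircleLocus n₁ n₂ ζ.coords) (h' : OnCircleLocus n₁ n₂ ζ'.coords) :
    ζ.specPoly = ζ'.specPoly ↔
      (n₁ * ζ.coords 0 + n₂ * ζ.coords 1) ^ 2 + ζ.coords 4 ^ 2 + ζ.coords 5 ^ 2 =
      (n₁ * ζ'.coords 0 + n₂ * ζ'.coords 1) ^ 2 + ζ'.coords 4 ^ 2 + ζ'.coords 5 ^ 2 := by
  obtain ⟨k1, k2, k3⟩ := h.integrals_eq hn
  obtain ⟨k1', k2', k3'⟩ := h'.integrals_eq hn
  rw [Potential.specPoly_eq_iff, k1, k2, k3, k1', k2', k3']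
  constructor
  · rintro ⟨-, -, h⟩
    linarith
  · intro h
    refine ⟨?_, ?_, ?_⟩
    · rw [h]
    · rw [h]
    · rw [h]

end Potential

namespace Potential

theorem OnCircleLocus.coords_eq {n₁ n₂ : ℝ} (hn : n₁ ^ 2 + n₂ ^ 2 = 1) {w : Fin 6 → ℝ}
    (h : OnCircleLocus n₁ n₂ w) :
    w 0 = (n₁ * w 0 + n₂ * w 1) * n₁ ∧ w 1 = (n₁ * w 0 + n₂ * w 1) * n₂ := by
  refine ⟨?_, ?_⟩
  · linear_combination (-w 0) * hn - n₂ * h.1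
  · linear_combination (-w 1) * hn + n₁ * h.1

theorem OnCircleLocus.isInner {n₁ n₂ : ℝ} (hn : n₁ ^ 2 + n₂ ^ 2 = 1) {ζ : Potential}
    (h : OnCircleLocus n₁ n₂ ζ.coords) (hlt : ζ.coords 5 < ζ.coords 4) : ζ.IsInner := by
  refine ⟨hlt, le_of_eq ?_⟩
  rw [sub_eq_zero.1 h.2.1, sub_eq_zero.1 h.2.2]
  linear_combination ((ζ.coords 4 + ζ.coords 5) * (ζ.coords 4 - ζ.coords 5)) ^ 2 *
    (n₁ ^ 2 + n₂ ^ 2 + 1) * hn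

/-- The isospectral set is a curve on which ρ = n₁ Re α + n₂ Im α is a local parameter as long as
γ⁻¹ < γ; the fields move ρ at speeds proportional to n₁ and -n₂, which are not both zero. -/
theorem OnCircleLocus.eventually_mem_laxOrbit {n₁ n₂ : ℝ} (hn : n₁ ^ 2 + n₂ ^ 2 = 1) {a : ℂ[X]}
    (hloc : ∀ ζ ∈ isoSet a, OnCircleLocus n₁ n₂ ζ.coords) {M : Potential} (hM : M ∈ isoSet a)
    (hlt : M.coords 5 < M.coords 4) :
    ∀ᶠ ζ in 𝓝 M, ζ ∈ isoSet a → ζ ∈ laxOrbit laxFlow M := by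
  let T : (Fin 6 → ℝ) →L[ℝ] ℝ := n₁ • ContinuousLinearMap.proj 0 + n₂ • ContinuousLinearMap.proj 1
  have hT : ∀ w, T w = n₁ * w 0 + n₂ * w 1 := fun w => by simp [T]
  refine Potential.eventually_mem_laxOrbit T hM
    ((isOpen_lt (continuous_coords_apply 5) (continuous_coords_apply 4)).mem_nhds hlt) ?_ ?_
  · rintro ζ ⟨hζ, hζa⟩ ζ' ⟨hζ', hζa'⟩ he
    have hs : ζ.specPoly = ζ'.specPoly := by rw [mem_isoSet_iff.1 hζa, mem_isoSet_iff.1 hζa']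
    have h := hloc ζ hζa
    have h' := hloc ζ' hζa'
    rw [hT, hT] at he
    refine (h.isInner hn hζ).eq_of_specPoly_eq (h'.isInner hn hζ') hs ?_ ?_
    · rw [(h.coords_eq hn).1, (h'.coords_eq hn).1, he]
    · rw [(h.coords_eq hn).2, (h'.coords_eq hn).2, he]
  · intro g
    obtain ⟨-, h2, h3⟩ := hloc M hM
    have hp : 0 < M.coords 4 + M.coords 5 := add_pos M.coords_four_pos M.coords_five_pos
    have hq : 0 < M.coords 4 - M.coords 5 := sub_pos.2 hlt
    generalize M.coords = w at *
    have hX : T (fieldX w) = 2 * (w 4 + w 5) * (w 4 - w 5) * n₁ := by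
      simp only [hT, fieldX, Matrix.cons_val]
      linear_combination n₁ * (w 4 - w 5) * h2 + n₂ * (w 4 + w 5) * h3 +
        n₁ * (w 4 + w 5) * (w 4 - w 5) * hn
    have hY : T (fieldY w) = -(2 * (w 4 + w 5) * (w 4 - w 5) * n₂) := by
      simp only [hT, fieldY, Matrix.cons_val]
      linear_combination n₂ * (w 4 - w 5) * h2 - n₁ * (w 4 + w 5) * h3 -
        n₂ * (w 4 + w 5) * (w 4 - w 5) * hn
    refine ⟨g * n₁ / (2 * (w 4 + w 5) * (w 4 - w 5)), -(g * n₂ / (2 * (w 4 + w 5) * (w 4 - w 5))), ?_⟩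
    rw [hX, hY, smul_eq_mul, smul_eq_mul]
    field_simp
    linear_combination g * hn

theorem isoSet_eq_laxOrbit_of_onCircleLocus {n₁ n₂ : ℝ} (hn : n₁ ^ 2 + n₂ ^ 2 = 1) {a : ℂ[X]}
    (hloc : ∀ ζ ∈ isoSet a, OnCircleLocus n₁ n₂ ζ.coords)
    (hne : ∀ ζ ∈ isoSet a, ¬ (ζ.coords 0 = 0 ∧ ζ.coords 1 = 0 ∧ ζ.coords 5 = ζ.coords 4)) :
    ∀ ζ ∈ isoSet a, isoSet a = laxOrbit laxFlow ζ := by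
  refine eq_laxOrbit_of_forall_exists_isInner Subset.rfl
    (fun ζ hζ => laxOrbit_subset_isoSet hζ) fun ζ hζ => ?_
  obtain ⟨M, hM, h0, h1, hle, -, -⟩ := exists_forall_mem_closure_laxOrbit_le ζ
  have hMa := closure_laxOrbit_subset_isoSet hζ hM
  have hlt : M.coords 5 < M.coords 4 := hle.lt_of_ne fun h => hne M hMa ⟨h0, h1, h⟩
  exact ⟨M, mem_laxOrbit_of_mem_closure
    (OnCircleLocus.eventually_mem_laxOrbit hn hloc hMa hlt) hζ hM, h0, h1,
    (hloc M hMa).isInner hn hlt⟩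

/-- Equations for the isospectral sets inside the locus. -/
noncomputable def circleEquations (n₁ n₂ : ℝ) : Fin 4 → (Fin 6 → ℝ) → ℝ :=
  ![fun w => n₁ * w 1 - n₂ * w 0, fun w => w 2 - (w 4 + w 5) * (n₁ ^ 2 - n₂ ^ 2),
    fun w => w 3 - (w 4 - w 5) * (2 * n₁ * n₂),
    fun w => (n₁ * w 0 + n₂ * w 1) ^ 2 + w 4 ^ 2 + w 5 ^ 2]

theorem contDiff_circleEquations {n₁ n₂ : ℝ} {n : WithTop ℕ∞} (i : Fin 4) :
    ContDiff ℝ n (circleEquations n₁ n₂ i) := by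
  fin_cases i <;> simp only [circleEquations] <;> simp <;> fun_prop

theorem fderiv_circleEquations (n₁ n₂ : ℝ) (w k : Fin 6 → ℝ) :
    (fun i => fderiv ℝ (circleEquations n₁ n₂ i) w k) =
      ![n₁ * k 1 - n₂ * k 0, k 2 - (k 4 + k 5) * (n₁ ^ 2 - n₂ ^ 2),
        k 3 - (k 4 - k 5) * (2 * n₁ * n₂),
        2 * (n₁ * w 0 + n₂ * w 1) * (n₁ * k 0 + n₂ * k 1) + 2 * w 4 * k 4 + 2 * w 5 * k 5] := by
  have hl : ∀ i, HasDerivAt (fun t : ℝ => w i + t * k i) (k i) 0 := fun i =>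
    (hasDerivAt_mul_const (k i)).const_add (w i)
  have key : ∀ i c, HasDerivAt (fun t : ℝ => circleEquations n₁ n₂ i (w + t • k)) c 0 →
      fderiv ℝ (circleEquations n₁ n₂ i) w k = c := fun i c hc => by
    have h := ((contDiff_circleEquations (n₁ := n₁) (n₂ := n₂) (n := 1) i).differentiable one_ne_zero
      w).hasFDerivAt.hasLineDerivAt k
    exact HasDerivAt.unique h hc
  ext i
  refine key i _ ?_
  fin_cases i
  · exact (((hl 1).const_mul n₁).sub ((hl 0).const_mul n₂))
  · exact ((hl 2).sub (((hl 4).add (hl 5)).mul_const _))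
  · exact ((hl 3).sub (((hl 4).sub (hl 5)).mul_const _))
  · exact ((((((hl 0).const_mul n₁).add ((hl 1).const_mul n₂)).pow 2).add ((hl 4).pow 2)).add
      ((hl 5).pow 2)).congr_deriv (by simp)

/-- The first three equations are always independent, and the quadratic one is critical on their
zero set only where ρ = 0 and γ = γ⁻¹, a point excluded by `hne`. -/
theorem surjective_fderiv_circleEquations {n₁ n₂ : ℝ} (hn : n₁ ^ 2 + n₂ ^ 2 = 1) {ζ : Potential}
    (h : OnCircleLocus n₁ n₂ ζ.coords)
    (hne : ¬ (ζ.coords 0 = 0 ∧ ζ.coords 1 = 0 ∧ ζ.coords 5 = ζ.coords 4)) :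
    Function.Surjective (fderiv ℝ (ambientMap (circleEquations n₁ n₂)) ζ.1) := by
  have hγ : ζ.1.2.2 ≠ 0 := ζ.2.ne'
  refine surjective_of_forall_functional
    (fderiv ℝ (ambientMap (circleEquations n₁ n₂)) ζ.1).toLinearMap fun t ht => ?_
  have hv := fun v => ht v
  have hd := fun w k i => congrFun (fderiv_circleEquations n₁ n₂ w k) i
  simp only [ContinuousLinearMap.coe_coe, fderiv_ambientMap contDiff_circleEquations hγ,
    Fin.sum_univ_four, hd, fderiv_ambientCoords hγ, ambientCoords_val] at hv
  have g0 := hv (1, 0, 0)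
  have g1 := hv (Complex.I, 0, 0)
  have g2 := hv (0, 1, 0)
  have g3 := hv (0, Complex.I, 0)
  have g4 := hv (0, 0, 1)
  have hinv : (ζ.1.2.2)⁻¹ = ζ.coords 5 := rfl
  have hg : ζ.coords 4 * ζ.coords 5 = 1 := ζ.gammaProd_coords
  obtain ⟨c0, c1⟩ := h.coords_eq hn
  have h4p := ζ.coords_four_pos
  have h5p := ζ.coords_five_pos
  simp [hinv] at g0 g1 g2 g3 g4
  generalize ζ.coords = w at *
  obtain ⟨ρ, hρ⟩ : ∃ ρ, ρ = n₁ * w 0 + n₂ * w 1 := ⟨_, rfl⟩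
  rw [← hρ] at g0 g1 c0 c1
  have t0 : t 0 = 0 := by linear_combination n₁ * g1 - n₂ * g0 - t 0 * hn
  have t3 : t 3 = 0 := by
    by_contra h3
    have e : t 3 * (2 * ρ) = 0 := by linear_combination n₁ * g0 + n₂ * g1 - t 3 * (2 * ρ) * hn
    have hρ0 : ρ = 0 := by simpa [h3] using e
    rw [hρ0, zero_mul] at c0 c1
    have e' : t 3 * (w 4 - w 5 ^ 3) = 0 := by
      simp only [g2, g3] at g4
      linarith
    have e'' : w 4 = w 5 ^ 3 := by
      rcases mul_eq_zero.1 e' with k | k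
      · exact absurd k h3
      · linarith
    refine hne ⟨c0, c1, ?_⟩
    rw [e''] at hg ⊢
    have : w 5 = 1 := by
      have : w 5 ^ 4 = 1 := by linarith
      exact (pow_eq_one_iff_of_nonneg h5p.le (by norm_num)).1 this
    rw [this]; norm_num
  ext i
  fin_cases i
  exacts [t0, g2, g3, t3]

theorem isPotentialSubmanifold_of_onCircleLocus {n₁ n₂ : ℝ} (hn : n₁ ^ 2 + n₂ ^ 2 = 1) {a : ℂ[X]}
    (hloc : ∀ ζ ∈ isoSet a, OnCircleLocus n₁ n₂ ζ.coords)
    (hne : ∀ ζ ∈ isoSet a, ¬ (ζ.coords 0 = 0 ∧ ζ.coords 1 = 0 ∧ ζ.coords 5 = ζ.coords 4)) :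
    IsPotentialSubmanifold 1 (isoSet a) := by
  refine isSubmanifold_of_forall_exists_regular (m := 4) (by rw [finrank_ambient]) ?_
  rintro _ ⟨ζ, hζ, rfl⟩
  refine ⟨ambientMap (circleEquations n₁ n₂), {p | 0 < p.2.2}, isOpen_setOf_gamma_pos, ζ.2, ?_,
    surjective_fderiv_circleEquations hn (hloc ζ hζ) (hne ζ hζ), ?_⟩
  · exact fun p hp => (contDiffAt_ambientMap contDiff_circleEquations
      (ne_of_gt hp)).contDiffWithinAt
  · intro p hp
    obtain ⟨ζ', rfl⟩ : ∃ ζ' : Potential, ζ'.1 = p := ⟨⟨p, hp⟩, rfl⟩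
    have h := hloc ζ hζ
    rw [Subtype.val_injective.mem_set_image]
    constructor
    · intro hζ'
      have h' := hloc ζ' hζ'
      have hs := (h'.specPoly_eq_iff hn h).1
        (by rw [mem_isoSet_iff.1 hζ', mem_isoSet_iff.1 hζ])
      ext i
      fin_cases i
      exacts [h'.1.trans h.1.symm, h'.2.1.trans h.2.1.symm, h'.2.2.trans h.2.2.symm, hs]
    · intro he
      have h' : OnCircleLocus n₁ n₂ ζ'.coords :=
        ⟨(congrFun he 0).trans h.1, (congrFun he 1).trans h.2.1, (congrFun he 2).trans h.2.2⟩
      rw [mem_isoSet_iff, (h'.specPoly_eq_iff hn h).2 (congrFun he 3), mem_isoSet_iff.1 hζ]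

theorem isPotentialSubmanifold_and_eq_laxOrbit_of_roots {a : ℂ[X]} {μ z : ℂ} (hμ : μ ∈ a.roots)
    (hz : z ∈ a.roots) (hμ1 : ‖μ‖ = 1) (hz1 : ‖z‖ ≠ 1) :
    IsPotentialSubmanifold 1 (isoSet a) ∧ ∀ ζ ∈ isoSet a, isoSet a = laxOrbit laxFlow ζ := by
  obtain ⟨n₁, n₂, hn, hre, him⟩ := exists_sqrt_of_norm hμ1
  have hloc : ∀ ζ ∈ isoSet a, OnCircleLocus n₁ n₂ ζ.coords := fun ζ hζ =>
    onCircleLocus_of_isRoot hμ1 (isRoot_specPoly hζ hμ) hn hre him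
  have hne : ∀ ζ ∈ isoSet a, ¬ (ζ.coords 0 = 0 ∧ ζ.coords 1 = 0 ∧ ζ.coords 5 = ζ.coords 4) :=
    fun ζ hζ => coords_ne_of_isRoot hμ1 hz1 (isRoot_specPoly hζ hμ) (isRoot_specPoly hζ hz)
  exact ⟨isPotentialSubmanifold_of_onCircleLocus hn hloc hne,
    isoSet_eq_laxOrbit_of_onCircleLocus hn hloc hne⟩

end Potential

/-! ### No negative entire solutions of the sinh-Gordon equation -/

/-- A Liouville property of the equation `Δ h = -8 sinh (2 h)` satisfied by `h = log γ` along the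
joint flow: it has no negative entire solutions. -/
theorem exists_one_le_jointFlow_four {w : Fin 6 → ℝ} (hg : gammaProd w = 1) (h4 : 0 < w 4) :
    ∃ p, 1 ≤ jointFlow p w 4 := by
  by_contra! hlt
  have hpos : ∀ p, 0 < jointFlow p w 4 := fun p => jointFlow_four_pos hg h4 p
  have hprod : ∀ p, jointFlow p w 4 * jointFlow p w 5 = 1 := fun p =>
    (isFirstIntegral_gammaProd.jointFlow_eq p w).trans hg
  have hlog : ∀ p, 0 < -Real.log (jointFlow p w 4) := fun p =>
    neg_pos.2 (Real.log_neg (hpos p) (hlt p))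
  have hcont : Continuous fun p => jointFlow p w 4 :=
    (continuous_apply 4).comp (continuous_jointFlow.comp (continuous_id.prodMk continuous_const))
  -- Comparison of u = -log γ > 0 with the Dirichlet eigenfunction sin x sin y of the square. At the
  -- interior maximum T of the quotient, sin x sin y - T u touches 0 from below, so both second
  -- derivatives are nonpositive.
  have hcontF : Continuous fun p : ℝ × ℝ =>
      Real.sin p.1 * Real.sin p.2 / -Real.log (jointFlow p w 4) :=
    ((Real.continuous_sin.comp continuous_fst).mul (Real.continuous_sin.comp continuous_snd)).div
      (hcont.log fun p => (hpos p).ne').neg fun p => (hlog p).ne'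
  have hπ := Real.pi_pos
  have hK : IsCompact (Icc 0 Real.pi ×ˢ Icc 0 Real.pi) := isCompact_Icc.prod isCompact_Icc
  have hmid : ((Real.pi / 2, Real.pi / 2) : ℝ × ℝ) ∈ Icc 0 Real.pi ×ˢ Icc 0 Real.pi :=
    ⟨⟨by positivity, by simp only []; linarith⟩, ⟨by positivity, by simp only []; linarith⟩⟩
  obtain ⟨⟨x, y⟩, ⟨hx, hy⟩, hmax⟩ := hK.exists_isMaxOn ⟨_, hmid⟩ hcontF.continuousOn
  simp only at hx hy
  obtain ⟨T, hT⟩ : ∃ T, T = Real.sin x * Real.sin y / -Real.log (jointFlow (x, y) w 4) := ⟨_, rfl⟩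
  have hle : ∀ u v, u ∈ Icc 0 Real.pi → v ∈ Icc 0 Real.pi →
      Real.sin u * Real.sin v ≤ T * -Real.log (jointFlow (u, v) w 4) := fun u v hu hv => by
    have := isMaxOn_iff.1 hmax (u, v) ⟨hu, hv⟩
    simp only at this
    rw [← hT] at this
    exact (div_le_iff₀ (hlog _)).1 this
  have heq : Real.sin x * Real.sin y = T * -Real.log (jointFlow (x, y) w 4) := by
    rw [hT, div_mul_cancel₀ _ (hlog _).ne']
  have hTpos : 0 < T := by
    have := hle _ _ hmid.1 hmid.2
    simp only [Real.sin_pi_div_two, mul_one] at this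
    exact pos_of_mul_pos_left (one_pos.trans_le this) (hlog _).le
  have hψ : 0 < Real.sin x * Real.sin y := heq ▸ mul_pos hTpos (hlog _)
  have hsx := Real.sin_nonneg_of_mem_Icc hx
  have hsy := Real.sin_nonneg_of_mem_Icc hy
  have hx0 : Real.sin x ≠ 0 := fun h => by simp [h] at hψ
  have hy0 : Real.sin y ≠ 0 := fun h => by simp [h] at hψ
  have hint : ∀ {u}, u ∈ Icc 0 Real.pi → Real.sin u ≠ 0 → Icc 0 Real.pi ∈ 𝓝 u := fun hu h =>
    Icc_mem_nhds (hu.1.lt_of_ne fun h' => h (by rw [← h', Real.sin_zero]))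
      (hu.2.lt_of_ne fun h' => h (by rw [h', Real.sin_pi]))
  have dX : ∀ t i, HasDerivAt (fun t => jointFlow (t, y) w i) (fieldX (jointFlow (t, y) w) i) t :=
    fun t i => hasDerivAt_pi.1 (hasDerivAt_jointFlow_fst w t y) i
  have dY : ∀ t i, HasDerivAt (fun t => jointFlow (x, t) w i) (fieldY (jointFlow (x, t) w) i) t :=
    fun t i => hasDerivAt_pi.1 (hasDerivAt_jointFlow_snd w x t) i
  have hX := second_deriv_nonpos_of_forall_le
    (f := fun t => Real.sin t * Real.sin y - T * -Real.log (jointFlow (t, y) w 4))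
    (f' := fun t => Real.cos t * Real.sin y - T * (2 * jointFlow (t, y) w 0)) (t₀ := x)
    (.of_forall fun t => by
      refine (((Real.hasDerivAt_sin t).mul_const _).sub
        ((((dX t 4).log (hpos _).ne').neg).const_mul T)).congr_deriv ?_
      have := (hpos (t, y)).ne'
      simp only [fieldX, Matrix.cons_val]
      field_simp)
    (((Real.hasDerivAt_cos x).mul_const _).sub (((dX x 0).const_mul 2).const_mul T))
    (by
      filter_upwards [hint hx hx0] with t ht
      have := hle t y ht hy
      linarith)
  have hY := second_deriv_nonpos_of_forall_le
    (f := fun t => Real.sin x * Real.sin t - T * -Real.log (jointFlow (x, t) w 4))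
    (f' := fun t => Real.sin x * Real.cos t - T * (-2 * jointFlow (x, t) w 1)) (t₀ := y)
    (.of_forall fun t => by
      refine (((Real.hasDerivAt_sin t).const_mul _).sub
        ((((dY t 4).log (hpos _).ne').neg).const_mul T)).congr_deriv ?_
      have := (hpos (x, t)).ne'
      simp only [fieldY, Matrix.cons_val]
      field_simp)
    (((Real.hasDerivAt_cos y).const_mul _).sub (((dY y 1).const_mul (-2)).const_mul T))
    (by
      filter_upwards [hint hy hy0] with t ht
      have := hle x t hx ht
      linarith)
  have hone := hlt (x, y)
  have hone' := hpos (x, y)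
  have hinv := hprod (x, y)
  generalize jointFlow (x, y) w = c at *
  have hc5 : c 5 = (c 4)⁻¹ := eq_inv_of_mul_eq_one_right hinv
  have hlog5 : -Real.log (c 4) ≤ c 5 - 1 := by
    rw [← Real.log_inv, ← hc5]
    exact Real.log_le_sub_one_of_pos (hc5 ▸ inv_pos.2 hone')
  have h5 : 1 < c 5 := hc5 ▸ (one_lt_inv₀ hone').2 hone
  simp only [fieldX, fieldY, Matrix.cons_val] at hX hY
  -- Sum of the two inequalities. It contradicts u ≤ γ⁻¹ - 1 together with γ < 1 < γ⁻¹.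
  have hsum : T * (2 * (c 5 ^ 2 - c 4 ^ 2)) ≤ T * -Real.log (c 4) := by
    rw [← heq]
    linarith
  have := le_of_mul_le_mul_left hsum hTpos
  nlinarith

/-! ### Two double roots off the circle -/

namespace Potential

theorem stationary_integrals (s : ℝ) : casimirRe (stationary s).coords = 2 * s ∧
    casimirIm (stationary s).coords = 0 ∧ energy (stationary s).coords = s ^ 2 + 2 := by
  rw [coords_stationary]
  unfold casimirRe casimirIm energy
  refine ⟨?_, ?_, ?_⟩ <;> simp <;> ring

theorem mem_isoSet_stationary_iff {ζ : Potential} {s : ℝ} :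
    ζ ∈ isoSet (stationary s).specPoly ↔ casimirRe ζ.coords = 2 * s ∧
      casimirIm ζ.coords = 0 ∧ energy ζ.coords = s ^ 2 + 2 := by
  obtain ⟨h1, h2, h3⟩ := stationary_integrals s
  rw [mem_isoSet_iff, specPoly_eq_iff, h1, h2, h3]

theorem isRoot_specPoly_stationary {s : ℝ} {z : ℂ} :
    (stationary s).specPoly.IsRoot z ↔ z ^ 2 - s * z + 1 = 0 := by
  obtain ⟨h1, h2, h3⟩ := stationary_integrals s
  rw [IsRoot, specPoly, h1, h2, h3, ← pow_eq_zero_iff (a := z ^ 2 - s * z + 1) two_ne_zero]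
  simp only [eval_add, eval_sub, eval_mul, eval_pow, eval_X, eval_C, eval_one]
  push_cast
  constructor <;> intro h <;> linear_combination h

theorem exists_real_of_isRoot {s : ℝ} (hs : 4 < s ^ 2) {z : ℂ}
    (h : (stationary s).specPoly.IsRoot z) : ∃ r : ℝ, z = r ∧ r ^ 2 - s * r + 1 = 0 := by
  rw [isRoot_specPoly_stationary] at h
  have hre := congrArg Complex.re h
  have him := congrArg Complex.im h
  simp [pow_two] at hre him
  have h0 : z.im * (2 * z.re - s) = 0 := by linarith
  have hz : z.im = 0 := by
    rcases mul_eq_zero.1 h0 with h0 | h0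
    · exact h0
    · have : s = 2 * z.re := by linarith
      rw [this] at hs hre
      nlinarith
  refine ⟨z.re, Complex.ext rfl (by simp [hz]), ?_⟩
  rw [hz] at hre
  linarith

theorem evalAt_stationary {s : ℝ} {z : ℂ} (h : (stationary s).specPoly.IsRoot z) :
    (stationary s).evalAt z = 0 := by
  rw [isRoot_specPoly_stationary] at h
  rw [evalAt_eq, coords_stationary]
  ext i j
  fin_cases i <;> fin_cases j <;> simp [coordMatrix]
  · linear_combination -h
  · linear_combination z * h

/-- A root of ζ is a root of λ² - sλ + 1, hence real and different from 0 and ±1. Evaluating the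
entries there kills α and Im β, forces γ = γ⁻¹, and the integral then fixes β. -/
theorem eq_stationary_of_evalAt_eq_zero {s : ℝ} (hs : 4 < s ^ 2) {ζ : Potential}
    (hζ : ζ ∈ isoSet (stationary s).specPoly) {z : ℂ} (h : ζ.evalAt z = 0) :
    ζ = stationary s := by
  have hroot := isRoot_of_evalAt_eq_zero h
  rw [mem_isoSet_iff.1 hζ] at hroot
  obtain ⟨r, rfl, hr⟩ := exists_real_of_isRoot hs hroot
  have hg : ζ.coords 4 * ζ.coords 5 = 1 := ζ.gammaProd_coords
  have h4 := ζ.coords_four_pos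
  have h5 := ζ.coords_five_pos
  obtain ⟨hc, -, -⟩ := mem_isoSet_stationary_iff.1 hζ
  rw [evalAt_eq] at h
  have a1 := congrArg Complex.re (congrFun (congrFun h 0) 0)
  have a2 := congrArg Complex.im (congrFun (congrFun h 0) 0)
  have a3 := congrArg Complex.re (congrFun (congrFun h 0) 1)
  have a4 := congrArg Complex.im (congrFun (congrFun h 0) 1)
  have a5 := congrArg Complex.re (congrFun (congrFun h 1) 0)
  simp [coordMatrix, ← Complex.ofReal_pow] at a1 a2 a3 a4 a5
  unfold casimirRe at hc
  have hr0 : r ≠ 0 := by rintro rfl; norm_num at hr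
  have hr1 : r ^ 2 ≠ 1 := fun h => by
    have : (s * r) ^ 2 = 4 := by rw [show s * r = 2 by linarith]; norm_num
    rw [mul_pow, h] at this
    linarith
  have hm : 1 - r ≠ 0 := fun h => hr1 (by rw [show r = 1 by linarith]; norm_num)
  have hp : 1 + r ≠ 0 := fun h => hr1 (by rw [show r = -1 by linarith]; norm_num)
  have e0 : ζ.coords 0 = 0 := by
    refine (mul_eq_zero.1 (?_ : ζ.coords 0 * (r * (1 - r)) = 0)).resolve_right (mul_ne_zero hr0 hm)
    linarith
  have e1 : ζ.coords 1 = 0 := by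
    refine (mul_eq_zero.1 (?_ : ζ.coords 1 * (r * (1 + r)) = 0)).resolve_right (mul_ne_zero hr0 hp)
    linarith
  have e3 : ζ.coords 3 = 0 := by
    refine (mul_eq_zero.1 (?_ : ζ.coords 3 * r = 0)).resolve_right hr0
    simpa using a4
  have e : ζ.coords 5 = ζ.coords 4 := by
    have : (ζ.coords 4 - ζ.coords 5) * (r * (1 - r ^ 2)) = 0 := by
      linear_combination a5 + r * a3
    have := (mul_eq_zero.1 this).resolve_right (mul_ne_zero hr0 fun h => hr1 (by linarith))
    linarith
  obtain ⟨e4, e5⟩ := gamma_eq_one_of_eq e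
  rw [e0, e1, e4, e5] at hc
  exact eq_stationary e0 e1 (by linarith) e3 e4 e5

theorem stationary_mem_isoSet (s : ℝ) : stationary s ∈ isoSet (stationary s).specPoly :=
  mem_isoSet_iff.2 rfl

theorem exists_evalAt_stationary_eq_zero (s : ℝ) : ∃ z, (stationary s).evalAt z = 0 := by
  refine exists_evalAt_eq_zero_of_gamma_eq_one ?_ ?_ ?_ ?_ ?_ <;> simp [coords_stationary]

theorem mem_rootlessPart_stationary_iff {s : ℝ} (hs : 4 < s ^ 2) {ζ : Potential} :
    ζ ∈ rootlessPart (stationary s).specPoly ↔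
      ζ ∈ isoSet (stationary s).specPoly ∧ ζ ≠ stationary s := by
  constructor
  · rintro ⟨h, hr⟩
    refine ⟨h, ?_⟩
    rintro rfl
    obtain ⟨z, hz⟩ := exists_evalAt_stationary_eq_zero s
    exact hr z hz
  · exact fun ⟨h, hne⟩ => ⟨h, fun z hz => hne (eq_stationary_of_evalAt_eq_zero hs h hz)⟩

theorem vanishingPart_stationary {s : ℝ} (hs : 4 < s ^ 2) {z : ℂ}
    (hz : (stationary s).specPoly.IsRoot z) :
    vanishingPart (stationary s).specPoly z = {stationary s} := by
  ext ζ
  constructor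
  · exact fun h => eq_stationary_of_evalAt_eq_zero hs h.1 h.2
  · rintro rfl
    exact ⟨stationary_mem_isoSet s, evalAt_stationary hz⟩

theorem laxFlow_ne_stationary {ζ : Potential} {s : ℝ} (h : ζ ≠ stationary s) (p : ℝ × ℝ) :
    laxFlow p ζ ≠ stationary s := by
  intro he
  rw [← laxFlow_neg_laxFlow p ζ, he, laxFlow_stationary] at h
  exact h rfl

theorem laxOrbit_subset_rootlessPart {s : ℝ} (hs : 4 < s ^ 2) {ζ : Potential}
    (h : ζ ∈ rootlessPart (stationary s).specPoly) :
    laxOrbit laxFlow ζ ⊆ rootlessPart (stationary s).specPoly := by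
  rw [mem_rootlessPart_stationary_iff hs] at h
  rintro _ ⟨p, rfl⟩
  exact (mem_rootlessPart_stationary_iff hs).2
    ⟨laxFlow_mem_isoSet h.1 p, laxFlow_ne_stationary h.2 p⟩

theorem eq_stationary_of_gamma_eq_one {s : ℝ} {ζ : Potential}
    (hζ : ζ ∈ isoSet (stationary s).specPoly) (h0 : ζ.coords 0 = 0) (h1 : ζ.coords 1 = 0)
    (h3 : ζ.coords 3 = 0) (h4 : ζ.coords 4 = 1) (h5 : ζ.coords 5 = 1) : ζ = stationary s := by
  obtain ⟨hc, -, -⟩ := mem_isoSet_stationary_iff.1 hζ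
  unfold casimirRe at hc
  rw [h0, h1, h4, h5] at hc
  exact eq_stationary h0 h1 (by linarith) h3 h4 h5

/-- The maximising M could be the stationary point in the closure, with γ = 1. But the Liouville
property yields an orbit point with γ ≥ 1, which is then itself such a maximum. That point would
have to be stationary, whereas a fixed point is not reached from a different potential. -/
theorem exists_isInner_mem_laxOrbit_of_rootless {s : ℝ} (hs : 4 < s ^ 2) {ζ : Potential}
    (hζ : ζ ∈ rootlessPart (stationary s).specPoly) :
    ∃ M ∈ laxOrbit laxFlow ζ, M.coords 0 = 0 ∧ M.coords 1 = 0 ∧ M.IsInner := by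
  obtain ⟨hζa, hne⟩ := (mem_rootlessPart_stationary_iff hs).1 hζ
  obtain ⟨M, hM, h0, h1, hle, hq, hmax⟩ := exists_forall_mem_closure_laxOrbit_le ζ
  have hMa := closure_laxOrbit_subset_isoSet hζa hM
  rcases isInner_or hle hq with hi | ⟨h3, h4, h5⟩
  · have hMr : M ∈ rootlessPart (stationary s).specPoly := by
      refine (mem_rootlessPart_stationary_iff hs).2 ⟨hMa, ?_⟩
      rintro rfl
      have := hi.1
      simp [coords_stationary] at this
    have hstr := hi.isStrictlyInner h0 h1 hMr.2
    exact ⟨M, mem_laxOrbit_of_mem_closure (hstr.eventually_mem_laxOrbit hMa) hζa hM, h0, h1, hi⟩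
  · exfalso
    obtain ⟨p, hp⟩ := exists_one_le_jointFlow_four ζ.gammaProd_coords ζ.coords_four_pos
    rw [← coords_laxFlow] at hp
    set ζ' := laxFlow p ζ with hζ'
    have hmem : ∀ q, laxFlow q ζ' ∈ closure (laxOrbit laxFlow ζ) := fun q =>
      laxFlow_mem_closure_laxOrbit (subset_closure ⟨p, rfl⟩) q
    have hone : ζ'.coords 4 = 1 := le_antisymm
      (h4 ▸ hmax ζ' (subset_closure ⟨p, rfl⟩)) hp
    have hone5 : ζ'.coords 5 = 1 := by
      have : ζ'.coords 4 * ζ'.coords 5 = 1 := ζ'.gammaProd_coords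
      rwa [hone, one_mul] at this
    obtain ⟨k0, k1, kle, kq⟩ := conditions_of_forall_jointFlow_le ζ'.coords_four_pos
      ζ'.coords_five_pos fun q => by
        rw [← coords_laxFlow, hone, ← h4]
        exact hmax _ (hmem q)
    rcases isInner_or kle kq with hi | ⟨k3, k4, k5⟩
    · have := hi.1
      rw [hone, hone5] at this
      exact lt_irrefl _ this
    · exact laxFlow_ne_stationary hne p
        (eq_stationary_of_gamma_eq_one (laxFlow_mem_isoSet hζa p) k0 k1 k3 k4 k5)

theorem rootlessPart_stationary_eq_laxOrbit {s : ℝ} (hs : 4 < s ^ 2) :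
    ∀ ζ ∈ rootlessPart (stationary s).specPoly,
      rootlessPart (stationary s).specPoly = laxOrbit laxFlow ζ :=
  eq_laxOrbit_of_forall_exists_isInner (fun _ h => h.1)
    (fun _ h => laxOrbit_subset_rootlessPart hs h)
    fun _ h => exists_isInner_mem_laxOrbit_of_rootless hs h

theorem stationary_mem_closure_of_sign {s e A B : ℝ} (hs : 4 < s ^ 2) (he : e ^ 2 = 1)
    (hes : 2 < e * s) (h1 : A ^ 2 - B ^ 2 = -e) (h2 : A ^ 2 + B ^ 2 = 1) (h3 : A * B = 0) :
    stationary s ∈ closure (rootlessPart (stationary s).specPoly) := by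
  -- A curve with γ = eᵗ and p = γ + γ⁻¹. The sign e is that of s, β is chosen linear in p, and α² =
  -- -e(p - 2)(es - p) solves the level equations; (A + iB)² = -e provides the square root, and es >
  -- 2 keeps the radicand nonnegative for small t.
  let p : ℝ → ℝ := fun t => Real.exp t + Real.exp (-t)
  let c : ℝ → Fin 6 → ℝ := fun t => ![A * √((p t - 2) * (e * s - p t)),
    B * √((p t - 2) * (e * s - p t)), s + e * (2 - p t), 0, Real.exp t, Real.exp (-t)]
  have hpc : Continuous p := by fun_prop
  have hcc : Continuous c := by
    refine continuous_pi fun i => ?_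
    fin_cases i <;> simp [c] <;> fun_prop
  have hgd : ∀ t, Real.exp t * Real.exp (-t) = 1 := fun t => by rw [← Real.exp_add]; simp
  let ζ : ℝ → Potential := fun t => ofCoords (c t) (Real.exp_pos t)
  have hζ : ∀ t, (ζ t).coords = c t := fun t => coords_ofCoords (Real.exp_pos t) (hgd t)
  have hζc : Continuous ζ :=
    isClosedEmbedding_coords.isInducing.continuous_iff.2 (by simpa only [Function.comp_def, hζ])
  have hp0 : p 0 = 2 := by simp [p]; norm_num
  have hζ0 : ζ 0 = stationary s := by
    refine coords_injective ?_
    rw [hζ, coords_stationary]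
    simp [c, hp0]
  have hlim : Tendsto ζ (𝓝[≠] 0) (𝓝 (stationary s)) :=
    hζ0 ▸ hζc.continuousAt.tendsto.mono_left nhdsWithin_le_nhds
  refine mem_closure_of_tendsto hlim ?_
  have hev : ∀ᶠ t in 𝓝[≠] (0 : ℝ), p t < e * s :=
    nhdsWithin_le_nhds (hpc.continuousAt.eventually_lt_const (hp0 ▸ hes))
  filter_upwards [hev, self_mem_nhdsWithin] with t ht ht0
  refine (mem_rootlessPart_stationary_iff hs).2 ⟨mem_isoSet_stationary_iff.2 ?_, fun h => ?_⟩
  · have hp2 : 2 ≤ p t := by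
      have hg := hgd t
      have := Real.exp_pos (-t)
      simp only [p]
      nlinarith [sq_nonneg (Real.exp t - 1)]
    have hsq := Real.sq_sqrt (mul_nonneg (sub_nonneg.2 hp2) (sub_nonneg.2 ht.le))
    have hpe : Real.exp t + Real.exp (-t) = p t := rfl
    rw [hζ]
    simp only [casimirRe, casimirIm, energy, c, Matrix.cons_val, hpe]
    generalize √((p t - 2) * (e * s - p t)) = v at *
    refine ⟨?_, ?_, ?_⟩
    · linear_combination v ^ 2 * h1 - e * hsq - (p t - 2) * s * he
    · linear_combination 2 * v ^ 2 * h3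
    · linear_combination 2 * v ^ 2 * h2 + 2 * hsq + (2 - p t) ^ 2 * he - 2 * hgd t +
        (Real.exp t + Real.exp (-t) + p t) * hpe
  · have := congrFun (congrArg coords h) 4
    rw [hζ, coords_stationary] at this
    simp [c] at this
    exact ht0 this

theorem closure_rootlessPart_stationary {s : ℝ} (hs : 4 < s ^ 2) :
    closure (rootlessPart (stationary s).specPoly) = isoSet (stationary s).specPoly := by
  refine Subset.antisymm (closure_minimal (fun _ h => h.1) (isCompact_isoSet _).isClosed) ?_
  intro ζ hζ
  by_cases h : ζ = stationary s
  · rw [h]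
    rcases le_or_gt 0 s with h0 | h0
    · exact stationary_mem_closure_of_sign hs (e := 1) (A := 0) (B := 1) (by norm_num)
        (by nlinarith) (by norm_num) (by norm_num) (by norm_num)
    · exact stationary_mem_closure_of_sign hs (e := -1) (A := 1) (B := 0) (by norm_num)
        (by nlinarith) (by norm_num) (by norm_num) (by norm_num)
  · exact subset_closure ((mem_rootlessPart_stationary_iff hs).2 ⟨hζ, h⟩)

/-- A nonreal root of a real quadratic with constant term 1 has modulus 1, so z is real, and z² ≠ 1
makes the discriminant positive. -/
theorem four_lt_sq_of_norm_ne_one {s : ℝ} {z : ℂ} (hz : ‖z‖ ≠ 1) (h : z ^ 2 - s * z + 1 = 0) :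
    4 < s ^ 2 := by
  have hn : z.re ^ 2 + z.im ^ 2 ≠ 1 := fun h => hz (by
    rw [← pow_left_inj₀ (norm_nonneg z) zero_le_one two_ne_zero, Complex.sq_norm,
      Complex.normSq_apply]
    linarith)
  have hre := congrArg Complex.re h
  have him := congrArg Complex.im h
  simp [pow_two] at hre him
  have hy : z.im = 0 := by
    have h0 : z.im * (2 * z.re - s) = 0 := by linarith
    refine (mul_eq_zero.1 h0).resolve_right fun h0 => hn ?_
    rw [show s = 2 * z.re by linarith] at hre
    linarith
  rw [hy] at hre hn
  have hx : 0 < z.re ^ 2 := sq_pos_of_ne_zero fun h0 => by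
    rw [h0] at hre
    norm_num at hre
  have hlt : 0 < (z.re ^ 2 - 1) ^ 2 := sq_pos_of_ne_zero fun h0 => hn (by linarith)
  have hs : (s * z.re) ^ 2 = (z.re ^ 2 + 1) ^ 2 := by
    rw [show s * z.re = z.re ^ 2 + 1 by linarith]
  rw [mul_pow] at hs
  by_contra! hle
  nlinarith

theorem exists_eq_specPoly_stationary {a : ℂ[X]} (ha : a ∈ spectralPolys5) :
    ∃ s : ℝ, 4 < s ^ 2 ∧ a = (stationary s).specPoly := by
  obtain ⟨⟨ζ, hζ⟩, z, w, hroots, -, hz, -⟩ := ha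
  have hprod := specPoly_eq_prod hζ hroots
  have hE : 0 ≤ energy ζ.coords := by unfold energy; positivity
  rw [show (X - C z) * ((X - C z) * ((X - C w) * (X - C w))) =
    X ^ 4 - C (2 * (z + w)) * X ^ 3 + C ((z + w) ^ 2 + 2 * (z * w)) * X ^ 2
      - C (2 * (z + w) * (z * w)) * X + C ((z * w) ^ 2) by
    simp only [map_mul, map_pow, map_add, map_ofNat]; ring, specPoly] at hprod
  have k0 := congrArg (coeff · 0) hprod
  have k1 := congrArg (coeff · 1) hprod
  have k2 := congrArg (coeff · 2) hprod
  have k3 := congrArg (coeff · 3) hprod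
  simp [coeff_one, coeff_X_pow, -map_add, -map_sub, -map_mul, -map_pow] at k0 k1 k2 k3
  have hI := Complex.I_sq
  -- The constant term gives (zw)² = 1. For zw = 1 the linear and cubic coefficients agree, so z + w
  -- is real; for zw = -1 it is imaginary and the energy (z + w)² - 2 would be negative.
  rcases sq_eq_sq_iff_eq_or_eq_neg.1 (k0.symm.trans (one_pow 2).symm) with h | h
  · rw [h] at k1 k2
    have hc2 : casimirIm ζ.coords = 0 := by
      have : (casimirIm ζ.coords : ℂ) * Complex.I = 0 := by linear_combination (k3 - k1) / 2
      simpa using this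
    rw [hc2, Complex.ofReal_zero, zero_mul] at k3
    obtain ⟨s, hs⟩ : ∃ s, s = casimirRe ζ.coords / 2 := ⟨_, rfl⟩
    have hc1 : casimirRe ζ.coords = 2 * s := by linarith
    rw [hc1] at k3
    push_cast at k3
    have hsum : z + w = s := by linear_combination k3 / 2
    have hen : energy ζ.coords = s ^ 2 + 2 := by
      rw [hsum] at k2
      have : ((energy ζ.coords : ℝ) : ℂ) = ((s ^ 2 + 2 : ℝ) : ℂ) := by
        push_cast
        linear_combination k2
      exact_mod_cast this
    refine ⟨s, four_lt_sq_of_norm_ne_one hz (by linear_combination z * hsum - h), ?_⟩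
    rw [← mem_isoSet_iff.1 hζ, ← mem_isoSet_iff, mem_isoSet_stationary_iff]
    exact ⟨hc1, hc2, hen⟩
  · exfalso
    rw [h] at k1 k2
    have hc1 : casimirRe ζ.coords = 0 := by
      have : (casimirRe ζ.coords : ℂ) = 0 := by linear_combination (-k1 - k3) / 2
      exact_mod_cast this
    rw [hc1, Complex.ofReal_zero] at k3
    have : ((energy ζ.coords : ℝ) : ℂ) = ((-(casimirIm ζ.coords ^ 2) / 4 - 2 : ℝ) : ℂ) := by
      push_cast
      linear_combination k2 + (casimirIm ζ.coords : ℂ) ^ 2 / 4 * hI +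
        ((z + w) / 2 - casimirIm ζ.coords * Complex.I / 4) * k3
    have h' : energy ζ.coords = -(casimirIm ζ.coords ^ 2) / 4 - 2 := by exact_mod_cast this
    nlinarith [sq_nonneg (casimirIm ζ.coords)]

end Potential

/-! ### Decomposition, non-compactness and the assembled theorem -/

namespace Potential

theorem isoSet_eq_union {s : ℝ} (hs : 4 < s ^ 2) {z : ℂ}
    (hz : (stationary s).specPoly.IsRoot z) :
    isoSet (stationary s).specPoly =
      rootlessPart (stationary s).specPoly ∪ vanishingPart (stationary s).specPoly z := by
  ext ζ
  rw [vanishingPart_stationary hs hz, mem_union, mem_rootlessPart_stationary_iff hs,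
    mem_singleton_iff]
  constructor
  · intro h
    by_cases he : ζ = stationary s
    · exact Or.inr he
    · exact Or.inl ⟨h, he⟩
  · rintro (h | rfl)
    · exact h.1
    · exact stationary_mem_isoSet s

theorem not_isCompact_rootlessPart_stationary {s : ℝ} (hs : 4 < s ^ 2) :
    ¬ IsCompact (rootlessPart (stationary s).specPoly) := by
  intro h
  have hmem : stationary s ∈ rootlessPart (stationary s).specPoly := by
    rw [← h.isClosed.closure_eq, closure_rootlessPart_stationary hs]
    exact stationary_mem_isoSet s
  exact ((mem_rootlessPart_stationary_iff hs).1 hmem).2 rfl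

end Potential

theorem theorem2p1 :
    ∃ φ : ℝ × ℝ → Potential → Potential,
      IsLaxAction φ ∧ ExtendsLocalLaxFlows φ ∧
      (∀ a : ℂ[X], IsCompact (isoSet a)) ∧
      (∀ a ∈ spectralPolys1,
        IsPotentialSubmanifold 2 (isoSet a) ∧
        (∀ ζ ∈ isoSet a, isoSet a = laxOrbit φ ζ) ∧
        Nonempty (isoSet a ≃ₜ Circle × Circle)) ∧
      (∀ a ∈ spectralPolys2,
        IsPotentialSubmanifold 1 (isoSet a) ∧
        ∀ ζ ∈ isoSet a, isoSet a = laxOrbit φ ζ) ∧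
      (∀ a ∈ spectralPolys3 ∪ spectralPolys4,
        ∃ ζ : Potential, isoSet a = {ζ} ∧ ∀ p : ℝ × ℝ, φ p ζ = ζ) ∧
      (∀ a ∈ spectralPolys5, ∀ z : ℂ, a.IsRoot z →
        isoSet a = rootlessPart a ∪ vanishingPart a z ∧
        Disjoint (rootlessPart a) (vanishingPart a z) ∧
        (rootlessPart a).Nonempty ∧
        (∀ ζ ∈ rootlessPart a, rootlessPart a = laxOrbit φ ζ) ∧
        IsPotentialSubmanifold 2 (rootlessPart a) ∧
        ¬ IsCompact (rootlessPart a) ∧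
        closure (rootlessPart a) = isoSet a ∧
        ∃ ζ : Potential, vanishingPart a z = {ζ} ∧ ∀ p : ℝ × ℝ, φ p ζ = ζ) := by
  refine ⟨Potential.laxFlow, Potential.isLaxAction_laxFlow,
    Potential.extendsLocalLaxFlows_laxFlow, Potential.isCompact_isoSet, ?_, ?_, ?_, ?_⟩
  · rintro a ⟨hne, -, hnodup, -⟩
    refine ⟨?_, Potential.isoSet_eq_laxOrbit_of_nodup hnodup,
      Potential.nonempty_homeomorph_isoSet_torus hnodup hne⟩
    rw [← Potential.rootlessPart_eq_isoSet_of_nodup hnodup]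
    exact Potential.isPotentialSubmanifold_rootlessPart a
  · rintro a ⟨-, μ, z, w, hroots, -, hμ, hz, -⟩
    exact Potential.isPotentialSubmanifold_and_eq_laxOrbit_of_roots (by simp [hroots])
      (by simp [hroots]) hμ hz
  · rintro a (⟨ha, μ, ν, hroots, hne, hμ, hν⟩ | ⟨ha, μ, hroots, hμ⟩)
    · exact Potential.exists_isoSet_eq_singleton_of_two_circle_roots ha (by simp [hroots])
        (by simp [hroots]) hne hμ hν
    · exact Potential.exists_isoSet_eq_singleton_of_quadruple_root ha hroots hμ
  · intro a ha z hz
    obtain ⟨s, hs, rfl⟩ := Potential.exists_eq_specPoly_stationary ha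
    refine ⟨Potential.isoSet_eq_union hs hz,
      Set.disjoint_left.2 fun ζ h h' => h.2 z h'.2, ?_,
      Potential.rootlessPart_stationary_eq_laxOrbit hs,
      Potential.isPotentialSubmanifold_rootlessPart _,
      Potential.not_isCompact_rootlessPart_stationary hs,
      Potential.closure_rootlessPart_stationary hs, Potential.stationary s,
      Potential.vanishingPart_stationary hs hz, fun p => Potential.laxFlow_stationary p s⟩
    rw [← closure_nonempty_iff, Potential.closure_rootlessPart_stationary hs]
    exact ha.1
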